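/- For positive integers $k,n$ let $S_n$ be the set of permutations of $[n]=\{1,\dots,n\}$, let $m_k(\sigma)$ be the number of monotone (increasing or decreasing) subsequences of length $k+1$ in $\sigma\in S_n$, and let $m_k(n)=\min\{m_k(\sigma):\sigma\in S_n\}$. Let $\tau_{k,n}\in S_n$ be the permutation whose one-line notation is obtained by concatenating, for $b=k-1,k-2,\dots,0$ in this order, the increasing runs $\lfloor bn/k\rfloor+1,\ \lfloor bn/k\rfloor+2,\ \dots,\ \lfloor (b+1)n/k\rfloor$. **Theorem.** There exist an integer $k_0\ge 2$ and a real number $c>0$ such that for all integers $k\ge k_0$ and $n\ge 1$ with $n\le k^2+c\,k^{3/2}/\log k$, $$m_k(n)=m_k(\tau_{k,n})=r\binom{\lceil n/k\rceil}{k+1}+(k-r)\binom{\lfloor n/k\rfloor}{k+1},$$ where $r\in\{0,\dots,k-1\}$ is determined by $r\equiv n \pmod k$. Moreover, for such $k$ and $n$, if $n\ne k^2+k+1$, then every $\sigma\in S_n$ with $m_k(\sigma)=m_k(n)$ contains monotone subsequences of length $k+1$ of at most one type: it contains no increasing subsequence of length $k+1$ or no decreasing subsequence of length $k+1$. -/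

import Mathlib

/-- The increasing subsequences of length `k + 1` of a permutation `σ` of an `n`-element linearly
ordered set (`Fin n` in place of `{1, …, n}`), recorded by their sets of positions. -/
def incSubseqs {n : ℕ} (k : ℕ) (σ : Equiv.Perm (Fin n)) : Finset (Finset (Fin n)) :=
  open Classical in
  (Finset.powersetCard (k + 1) Finset.univ).filter fun S => StrictMonoOn σ (S : Set (Fin n))

/-- The decreasing subsequences of length `k + 1` of `σ`, recorded by their sets of positions. -/
def decSubseqs {n : ℕ} (k : ℕ) (σ : Equiv.Perm (Fin n)) : Finset (Finset (Fin n)) :=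
  open Classical in
  (Finset.powersetCard (k + 1) Finset.univ).filter fun S => StrictAntiOn σ (S : Set (Fin n))

/-- `m_k(σ)`: the number of monotone subsequences of length `k + 1` in `σ`. -/
def monoCount {n : ℕ} (k : ℕ) (σ : Equiv.Perm (Fin n)) : ℕ :=
  (incSubseqs k σ ∪ decSubseqs k σ).card

/-- `m_k(n)`: the minimum of `m_k(σ)` over all permutations `σ` of an `n`-element set. -/
noncomputable def minMonoCount (k n : ℕ) : ℕ :=
  sInf (Set.range fun σ : Equiv.Perm (Fin n) => monoCount k σ)

/-- For `k > 0` and `q < n`, the unique `b < k` with `⌊b n / k⌋ ≤ q < ⌊(b + 1) n / k⌋`. -/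
def rowIndex (k n q : ℕ) : ℕ := ((q + 1) * k - 1) / n

theorem rowIndex_eq_iff {k n q b : ℕ} (hk : 0 < k) (hq : q < n) :
    rowIndex k n q = b ↔ b * n / k ≤ q ∧ q < (b + 1) * n / k := by
  have hn : 0 < n := by omega
  have h1 : 0 < (q + 1) * k := by positivity
  unfold rowIndex
  rw [Nat.div_eq_iff hn, ← Nat.lt_succ_iff (n := q), Nat.div_lt_iff_lt_mul hk,
    ← Nat.succ_le_iff (m := q) (n := (b + 1) * n / k), Nat.le_div_iff_mul_le hk]
  simp only [Nat.succ_eq_add_one, Nat.add_mul b 1 n, one_mul]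
  omega

theorem rowIndex_lt {k n q : ℕ} (hk : 0 < k) (hq : q < n) : rowIndex k n q < k := by
  have h2 : (q + 1) * k ≤ n * k := Nat.mul_le_mul_right k hq
  have h1 : 0 < (q + 1) * k := by positivity
  unfold rowIndex
  rw [Nat.div_lt_iff_lt_mul (by omega), mul_comm k n]
  omega

/-- The entry at position `p` (positions and values counted from `0`) of the sequence obtained by
writing one after another the rows `⌊b n / k⌋, ⌊b n / k⌋ + 1, …, ⌊(b + 1) n / k⌋ - 1` for
`b = k - 1, k - 2, …, 0`; see `tauVal_row`. Position `p` lies in the row that contains the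
value `n - 1 - p`. -/
def tauVal (k n p : ℕ) : ℕ :=
  rowIndex k n (n - 1 - p) * n / k + (rowIndex k n (n - 1 - p) + 1) * n / k - 1 - (n - 1 - p)

theorem row_le {k n b : ℕ} (hb : b < k) : (b + 1) * n / k ≤ n := by
  apply Nat.div_le_of_le_mul
  exact Nat.mul_le_mul_right n hb

/-- The row with index `b` starts at position `n - ⌊(b + 1) n / k⌋` (the number of entries in the
rows written before it) and reads `⌊b n / k⌋, ⌊b n / k⌋ + 1, …, ⌊(b + 1) n / k⌋ - 1`. -/
theorem tauVal_row {k n b i : ℕ} (hk : 0 < k) (hb : b < k)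
    (hi : b * n / k + i < (b + 1) * n / k) :
    tauVal k n (n - (b + 1) * n / k + i) = b * n / k + i := by
  have h := row_le (n := n) hb
  have hr : rowIndex k n (n - 1 - (n - (b + 1) * n / k + i)) = b := by
    generalize hx : n - 1 - (n - (b + 1) * n / k + i) = x
    generalize hh : (b + 1) * n / k = H at *
    generalize hl : b * n / k = L at *
    rw [rowIndex_eq_iff hk (by omega), hh, hl]
    omega
  unfold tauVal
  rw [hr]
  generalize (b + 1) * n / k = H at *
  generalize b * n / k = L at *
  omega

theorem tauVal_lt {k n p : ℕ} (hk : 0 < k) (hp : p < n) : tauVal k n p < n := by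
  have h := (rowIndex_eq_iff (n := n) (q := n - 1 - p) hk (by omega)).1 rfl
  have h' := row_le (n := n) (rowIndex_lt (n := n) (q := n - 1 - p) hk (by omega))
  unfold tauVal
  generalize (rowIndex k n (n - 1 - p) + 1) * n / k = H at *
  generalize rowIndex k n (n - 1 - p) * n / k = L at *
  omega

theorem tauVal_bijective {k n : ℕ} (hk : 0 < k) :
    Function.Bijective fun p : Fin n => (⟨tauVal k n p, tauVal_lt hk p.2⟩ : Fin n) := by
  apply Function.Surjective.bijective_of_finite
  rintro ⟨v, hv⟩
  have h := (rowIndex_eq_iff (q := v) hk hv).1 rfl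
  have hb := rowIndex_lt (q := v) hk hv
  have h' := row_le (n := n) hb
  have hrow := tauVal_row (n := n) (i := v - rowIndex k n v * n / k) hk hb (by
    generalize rowIndex k n v * n / k = L at *
    omega)
  generalize (rowIndex k n v + 1) * n / k = H at *
  generalize rowIndex k n v * n / k = L at *
  refine ⟨⟨n - H + (v - L), by omega⟩, ?_⟩
  apply Fin.ext
  show tauVal k n _ = v
  rw [hrow]
  omega

/-- The permutation `τ_{k,n}`, for `k > 0` (for `k = 0`, where it is not defined, the identity
serves as a default). -/
noncomputable def tau (k n : ℕ) : Equiv.Perm (Fin n) :=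
  if hk : 0 < k then Equiv.ofBijective _ (tauVal_bijective (n := n) hk) else 1

/-!
The increasing subsequences of a permutation `σ` are the chains of an order `incRel σ` on the
positions, and the decreasing ones are its antichains, which in turn are the chains of a second,
conjugate order `decRel σ` (`Conj`). So the theorem is about the number of chains and antichains
with `k + 1` elements in a finite ordered set `P`. It has the lower bound `extremal k #P`, the number
of such chains in a disjoint union of `k` chains of nearly equal size, and equality forces one of the
two kinds to be absent unless `#P = k² + k + 1` (`extremal_le_mono`). The permutation `τ` attains the
bound (`monoCount_tau_le`), its rows being the `k` chains.

The lower bound is proved by induction on `#P = k (k + j) + t`, where `1 ≤ t ≤ k`. The set is divided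
into levels according to the greatest size of a chain below an element. If no level has more than `k`
elements, the chains alone suffice (`extremal_le_card_chains`). If there is a chain with more than
`k + j` elements, one of its elements lies in a level with more than `k` elements, and this element
can be deleted (`extremal_le_mono_of_long_chain`); the conjugate order takes care of long antichains.
This leaves sets whose chains and antichains have at most `k + j` elements. For `j = 1` the longest
ones are counted exactly: removing the minimal elements layer after layer yields a bound in terms of
the least number of elements that meet all longest chains (`layerBound`, `layerBound_strict`,
`extremal_le_mono_of_height_width`).

For `j ≥ 2` suppose that the bound fails to be exceeded. Then there are fewer than `2 ^ Λ` chains and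
antichains, where `Λ` is of the order of `j log k`. Few antichains mean expansion from each level to
the next one (`expansion`), because many elements that are the only lower neighbour of another one
could be exchanged independently inside an antichain. Hence the number `maxBelow` of longest chains
below most elements is kept or doubled from level to level (`Bounded.step`), and it grows after each
big level, that is, one with more than `k` elements (`Bounded.raise`, `Bounded.climb`). On the other
hand, elements of `(k + 1)`-chains cannot have many longest chains below them (`maxBelow_lt`). In one
of two conjugate orders every set that meets all `(k + j)`-chains is large (`Bounded.robust_or`), so
that this limits the number of doublings and the surplus of the levels (`Tight.bounds`). Climbing from
the bottom, the big levels make most elements of the top level lie in so many `(k + 1)`-chains that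
cutting off this level contradicts the induction hypothesis (`Tight.false_of_cut`).

The climb falls short of this for two kinds of level sizes. If the top level is not big, just one
level with `k + j` elements remains possible (`Tight.profile`); here the antichains inside this level
and the next one complete the count (`Tight.false_of_one_big`). If the top level is big, the level
below it is cut off instead, where two upper neighbours double the number of chains
(`Tight.two_ends`). Comparing the order with its reverse covers all cases (`Tight.false`). The
error terms require `j L` to be small compared with `√k`, where `L` is of the order of `log k`
(`Sizes`), which is the source of the bound `n ≤ k² + c k ^ (3 / 2) / log k` (`exists_sizes`).
-/

namespace MonoCount

open Finset
open scoped Classical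

/-! ### Chains, antichains and rank -/

section Basics

variable {α : Type*} (r : α → α → Prop)

/-- The `m`-element `r`-chains contained in `P`. -/
noncomputable def chains (P : Finset α) (m : ℕ) : Finset (Finset α) :=
  {C ∈ P.powersetCard m | IsChain r (C : Set α)}

/-- The `m`-element `r`-antichains contained in `P`. -/
noncomputable def antis (P : Finset α) (m : ℕ) : Finset (Finset α) :=
  {C ∈ P.powersetCard m | IsAntichain r (C : Set α)}

/-- The elements of `P` strictly below `x`. -/
noncomputable def below (P : Finset α) (x : α) : Finset α := {y ∈ P | r y x}

/-- The rank of `x`: the largest size of a chain of `P` strictly below `x`. Minimal elements have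
rank `0`. -/
noncomputable def rk (P : Finset α) (x : α) : ℕ :=
  ((below r P x).powerset.filter fun C : Finset α => IsChain r (C : Set α)).sup card

/-- The number of longest chains strictly below `x`. -/
noncomputable def maxBelow (P : Finset α) (x : α) : ℕ := #(chains r (below r P x) (rk r P x))

/-- The elements of rank `i`. -/
noncomputable def level (P : Finset α) (i : ℕ) : Finset α := {x ∈ P | rk r P x = i}

variable {r} {P Q C A : Finset α} {x y z : α} {m k i : ℕ}

theorem mem_chains : C ∈ chains r P m ↔ C ⊆ P ∧ #C = m ∧ IsChain r (C : Set α) := by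
  simp [chains, mem_powersetCard, and_assoc]

theorem mem_antis : C ∈ antis r P m ↔ C ⊆ P ∧ #C = m ∧ IsAntichain r (C : Set α) := by
  simp [antis, mem_powersetCard, and_assoc]

theorem mem_below : y ∈ below r P x ↔ y ∈ P ∧ r y x := by simp [below]

theorem mem_level : x ∈ level r P i ↔ x ∈ P ∧ rk r P x = i := by simp [level]

theorem below_subset : below r P x ⊆ P := filter_subset _ _

theorem level_subset : level r P i ⊆ P := filter_subset _ _

theorem chains_mono (h : P ⊆ Q) : chains r P m ⊆ chains r Q m := by
  intro C hC
  rw [mem_chains] at *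
  exact ⟨hC.1.trans h, hC.2⟩

theorem antis_mono (h : P ⊆ Q) : antis r P m ⊆ antis r Q m := by
  intro C hC
  rw [mem_antis] at *
  exact ⟨hC.1.trans h, hC.2⟩

theorem exists_chain_of_le (hC : C ⊆ P) (hc : IsChain r (C : Set α)) (hm : m ≤ #C) :
    ∃ D ∈ chains r P m, D ⊆ C := by
  obtain ⟨D, hD, rfl⟩ := exists_subset_card_eq hm
  exact ⟨D, mem_chains.2 ⟨hD.trans hC, rfl, hc.mono (by exact_mod_cast hD)⟩, hD⟩

theorem exists_anti_of_le (hC : C ⊆ P) (hc : IsAntichain r (C : Set α)) (hm : m ≤ #C) :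
    ∃ D ∈ antis r P m, D ⊆ C := by
  obtain ⟨D, hD, rfl⟩ := exists_subset_card_eq hm
  exact ⟨D, mem_antis.2 ⟨hD.trans hC, rfl, hc.subset (by exact_mod_cast hD)⟩, hD⟩

theorem card_le_rk (hC : C ⊆ below r P x) (hc : IsChain r (C : Set α)) : #C ≤ rk r P x :=
  le_sup (f := card) (by simp [hC, hc])

theorem exists_rk_chain (r : α → α → Prop) (P : Finset α) (x : α) :
    ∃ C, C ⊆ below r P x ∧ IsChain r (C : Set α) ∧ #C = rk r P x := by
  obtain ⟨C, hC, h⟩ := exists_mem_eq_sup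
    (s := (below r P x).powerset.filter fun C : Finset α => IsChain r (C : Set α)) ⟨∅, by simp⟩ card
  simp only [mem_filter, mem_powerset] at hC
  exact ⟨C, hC.1, hC.2, h.symm⟩

theorem maxBelow_pos : 1 ≤ maxBelow r P x := by
  obtain ⟨C, h1, h2, h3⟩ := exists_rk_chain r P x
  exact card_pos.2 ⟨C, mem_chains.2 ⟨h1, h3, h2⟩⟩

theorem isChain_insert_above (hc : IsChain r (C : Set α)) (h : ∀ y ∈ C, r y x) :
    IsChain r ((insert x C : Finset α) : Set α) := by
  rw [coe_insert]
  exact hc.insert fun b hb _ => Or.inr (h b hb)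

theorem isChain_union_of_lt {D : Finset α} (hC : IsChain r (C : Set α))
    (hD : IsChain r (D : Set α)) (h : ∀ x ∈ C, ∀ y ∈ D, r x y) :
    IsChain r ((C ∪ D : Finset α) : Set α) := by
  intro x hx y hy hxy
  simp only [coe_union, Set.mem_union, mem_coe] at hx hy
  rcases hx with hx | hx <;> rcases hy with hy | hy
  · exact hC hx hy hxy
  · exact Or.inl (h x hx y hy)
  · exact Or.inr (h y hy x hx)
  · exact hD hx hy hxy

theorem card_eq_sum_level (h : ∀ x ∈ P, rk r P x < m) : #P = ∑ i ∈ range m, #(level r P i) :=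
  card_eq_sum_card_fiberwise fun x hx => by simpa using h x hx

theorem sum_eq_sum_level {β : Type*} [AddCommMonoid β] (h : ∀ x ∈ P, rk r P x < m) (f : α → β) :
    ∑ x ∈ P, f x = ∑ i ∈ range m, ∑ x ∈ level r P i, f x :=
  (sum_fiberwise_of_maps_to (fun x hx => by simpa using h x hx) f).symm

variable [IsStrictOrder α r]

theorem rk_lt_rk (hy : y ∈ P) (h : r y x) : rk r P y < rk r P x := by
  obtain ⟨C, h1, h2, h3⟩ := exists_rk_chain r P y
  have hyC : y ∉ C := fun h' => irrefl (r := r) y (mem_below.1 (h1 h')).2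
  have := card_le_rk (r := r) (P := P) (x := x) (C := insert y C) ?_
    (isChain_insert_above h2 fun z hz => (mem_below.1 (h1 hz)).2)
  · rw [card_insert_of_notMem hyC] at this
    omega
  · intro z hz
    rcases mem_insert.1 hz with rfl | hz
    · exact mem_below.2 ⟨hy, h⟩
    · have := mem_below.1 (h1 hz)
      exact mem_below.2 ⟨this.1, _root_.trans this.2 h⟩

theorem rk_injOn_chain (hC : C ⊆ P) (hc : IsChain r (C : Set α)) :
    Set.InjOn (rk r P) (C : Set α) := by
  intro x hx y hy h
  by_contra hne
  rcases hc hx hy hne with h' | h'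
  · exact absurd h (rk_lt_rk (hC hx) h').ne
  · exact absurd h (rk_lt_rk (hC hy) h').ne'

/-- A chain with as many elements as there are ranks available meets every level. -/
theorem exists_mem_rk_eq (hC : C ⊆ P) (hc : IsChain r (C : Set α))
    (h : ∀ x ∈ C, rk r P x < m) (hm : m ≤ #C) (hi : i < m) : ∃ x ∈ C, rk r P x = i := by
  have himg : C.image (rk r P) = range m := by
    apply eq_of_subset_of_card_le
    · intro j hj
      obtain ⟨x, hx, rfl⟩ := mem_image.1 hj
      simpa using h x hx
    · rw [card_image_of_injOn (rk_injOn_chain hC hc)]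
      simpa using hm
  have : i ∈ C.image (rk r P) := by rw [himg]; simpa using hi
  simpa using this

theorem exists_below_of_rk (hi : i < rk r P x) : ∃ y ∈ P, r y x ∧ rk r P y = i := by
  obtain ⟨C, h1, h2, h3⟩ := exists_rk_chain r P x
  obtain ⟨y, hy, h4⟩ := exists_mem_rk_eq (m := rk r P x) (i := i) (h1.trans below_subset) h2
    (fun z hz => by
      have := mem_below.1 (h1 hz)
      exact rk_lt_rk this.1 this.2) h3.ge hi
  exact ⟨y, (mem_below.1 (h1 hy)).1, (mem_below.1 (h1 hy)).2, h4⟩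

theorem rk_lt_of_chains_le
    (h : ∀ C ⊆ P, IsChain r (C : Set α) → #C ≤ m) (hx : x ∈ P) : rk r P x < m := by
  obtain ⟨C, h1, h2, h3⟩ := exists_rk_chain r P x
  have hxC : x ∉ C := fun h' => irrefl (r := r) x (mem_below.1 (h1 h')).2
  have := h (insert x C) (insert_subset hx (h1.trans below_subset))
    (isChain_insert_above h2 fun z hz => (mem_below.1 (h1 hz)).2)
  rw [card_insert_of_notMem hxC] at this
  omega

theorem level_antichain : IsAntichain r (level r P i : Set α) := by
  intro x hx y hy _ h
  have h1 := mem_level.1 (mem_coe.1 hx)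
  have h2 := mem_level.1 (mem_coe.1 hy)
  have := rk_lt_rk h1.1 h
  omega

/-- **Mirsky's theorem**, in the form of a bound for the number of elements. -/
theorem card_le_mul {p : ℕ} (h : ∀ C ⊆ P, IsChain r (C : Set α) → #C ≤ m)
    (h' : ∀ A ⊆ P, IsAntichain r (A : Set α) → #A ≤ p) : #P ≤ m * p := by
  rw [card_eq_sum_level (r := r) fun x hx => rk_lt_of_chains_le h hx]
  calc _ ≤ ∑ i ∈ range m, p := sum_le_sum fun i _ => h' _ level_subset level_antichain
    _ = _ := by simp

/-! ### Counting chains by their greatest element -/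

theorem insert_below_inj {x x' : α} {C C' : Finset α} (hC : C ⊆ below r Q x)
    (hC' : C' ⊆ below r Q x') (h : insert x C = insert x' C') : x = x' ∧ C = C' := by
  have key : x = x' := by
    by_contra hne
    have h1 : x ∈ insert x' C' := h ▸ mem_insert_self _ _
    have h2 : x' ∈ insert x C := h ▸ mem_insert_self _ _
    have h3 := (mem_below.1 (hC' ((mem_insert.1 h1).resolve_left hne))).2
    have h4 := (mem_below.1 (hC ((mem_insert.1 h2).resolve_left (Ne.symm hne)))).2
    exact asymm (r := r) h3 h4
  subst key
  refine ⟨rfl, ?_⟩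
  have h1 : x ∉ C := fun h' => irrefl (r := r) x (mem_below.1 (hC h')).2
  have h2 : x ∉ C' := fun h' => irrefl (r := r) x (mem_below.1 (hC' h')).2
  rw [← erase_insert h1, h, erase_insert h2]

/-- Families of chains strictly below the elements of `S` inject into the chains of `Q`. -/
theorem sum_card_below_le {S : Finset α} (ℱ : α → Finset (Finset α)) (𝒢 : Finset (Finset α))
    (hℱ : ∀ x ∈ S, ∀ C ∈ ℱ x, C ⊆ below r Q x)
    (h𝒢 : ∀ x ∈ S, ∀ C ∈ ℱ x, insert x C ∈ 𝒢) : ∑ x ∈ S, #(ℱ x) ≤ #𝒢 := by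
  rw [← card_sigma]
  apply card_le_card_of_injOn (fun p => insert p.1 p.2)
  · rintro ⟨x, C⟩ h
    simp only [mem_coe, mem_sigma] at h
    exact h𝒢 x h.1 C h.2
  · rintro ⟨x, C⟩ h ⟨x', C'⟩ h' he
    simp only [mem_coe, mem_sigma] at h h'
    obtain ⟨rfl, rfl⟩ := insert_below_inj (hℱ x h.1 C h.2) (hℱ x' h'.1 C' h'.2) he
    rfl

theorem insert_mem_chains (hx : x ∈ P) (hC : C ∈ chains r (below r P x) m) :
    insert x C ∈ chains r P (m + 1) := by
  obtain ⟨h1, h2, h3⟩ := mem_chains.1 hC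
  refine mem_chains.2 ⟨insert_subset hx (h1.trans below_subset), ?_,
    isChain_insert_above h3 fun y hy => (mem_below.1 (h1 hy)).2⟩
  rw [card_insert_of_notMem, h2]
  exact fun h' => irrefl (r := r) x (mem_below.1 (h1 h')).2

theorem sum_chains_below_le {S : Finset α} (hS : S ⊆ P) :
    ∑ x ∈ S, #(chains r (below r P x) m) ≤ #(chains r P (m + 1)) :=
  sum_card_below_le (Q := P) _ _ (fun _ _ _ hC => (mem_chains.1 hC).1)
    fun _ hx _ hC => insert_mem_chains (hS hx) hC

theorem below_below (h : r x z) : below r (below r P z) x = below r P x := by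
  ext y
  simp only [mem_below]
  exact ⟨fun h' => ⟨h'.1.1, h'.2⟩, fun h' => ⟨⟨h'.1, _root_.trans h'.2 h⟩, h'.2⟩⟩

theorem sum_maxBelow_le {S : Finset α} (hS : ∀ x ∈ S, x ∈ P ∧ r x z ∧ rk r P x + 1 = rk r P z) :
    ∑ x ∈ S, maxBelow r P x ≤ maxBelow r P z := by
  rcases S.eq_empty_or_nonempty with rfl | ⟨x0, hx0⟩
  · simp
  · have h0 := (hS x0 hx0).2.2
    have := sum_chains_below_le (r := r) (P := below r P z) (m := rk r P x0) (S := S)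
      fun x hx => mem_below.2 ⟨(hS x hx).1, (hS x hx).2.1⟩
    rw [h0] at this
    refine le_trans (sum_le_sum fun x hx => ?_) this
    rw [below_below (hS x hx).2.1, maxBelow]
    have := (hS x hx).2.2
    rw [show rk r P x = rk r P x0 by omega]

end Basics

section Subsets

variable {α : Type*} {r : α → α → Prop} {P : Finset α} {x : α} {k : ℕ}

/-! ### Subsets of a family of sets of equal size -/

/-- Adding the sets one by one, the `t`-th set `A` has at least `C(ℓ - t, k - t)` `k`-subsets
that are not contained in an earlier set: those that contain `t` points of `A`, each of which
separates `A` from one of the earlier sets. -/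
theorem sum_choose_le_card_subsets {ℓ k : ℕ} (𝒜 : Finset (Finset α)) (h : ∀ A ∈ 𝒜, #A = ℓ)
    (hk : #𝒜 ≤ k) :
    ∑ t ∈ range #𝒜, (ℓ - t).choose (k - t) ≤ #(𝒜.biUnion fun A => A.powersetCard k) := by
  induction 𝒜 using Finset.induction_on with
  | empty => simp
  | insert A 𝒜 hA ih =>
    rw [card_insert_of_notMem hA] at hk ⊢
    specialize ih (fun B hB => h B (mem_insert_of_mem hB)) (by omega)
    rw [sum_range_succ, biUnion_insert, union_comm, card_union]
    have hAl := h A (mem_insert_self _ _)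
    have hsep : ∀ B ∈ 𝒜, ∃ a ∈ A, a ∉ B := by
      intro B hB
      by_contra! hcon
      have : A = B := eq_of_subset_of_card_le hcon (by rw [hAl, h B (mem_insert_of_mem hB)])
      exact hA (this ▸ hB)
    choose f hf hf' using hsep
    set S := 𝒜.attach.image fun B => f B.1 B.2 with hS
    have hSA : S ⊆ A := by
      intro a ha
      obtain ⟨B, hB, rfl⟩ := mem_image.1 ha
      exact hf B.1 B.2
    have hScard : #S ≤ #𝒜 := card_image_le.trans card_attach.le
    have h1 : (ℓ - #𝒜).choose (k - #𝒜) ≤ (ℓ - #S).choose (k - #S) := by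
      rcases lt_or_ge ℓ k with hlk | hlk
      · rw [Nat.choose_eq_zero_of_lt (by omega)]
        exact Nat.zero_le _
      · rw [← Nat.choose_symm (n := ℓ - #𝒜) (by omega), ← Nat.choose_symm (n := ℓ - #S) (by omega),
          show ℓ - #𝒜 - (k - #𝒜) = ℓ - k by omega, show ℓ - #S - (k - #S) = ℓ - k by omega]
        exact Nat.choose_le_choose _ (by omega)
    have h2 : (ℓ - #S).choose (k - #S) ≤
        #((A.powersetCard k) \ (𝒜.biUnion fun A => A.powersetCard k)) := by
      have : (ℓ - #S).choose (k - #S) = #((A \ S).powersetCard (k - #S)) := by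
        rw [card_powersetCard, card_sdiff_of_subset hSA, hAl]
      rw [this]
      apply card_le_card_of_injOn fun B => B ∪ S
      · intro B hB
        simp only [mem_coe, mem_powersetCard, mem_sdiff, mem_biUnion, not_exists, not_and] at hB ⊢
        refine ⟨⟨union_subset (hB.1.trans sdiff_subset) hSA, ?_⟩, fun B' hB' hsub _ => ?_⟩
        · rw [card_union_of_disjoint (disjoint_of_subset_left hB.1 sdiff_disjoint), hB.2]
          omega
        · exact hf' B' hB' (hsub (mem_union_right _
            (mem_image.2 ⟨⟨B', hB'⟩, mem_attach _ _, rfl⟩)))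
      · intro B hB B' hB' he
        simp only [mem_coe, mem_powersetCard] at hB hB'
        have e1 := disjoint_of_subset_left hB.1 sdiff_disjoint
        have e2 := disjoint_of_subset_left hB'.1 sdiff_disjoint
        rw [← union_sdiff_cancel_right e1, ← union_sdiff_cancel_right e2]
        simp only at he
        rw [he]
    rw [card_sdiff] at h2
    have := card_le_card (inter_subset_right (s₁ := 𝒜.biUnion fun A => A.powersetCard k)
      (s₂ := A.powersetCard k))
    omega

/-- A lower bound for the number of `k`-chains below `x` in terms of a number `θ` of longest
chains below `x`. -/
theorem sum_choose_le_chains_below {θ : ℕ} (hθ : θ ≤ maxBelow r P x) (hk : θ ≤ k) :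
    ∑ t ∈ range θ, (rk r P x - t).choose (k - t) ≤ #(chains r (below r P x) k) := by
  obtain ⟨𝒜, h𝒜, rfl⟩ := exists_subset_card_eq hθ
  refine (sum_choose_le_card_subsets 𝒜 (fun A hA => (mem_chains.1 (h𝒜 hA)).2.1) hk).trans ?_
  apply card_le_card
  intro B hB
  obtain ⟨A, hA, hB⟩ := mem_biUnion.1 hB
  obtain ⟨h1, _, h3⟩ := mem_chains.1 (h𝒜 hA)
  obtain ⟨h4, h5⟩ := mem_powersetCard.1 hB
  exact mem_chains.2 ⟨h4.trans h1, h5, h3.mono (by exact_mod_cast h4)⟩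

theorem choose_rk_le_chains_below : (rk r P x).choose k ≤ #(chains r (below r P x) k) := by
  rcases k.eq_zero_or_pos with rfl | hk
  · simp only [Nat.choose_zero_right]
    exact card_pos.2 ⟨∅, mem_chains.2 (by simp)⟩
  · simpa using sum_choose_le_chains_below (r := r) (P := P) (x := x) maxBelow_pos hk

end Subsets

/-! ### The extremal number -/

/-- The number `∑_{i < n} C(⌊i / k⌋, k)` of `(k + 1)`-chains in a disjoint union of `k` chains whose
sizes add up to `n` and differ by at most one. -/
def extremal (k n : ℕ) : ℕ := ∑ i ∈ range n, (i / k).choose k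

theorem extremal_succ (k n : ℕ) : extremal k (n + 1) = extremal k n + (n / k).choose k :=
  sum_range_succ _ _

theorem extremal_eq {k : ℕ} (n : ℕ) :
    ∀ q t, t < k → n = k * q + t → extremal k n = k * q.choose (k + 1) + t * q.choose k := by
  induction n with
  | zero =>
    intro q t ht h
    have hq : q = 0 := by
      by_contra hq
      have : 0 < k * q := Nat.mul_pos (by omega) (by omega)
      omega
    have : t = 0 := by omega
    subst hq this
    simp [extremal]
  | succ n ih =>
    intro q t ht h
    rw [extremal_succ]
    rcases t.eq_zero_or_pos with rfl | ht0
    · obtain ⟨q, rfl⟩ : ∃ q', q = q' + 1 := ⟨q - 1, by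
        have : q ≠ 0 := by rintro rfl; omega
        omega⟩
      have hn : n = k * q + (k - 1) := by
        have : k * (q + 1) = k * q + k := by ring
        omega
      rw [ih q (k - 1) (by omega) hn, Nat.choose_succ_succ]
      have : n / k = q := by
        rw [hn, Nat.mul_add_div (by omega), Nat.div_eq_of_lt (by omega), add_zero]
      rw [this]
      obtain ⟨k, rfl⟩ : ∃ k', k = k' + 1 := ⟨k - 1, by omega⟩
      simp only [Nat.add_sub_cancel]
      ring
    · obtain ⟨t, rfl⟩ : ∃ t', t = t' + 1 := ⟨t - 1, by omega⟩
      have hn : n = k * q + t := by omega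
      rw [ih q t (by omega) hn]
      have : n / k = q := by
        rw [hn, Nat.mul_add_div (by omega), Nat.div_eq_of_lt (by omega), add_zero]
      rw [this]
      ring

/-- Same closed form with the remainder in `{1, …, k}`. -/
theorem extremal_eq' {k n q t : ℕ} (ht : t ≤ k) (ht0 : 1 ≤ t) (h : n = k * q + t) :
    extremal k n = k * q.choose (k + 1) + t * q.choose k := by
  rcases ht.lt_or_eq with h' | rfl
  · exact extremal_eq n q t h' h
  · rw [extremal_eq n (q + 1) 0 ht0 (by rw [h]; ring), Nat.choose_succ_succ]
    ring

theorem extremal_of_le {k n : ℕ} (h : n ≤ k * k) : extremal k n = 0 := by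
  apply sum_eq_zero
  intro i hi
  apply Nat.choose_eq_zero_of_lt
  rcases k.eq_zero_or_pos with rfl | hk
  · simp only [mul_zero, nonpos_iff_eq_zero] at h
    subst h
    simp at hi
  · exact Nat.div_lt_of_lt_mul (by simp at hi; omega)

/-- If every value is taken at most `k` times then the sum of `C(f x, k)` is smallest when the
values fill up from below. -/
theorem extremal_le_sum {α : Type*} {k : ℕ} (f : α → ℕ) (S : Finset α)
    (h : ∀ i, #{x ∈ S | f x = i} ≤ k) : extremal k #S ≤ ∑ x ∈ S, (f x).choose k := by
  induction hn : #S generalizing S with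
  | zero => simp [extremal]
  | succ n ih =>
    obtain ⟨x, hx, hmax⟩ := exists_max_image S f (card_pos.1 (by omega))
    have h1 : n / k ≤ f x := by
      have : #S ≤ k * (f x + 1) := by
        rw [mul_comm, ← card_range (f x + 1), ← smul_eq_mul]
        rw [card_eq_sum_card_fiberwise (f := f) (t := range (f x + 1))
          fun y hy => by simpa using Nat.lt_succ_of_le (hmax y hy)]
        exact sum_le_card_nsmul _ _ _ fun i _ => h i
      apply Nat.le_of_lt_succ
      exact Nat.div_lt_of_lt_mul (by rw [Nat.succ_eq_add_one]; omega)
    have h2 := ih (S.erase x)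
      (fun i => (card_le_card (filter_subset_filter _ (erase_subset _ _))).trans (h i))
      (by rw [card_erase_of_mem hx, hn]; rfl)
    rw [extremal_succ, ← sum_erase_add _ _ hx]
    exact add_le_add h2 (Nat.choose_le_choose _ h1)

/-! ### Conjugate orders, monotone sets and hitting sets -/

/-- Two relations are conjugate if any two distinct elements are comparable in exactly one of
them. -/
def Conj {α : Type*} (r s : α → α → Prop) : Prop :=
  ∀ x y, x ≠ y → ((s x y ∨ s y x) ↔ ¬(r x y ∨ r y x))

section

variable {α : Type*} {r s : α → α → Prop} {P Q C A Y : Finset α} {x y z : α} {m k i : ℕ}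

theorem Conj.symm (h : Conj r s) : Conj s r := fun x y hxy => by
  rw [h x y hxy, not_not]

theorem Conj.isChain_iff (h : Conj r s) {C : Set α} : IsChain s C ↔ IsAntichain r C := by
  constructor
  · intro hc x hx y hy hxy
    have := (h x y hxy).1 (hc hx hy hxy)
    exact fun h' => this (Or.inl h')
  · intro hc x hx y hy hxy
    refine (h x y hxy).2 ?_
    rintro (h' | h')
    · exact hc hx hy hxy h'
    · exact hc hy hx hxy.symm h'

theorem Conj.chains_eq (h : Conj r s) : chains s P m = antis r P m := by
  ext C
  rw [mem_chains, mem_antis, h.isChain_iff]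

theorem Conj.antis_eq (h : Conj r s) : antis s P m = chains r P m := h.symm.chains_eq.symm

/-- The number of `m`-element subsets of `P` that are a chain, plus the number of those that are an
antichain. -/
noncomputable def mono (r : α → α → Prop) (P : Finset α) (m : ℕ) : ℕ :=
  #(chains r P m) + #(antis r P m)

theorem Conj.mono_eq (h : Conj r s) : mono s P m = mono r P m := by
  rw [mono, mono, h.chains_eq, h.antis_eq, add_comm]

/-- The least size of a subset of `P` that meets all `m`-chains of `P`. -/
noncomputable def hit (r : α → α → Prop) (P : Finset α) (m : ℕ) : ℕ :=
  sInf {a | ∃ Y ⊆ P, (∀ C ∈ chains r P m, ∃ x ∈ C, x ∈ Y) ∧ #Y = a}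

theorem hit_le (hY : Y ⊆ P) (h : ∀ C ∈ chains r P m, ∃ x ∈ C, x ∈ Y) : hit r P m ≤ #Y :=
  Nat.sInf_le ⟨Y, hY, h, rfl⟩

/-- The same bound without the requirement that the meeting set is contained in `P`. -/
theorem hit_le_of_forall (h : ∀ C ∈ chains r P m, ∃ x ∈ C, x ∈ Y) : hit r P m ≤ #Y :=
  (hit_le (Y := Y ∩ P) inter_subset_right fun C hC => by
    obtain ⟨x, hx, hx'⟩ := h C hC
    exact ⟨x, hx, mem_inter.2 ⟨hx', (mem_chains.1 hC).1 hx⟩⟩).trans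
    (card_le_card inter_subset_left)

theorem exists_hit (r : α → α → Prop) (P : Finset α) (hm : 1 ≤ m) :
    ∃ Y ⊆ P, (∀ C ∈ chains r P m, ∃ x ∈ C, x ∈ Y) ∧ #Y = hit r P m := by
  have : {a | ∃ Y ⊆ P, (∀ C ∈ chains r P m, ∃ x ∈ C, x ∈ Y) ∧ #Y = a}.Nonempty := by
    refine ⟨#P, P, Subset.rfl, fun C hC => ?_, rfl⟩
    obtain ⟨h1, h2, _⟩ := mem_chains.1 hC
    obtain ⟨x, hx⟩ := card_pos.1 (by omega : 0 < #C)
    exact ⟨x, hx, h1 hx⟩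
  exact Nat.sInf_mem this

/-- A set meeting each chain exists with at most one element per chain. -/
theorem hit_le_card_chains (hm : 1 ≤ m) : hit r P m ≤ #(chains r P m) := by
  have : ∀ C ∈ chains r P m, ∃ x, x ∈ C := fun C hC =>
    card_pos.1 (by rw [(mem_chains.1 hC).2.1]; omega)
  choose f hf using this
  refine (hit_le_of_forall (Y := (chains r P m).attach.image fun C => f C.1 C.2) ?_).trans
    (card_image_le.trans card_attach.le)
  intro C hC
  exact ⟨f C hC, hf C hC, mem_image.2 ⟨⟨C, hC⟩, mem_attach _ _, rfl⟩⟩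

theorem card_chains_eq_erase_add (x : α) :
    #(chains r P m) = #(chains r (P.erase x) m) + #{C ∈ chains r P m | x ∈ C} := by
  rw [← card_filter_add_card_filter_not (s := chains r P m) (fun C => x ∈ C), add_comm]
  congr 2
  ext C
  simp only [mem_filter, mem_chains, subset_erase]
  tauto

theorem card_antis_eq_erase_add (x : α) :
    #(antis r P m) = #(antis r (P.erase x) m) + #{C ∈ antis r P m | x ∈ C} := by
  rw [← card_filter_add_card_filter_not (s := antis r P m) (fun C => x ∈ C), add_comm]
  congr 2
  ext C
  simp only [mem_filter, mem_antis, subset_erase]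
  tauto

/-- A chain `C` through `x` contains `C(#C - 1, k)` chains of size `k + 1` through `x`. -/
theorem choose_le_card_chains_mem (hC : C ⊆ P) (hc : IsChain r (C : Set α)) (hx : x ∈ C) :
    (#C - 1).choose k ≤ #{D ∈ chains r P (k + 1) | x ∈ D} := by
  rw [← card_erase_of_mem hx, ← card_powersetCard]
  apply card_le_card_of_injOn (insert x)
  · intro B hB
    obtain ⟨h1, h2⟩ := mem_powersetCard.1 (mem_coe.1 hB)
    have hxB : x ∉ B := fun h => notMem_erase x C (h1 h)
    have hsub : insert x B ⊆ C := insert_subset hx (h1.trans (erase_subset _ _))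
    simp only [coe_filter, Set.mem_ofPred_eq, mem_chains, mem_insert_self, and_true]
    exact ⟨hsub.trans hC, by rw [card_insert_of_notMem hxB, h2],
      hc.mono (by exact_mod_cast hsub)⟩
  · intro B hB B' hB' h
    have h1 := (mem_powersetCard.1 (mem_coe.1 hB)).1
    have h2 := (mem_powersetCard.1 (mem_coe.1 hB')).1
    rw [← erase_insert (fun h => notMem_erase x C (h1 h) : x ∉ B),
      ← erase_insert (fun h => notMem_erase x C (h2 h) : x ∉ B'), h]

/-- An element of an antichain with at least `k + 1` elements lies in a `(k + 1)`-antichain. -/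
theorem exists_anti_mem (hA : A ⊆ P) (ha : IsAntichain r (A : Set α)) (hx : x ∈ A)
    (h : k + 1 ≤ #A) : ∃ D ∈ antis r P (k + 1), x ∈ D := by
  obtain ⟨D, h1, h2, h3⟩ := exists_subsuperset_card_eq (singleton_subset_iff.2 hx)
    (by simp : #{x} ≤ k + 1) h
  exact ⟨D, mem_antis.2 ⟨h2.trans hA, h3, ha.subset (by exact_mod_cast h2)⟩,
    h1 (mem_singleton_self x)⟩

theorem disjoint_chains_antis (hk : 2 ≤ m) : Disjoint (chains r P m) (antis r P m) := by
  rw [disjoint_left]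
  intro C h1 h2
  obtain ⟨_, h3, h4⟩ := mem_chains.1 h1
  obtain ⟨_, _, h5⟩ := mem_antis.1 h2
  obtain ⟨x, hx, y, hy, hxy⟩ := one_lt_card.1 (by omega : 1 < #C)
  rcases h4 hx hy hxy with h | h
  · exact h5 hx hy hxy h
  · exact h5 hy hx hxy.symm h

variable [IsStrictOrder α r]

/-- If there is no level with more than `k` elements, the chains alone reach the extremal number. -/
theorem extremal_le_card_chains (h : ∀ i, #(level r P i) ≤ k) :
    extremal k #P ≤ #(chains r P (k + 1)) :=
  (extremal_le_sum (rk r P) P h).trans ((sum_le_sum fun _ _ => choose_rk_le_chains_below).trans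
    (sum_chains_below_le Subset.rfl))

/-- A chain that is too long: some element of it lies in more monotone sets than the last element
adds to the extremal number, or else no level is large. -/
theorem extremal_le_mono_of_long_chain {j : ℕ} (hn : k * (k + j) < #P)
    (hn' : #P ≤ k * (k + j) + k) (hW : ∀ Q ⊆ P, #Q + 1 = #P → extremal k #Q ≤ mono r Q (k + 1))
    (hC : C ⊆ P) (hc : IsChain r (C : Set α)) (hlong : k + j + 1 ≤ #C) :
    extremal k #P ≤ mono r P (k + 1) ∧
      ((antis r P (k + 1)).Nonempty → extremal k #P < mono r P (k + 1)) := by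
  have hk : 0 < k := by
    rcases k.eq_zero_or_pos with rfl | hk
    · omega
    · exact hk
  by_cases hd : ∀ i, #(level r P i) ≤ k
  · have := extremal_le_card_chains hd
    refine ⟨this.trans (Nat.le_add_right _ _), fun h => ?_⟩
    have := card_pos.2 h
    unfold mono
    omega
  · push Not at hd
    obtain ⟨i, hi⟩ := hd
    -- a chain of maximum size meets every level
    obtain ⟨M, hM, hmax⟩ := exists_max_image (P.powerset.filter fun C : Finset α =>
      IsChain r (C : Set α)) card ⟨C, by simp [hC, hc]⟩
    simp only [mem_filter, mem_powerset, and_imp] at hM hmax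
    have hrk : ∀ x ∈ P, rk r P x < #M := fun x hx => rk_lt_of_chains_le hmax hx
    have hiM : i < #M := by
      obtain ⟨x, hx⟩ := card_pos.1 (by omega : 0 < #(level r P i))
      have := mem_level.1 hx
      rw [← this.2]
      exact hrk x this.1
    obtain ⟨x, hxM, hxi⟩ := exists_mem_rk_eq hM.1 hM.2 (fun x hx => hrk x (hM.1 hx)) le_rfl hiM
    have hxP := hM.1 hxM
    obtain ⟨D, hD, hxD⟩ := exists_anti_mem (r := r) level_subset level_antichain
      (mem_level.2 ⟨hxP, hxi⟩) hi
    have h1 := choose_le_card_chains_mem (k := k) hM.1 hM.2 hxM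
    have h2 : 1 ≤ #{D ∈ antis r P (k + 1) | x ∈ D} := card_pos.2 ⟨D, mem_filter.2 ⟨hD, hxD⟩⟩
    have h3 := hW (P.erase x) (erase_subset _ _) (card_erase_add_one hxP)
    have h4 : extremal k #P = extremal k #(P.erase x) + (k + j).choose k := by
      rw [← card_erase_add_one hxP, extremal_succ]
      congr 2
      rw [← card_erase_add_one hxP] at hn hn'
      exact Nat.div_eq_of_lt_le (by rw [mul_comm]; omega)
        (by rw [Nat.add_mul, mul_comm (k + j)]; omega)
    have h5 : (k + j).choose k ≤ (#M - 1).choose k :=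
      Nat.choose_le_choose _ (by have := hmax C hC hc; omega)
    have h6 := card_chains_eq_erase_add (r := r) (P := P) (m := k + 1) x
    have h7 := card_antis_eq_erase_add (r := r) (P := P) (m := k + 1) x
    unfold mono at *
    exact ⟨by omega, fun _ => by omega⟩

theorem card_le_sq (h1 : chains r P (k + 1) = ∅) (h2 : antis r P (k + 1) = ∅) : #P ≤ k * k := by
  refine card_le_mul (r := r) (fun C hC hc => ?_) (fun C hC hc => ?_)
  · by_contra! hlt
    obtain ⟨D, hD, -⟩ := exists_chain_of_le hC hc hlt
    simp [h1] at hD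
  · by_contra! hlt
    obtain ⟨D, hD, -⟩ := exists_anti_of_le hC hc hlt
    simp [h2] at hD

/-- Deleting a set that meets all chains and antichains of size `k + 1` leaves at most `k²`
elements. -/
theorem card_le_of_hits (h1 : ∀ C ∈ chains r P (k + 1), ∃ x ∈ C, x ∈ Y)
    (h2 : ∀ C ∈ antis r P (k + 1), ∃ x ∈ C, x ∈ Y) : #P ≤ k * k + #Y := by
  have : #(P \ Y) ≤ k * k := by
    refine card_le_sq (r := r) ?_ ?_ <;> refine eq_empty_of_forall_notMem fun C hC => ?_
    · obtain ⟨x, hx, hy⟩ := h1 C (chains_mono sdiff_subset hC)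
      exact (mem_sdiff.1 ((mem_chains.1 hC).1 hx)).2 hy
    · obtain ⟨x, hx, hy⟩ := h2 C (antis_mono sdiff_subset hC)
      exact (mem_sdiff.1 ((mem_antis.1 hC).1 hx)).2 hy
  have := le_card_sdiff Y P
  omega

theorem mono_ge_sub (hk : 1 ≤ k) : #P ≤ k * k + mono r P (k + 1) := by
  have : ∀ C ∈ chains r P (k + 1) ∪ antis r P (k + 1), ∃ x, x ∈ C := fun C hC =>
    card_pos.1 (by
      rcases mem_union.1 hC with h | h
      · rw [(mem_chains.1 h).2.1]; omega
      · rw [(mem_antis.1 h).2.1]; omega)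
  choose f hf using this
  set Y := (chains r P (k + 1) ∪ antis r P (k + 1)).attach.image fun C => f C.1 C.2
  have hY : ∀ C ∈ chains r P (k + 1) ∪ antis r P (k + 1), ∃ x ∈ C, x ∈ Y := fun C hC =>
    ⟨f C hC, hf C hC, mem_image.2 ⟨⟨C, hC⟩, mem_attach _ _, rfl⟩⟩
  refine (card_le_of_hits (r := r) (Y := Y) (fun C hC => hY C (mem_union_left _ hC))
    fun C hC => hY C (mem_union_right _ hC)).trans ?_
  have : #Y ≤ _ := card_image_le.trans card_attach.le
  rw [card_union_of_disjoint (disjoint_chains_antis (by omega))] at this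
  unfold mono
  omega

/-- If there are no more monotone sets than the size of `P` forces then they are pairwise
disjoint: a common point of two of them could be deleted in place of two points. -/
theorem disjoint_of_mono_eq (hk : 1 ≤ k) (h : #P = k * k + mono r P (k + 1)) {M M' : Finset α}
    (hM : M ∈ chains r P (k + 1) ∪ antis r P (k + 1))
    (hM' : M' ∈ chains r P (k + 1) ∪ antis r P (k + 1)) (hne : M ≠ M') : Disjoint M M' := by
  rw [disjoint_left]
  intro x hx hx'
  set 𝓜 := chains r P (k + 1) ∪ antis r P (k + 1) with h𝓜
  have hcard : #𝓜 = mono r P (k + 1) := card_union_of_disjoint (disjoint_chains_antis (by omega))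
  have : ∀ C ∈ 𝓜, ∃ x, x ∈ C := fun C hC => card_pos.1 (by
      rcases mem_union.1 hC with h | h
      · rw [(mem_chains.1 h).2.1]; omega
      · rw [(mem_antis.1 h).2.1]; omega)
  choose f hf using this
  set Y := insert x (((𝓜.erase M).erase M').attach.image fun C =>
    f C.1 (mem_of_mem_erase (mem_of_mem_erase C.2)))
  have hY : ∀ C ∈ 𝓜, ∃ x ∈ C, x ∈ Y := by
    intro C hC
    by_cases h1 : C = M
    · exact ⟨x, h1 ▸ hx, mem_insert_self _ _⟩
    by_cases h2 : C = M'
    · exact ⟨x, h2 ▸ hx', mem_insert_self _ _⟩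
    have h3 : C ∈ (𝓜.erase M).erase M' := mem_erase.2 ⟨h2, mem_erase.2 ⟨h1, hC⟩⟩
    exact ⟨f C hC, hf C hC, mem_insert_of_mem (mem_image.2 ⟨⟨C, h3⟩, mem_attach _ _, rfl⟩)⟩
  have h1 := card_le_of_hits (r := r) (Y := Y) (fun C hC => hY C (mem_union_left _ hC))
    fun C hC => hY C (mem_union_right _ hC)
  have h2 : #Y ≤ #((𝓜.erase M).erase M') + 1 :=
    (card_insert_le _ _).trans (Nat.add_le_add_right (card_image_le.trans card_attach.le) 1)
  have h3 := card_erase_add_one (mem_erase.2 ⟨hne.symm, hM'⟩ : M' ∈ 𝓜.erase M)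
  have h4 := card_erase_add_one hM
  omega

/-- For at most `k² + k` elements the extremal number is `#P - k²` (or `0`), which bounds the
number of monotone sets because deleting a point of each of them leaves at most `k²` elements.
In the case of equality the monotone sets are pairwise disjoint. If both kinds occur, delete one
point of each chain: a level with more than `k` elements remains, and what remains of a `(k +
1)`-chain meets it, so that this chain meets a `(k + 1)`-antichain. -/
theorem extremal_le_mono_of_small (hk : 1 ≤ k) (hn : #P ≤ k * k + k) :
    extremal k #P ≤ mono r P (k + 1) ∧ ((chains r P (k + 1)).Nonempty →
      (antis r P (k + 1)).Nonempty → extremal k #P < mono r P (k + 1)) := by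
  rcases le_or_gt #P (k * k) with h | h
  · rw [extremal_of_le h]
    refine ⟨Nat.zero_le _, fun h1 _ => ?_⟩
    have := card_pos.2 h1
    unfold mono
    omega
  have hF : extremal k #P = #P - k * k := by
    rw [extremal_eq' (k := k) (q := k) (t := #P - k * k) (by omega) (by omega) (by omega)]
    simp
  have hW := mono_ge_sub (r := r) (P := P) hk
  refine ⟨by omega, fun h1 h2 => ?_⟩
  by_contra! hle
  have heq : #P = k * k + mono r P (k + 1) := by omega
  have hdisj := fun M M' hM hM' => disjoint_of_mono_eq (M := M) (M' := M') hk heq hM hM'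
  -- delete one element from each `(k + 1)`-chain
  have : ∀ C ∈ chains r P (k + 1), ∃ x, x ∈ C := fun C hC =>
    card_pos.1 (by rw [(mem_chains.1 hC).2.1]; omega)
  choose f hf using this
  set Y := (chains r P (k + 1)).attach.image fun C => f C.1 C.2 with hYdef
  have hYc : #Y ≤ #(chains r P (k + 1)) := card_image_le.trans card_attach.le
  have hch : ∀ C ⊆ P \ Y, IsChain r (C : Set α) → #C ≤ k := by
    intro C hC hc
    by_contra! hlt
    obtain ⟨D, hD, -⟩ := exists_chain_of_le hC hc hlt
    have hD' := chains_mono (sdiff_subset (s := P) (t := Y)) hD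
    exact (mem_sdiff.1 ((mem_chains.1 hD).1 (hf D hD'))).2
      (mem_image.2 ⟨⟨D, hD'⟩, mem_attach _ _, rfl⟩)
  have hrk : ∀ x ∈ P \ Y, rk r (P \ Y) x < k := fun x hx => rk_lt_of_chains_le hch hx
  obtain ⟨i, hi, hlev⟩ : ∃ i < k, k + 1 ≤ #(level r (P \ Y) i) := by
    by_contra! hcon
    have h3 : #(P \ Y) ≤ k * k := by
      rw [card_eq_sum_level hrk]
      calc _ ≤ ∑ i ∈ range k, k := sum_le_sum fun i hi => by
            have := hcon i (by simpa using hi); omega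
        _ = _ := by simp
    have h4 := le_card_sdiff Y P
    have h5 := card_pos.2 h2
    unfold mono at heq
    omega
  obtain ⟨C, hC⟩ := h1
  have hCP := mem_chains.1 hC
  have hCY : C \ Y = C.erase (f C hC) := by
    ext x
    simp only [mem_sdiff, mem_erase, hYdef, mem_image, mem_attach, true_and, Subtype.exists,
      not_exists]
    constructor
    · rintro ⟨h3, h4⟩
      exact ⟨fun h5 => h4 C hC h5.symm, h3⟩
    · rintro ⟨h3, h4⟩
      refine ⟨h4, fun D hD h5 => ?_⟩
      have hne : C ≠ D := by
        rintro rfl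
        exact h3 h5.symm
      exact (disjoint_left.1 (hdisj C D (mem_union_left _ hC) (mem_union_left _ hD) hne) h4)
        (h5 ▸ hf D hD)
  have hsub : C \ Y ⊆ P \ Y := sdiff_subset_sdiff hCP.1 Subset.rfl
  obtain ⟨x, hx, hxi⟩ := exists_mem_rk_eq (m := k) (i := i) hsub
    (hCP.2.2.mono (by exact_mod_cast sdiff_subset)) (fun x hx => hrk x (hsub hx))
    (by rw [hCY, card_erase_of_mem (hf C hC), hCP.2.1]; omega) hi
  obtain ⟨D, hD, hxD⟩ := exists_anti_mem (P := P) (k := k) (r := r)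
    (level_subset.trans sdiff_subset) level_antichain (mem_level.2 ⟨hsub hx, hxi⟩) hlev
  have hne : C ≠ D := by
    rintro rfl
    exact disjoint_left.1 (disjoint_chains_antis (r := r) (by omega)) hC hD
  exact disjoint_left.1 (hdisj C D (mem_union_left _ hC) (mem_union_right _ hD) hne)
    (mem_sdiff.1 hx).1 hxD

end

/-! ### Exchanging elements of an antichain -/

section

variable {α : Type*} {r s : α → α → Prop} {P Q A Z W : Finset α} {x y z : α} {m k i p q : ℕ}

/-- If each `z ∈ Z` is comparable to no element of the antichain `A` other than `ξ z`, then the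
elements `ξ z` can be replaced by `z` independently of each other. -/
theorem isAntichain_exchange (ξ : α → α) (hA : IsAntichain r (A : Set α))
    (hZ : IsAntichain r (Z : Set α)) (h : ∀ z ∈ Z, ∀ a ∈ A, (r a z ∨ r z a) → a = ξ z)
    {S : Finset α} (hS : S ⊆ Z) : IsAntichain r ((A \ S.image ξ ∪ S : Finset α) : Set α) := by
  intro x hx y hy hxy hr
  simp only [coe_union, Set.mem_union, mem_coe, mem_sdiff, mem_image, not_exists, not_and] at hx hy
  rcases hx with hx | hx <;> rcases hy with hy | hy
  · exact hA hx.1 hy.1 hxy hr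
  · exact hx.2 y hy (h y (hS hy) x hx.1 (Or.inl hr)).symm
  · exact hy.2 x hx (h x (hS hx) y hy.1 (Or.inr hr)).symm
  · exact hZ (hS hx) (hS hy) hxy hr

theorem card_exchange (ξ : α → α) (hξ : ∀ z ∈ Z, ξ z ∈ A) (hinj : Set.InjOn ξ Z)
    (hd : Disjoint A Z) {S : Finset α} (hS : S ⊆ Z) : #(A \ S.image ξ ∪ S) = #A := by
  have h1 : S.image ξ ⊆ A := by
    intro y hy
    obtain ⟨z, hz, rfl⟩ := mem_image.1 hy
    exact hξ z (hS hz)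
  rw [card_union_of_disjoint, card_sdiff_of_subset h1,
    card_image_of_injOn (hinj.mono (by exact_mod_cast hS))]
  · have := card_le_card h1
    rw [card_image_of_injOn (hinj.mono (by exact_mod_cast hS))] at this
    omega
  · exact disjoint_of_subset_left sdiff_subset (disjoint_of_subset_right hS hd)

theorem exchange_injective (ξ : α → α) (hd : Disjoint A Z) {S T : Finset α} (hS : S ⊆ Z)
    (hT : T ⊆ Z) (h : A \ S.image ξ ∪ S = A \ T.image ξ ∪ T) : S = T := by
  have key : ∀ S ⊆ Z, (A \ S.image ξ ∪ S) ∩ Z = S := by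
    intro S hS
    ext x
    simp only [mem_inter, mem_union, mem_sdiff]
    constructor
    · rintro ⟨⟨h1, _⟩ | h1, h2⟩
      · exact absurd h2 (disjoint_left.1 hd h1)
      · exact h1
    · exact fun h1 => ⟨Or.inr h1, hS h1⟩
  rw [← key S hS, h, key T hT]

/-- Independent exchanges produce exponentially many antichains; `𝒮` selects the sets of elements
that are exchanged. -/
theorem card_le_card_antis_exchange (ξ : α → α) (hAP : A ⊆ P) (hZP : Z ⊆ P)
    (hA : IsAntichain r (A : Set α)) (hZ : IsAntichain r (Z : Set α))
    (hξ : ∀ z ∈ Z, ξ z ∈ A) (hinj : Set.InjOn ξ Z) (hd : Disjoint A Z)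
    (h : ∀ z ∈ Z, ∀ a ∈ A, (r a z ∨ r z a) → a = ξ z) (p : Finset α → Prop)
    [DecidablePred p] (𝒮 : Finset (Finset α)) (h𝒮 : ∀ S ∈ 𝒮, S ⊆ Z ∧ p (A \ S.image ξ ∪ S)) :
    #𝒮 ≤ #{B ∈ antis r P #A | p B} := by
  apply card_le_card_of_injOn fun S => A \ S.image ξ ∪ S
  · intro S hS
    have h1 := h𝒮 S hS
    simp only [coe_filter, Set.mem_ofPred_eq, mem_antis]
    exact ⟨⟨union_subset (sdiff_subset.trans hAP) (h1.1.trans hZP),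
      card_exchange ξ hξ hinj hd h1.1, isAntichain_exchange ξ hA hZ h h1.1⟩, h1.2⟩
  · intro S hS T hT he
    exact exchange_injective ξ hd (h𝒮 S hS).1 (h𝒮 T hT).1 he

theorem two_pow_le_card_antis (ξ : α → α) (hAP : A ⊆ P) (hZP : Z ⊆ P)
    (hA : IsAntichain r (A : Set α)) (hZ : IsAntichain r (Z : Set α))
    (hξ : ∀ z ∈ Z, ξ z ∈ A) (hinj : Set.InjOn ξ Z) (hd : Disjoint A Z)
    (h : ∀ z ∈ Z, ∀ a ∈ A, (r a z ∨ r z a) → a = ξ z) : 2 ^ #Z ≤ #(antis r P #A) := by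
  rw [← card_powerset]
  refine (card_le_card_antis_exchange ξ hAP hZP hA hZ hξ hinj hd h (fun _ => True) Z.powerset
    fun S hS => ⟨mem_powerset.1 hS, trivial⟩).trans (card_le_card (filter_subset _ _))

/-! ### Removing the minimal elements -/

/-- `P` without its minimal elements. -/
noncomputable def peel (r : α → α → Prop) (P : Finset α) : Finset α := P \ level r P 0

/-- The minimal elements of `P` below `z`. -/
noncomputable def feet (r : α → α → Prop) (P : Finset α) (z : α) : Finset α :=
  {x ∈ level r P 0 | r x z}

/-- The least elements of the `q`-chains of `P`. -/
noncomputable def bots (r : α → α → Prop) (P : Finset α) (q : ℕ) : Finset α :=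
  {z ∈ P | ∃ C ∈ chains r P q, z ∈ C ∧ ∀ y ∈ C, y ≠ z → r z y}

theorem mem_feet : x ∈ feet r P z ↔ x ∈ level r P 0 ∧ r x z := by simp [feet]

theorem mem_bots : z ∈ bots r P q ↔
    z ∈ P ∧ ∃ C ∈ chains r P q, z ∈ C ∧ ∀ y ∈ C, y ≠ z → r z y := by simp [bots]

theorem bots_subset : bots r P q ⊆ P := filter_subset _ _

theorem peel_subset : peel r P ⊆ P := sdiff_subset

theorem disjoint_level_peel : Disjoint (level r P 0) (peel r P) := disjoint_sdiff

theorem card_peel : #(peel r P) + #(level r P 0) = #P := by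
  rw [peel, card_sdiff_add_card_eq_card level_subset]

theorem isChain_insert_below {C : Finset α} (hc : IsChain r (C : Set α)) (h : ∀ y ∈ C, r x y) :
    IsChain r ((insert x C : Finset α) : Set α) := by
  rw [coe_insert]
  exact hc.insert fun b hb _ => Or.inl (h b hb)

variable [IsStrictOrder α r]

/-- A nonempty finite chain has a least element. -/
theorem exists_chain_bot {C : Finset α} (hc : IsChain r (C : Set α)) (hne : C.Nonempty) :
    ∃ x ∈ C, ∀ y ∈ C, y ≠ x → r x y := by
  obtain ⟨x, hx, h⟩ := exists_min_image C (rk r C) hne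
  refine ⟨x, hx, fun y hy hyx => ?_⟩
  rcases hc hy hx hyx with h' | h'
  · have := rk_lt_rk (P := C) hy h'
    have := h y hy
    omega
  · exact h'

theorem not_rel_level_zero (hx : x ∈ level r P 0) (hy : y ∈ P) : ¬r y x := by
  intro h
  have := rk_lt_rk hy h
  have := (mem_level.1 hx).2
  omega

theorem feet_nonempty (hz : z ∈ peel r P) : (feet r P z).Nonempty := by
  obtain ⟨h1, h2⟩ := mem_sdiff.1 hz
  have : 0 < rk r P z := by
    by_contra! h
    exact h2 (mem_level.2 ⟨h1, by omega⟩)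
  obtain ⟨y, h3, h4, h5⟩ := exists_below_of_rk this
  exact ⟨y, mem_feet.2 ⟨mem_level.2 ⟨h3, h5⟩, h4⟩⟩

theorem chains_peel_le (h : ∀ C ⊆ P, IsChain r (C : Set α) → #C ≤ q + 1) :
    ∀ C ⊆ peel r P, IsChain r (C : Set α) → #C ≤ q := by
  intro C hC hc
  rcases C.eq_empty_or_nonempty with rfl | hne
  · simp
  obtain ⟨z, hz, hbot⟩ := exists_chain_bot hc hne
  obtain ⟨x, hx⟩ := feet_nonempty (hC hz)
  obtain ⟨h1, h2⟩ := mem_feet.1 hx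
  have hxC : x ∉ C := fun h' => disjoint_left.1 disjoint_level_peel h1 (hC h')
  have := h (insert x C) (insert_subset (level_subset h1) (hC.trans peel_subset))
    (isChain_insert_below hc fun y hy => by
      by_cases hyz : y = z
      · exact hyz ▸ h2
      · exact _root_.trans h2 (hbot y hy hyz))
  rw [card_insert_of_notMem hxC] at this
  omega

theorem bots_hit (hq : 1 ≤ q) : ∀ C ∈ chains r P q, ∃ x ∈ C, x ∈ bots r P q := by
  intro C hC
  obtain ⟨h1, h2, h3⟩ := mem_chains.1 hC
  obtain ⟨x, hx, h⟩ := exists_chain_bot h3 (card_pos.1 (by omega))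
  exact ⟨x, hx, mem_bots.2 ⟨h1 hx, C, hC, hx, h⟩⟩

theorem bots_antichain (h : ∀ C ⊆ P, IsChain r (C : Set α) → #C ≤ q) :
    IsAntichain r (bots r P q : Set α) := by
  intro z hz z' hz' _ hr
  obtain ⟨_, C, hC, h1, h2⟩ := mem_bots.1 (mem_coe.1 hz')
  obtain ⟨h3, h4, h5⟩ := mem_chains.1 hC
  have hlt : ∀ y ∈ C, r z y := fun y hy => by
    by_cases hyz : y = z'
    · exact hyz ▸ hr
    · exact _root_.trans hr (h2 y hy hyz)
  have hzC : z ∉ C := fun h' => irrefl (r := r) z (hlt z h')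
  have := h (insert z C) (insert_subset (mem_bots.1 (mem_coe.1 hz)).1 h3)
    (isChain_insert_below h5 hlt)
  rw [card_insert_of_notMem hzC] at this
  omega

/-- Every chain of `peel r P` can be extended by each minimal element below it, and there is at
least one. -/
theorem sum_feet_le (hq : 1 ≤ q) :
    #(chains r (peel r P) q) + ∑ C ∈ chains r (peel r P) q,
      (#{x ∈ level r P 0 | ∀ y ∈ C, r x y} - 1) ≤ #(chains r P (q + 1)) := by
  have hpos : ∀ C ∈ chains r (peel r P) q, 1 ≤ #{x ∈ level r P 0 | ∀ y ∈ C, r x y} := by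
    intro C hC
    obtain ⟨h1, h2, h3⟩ := mem_chains.1 hC
    obtain ⟨z, hz, h⟩ := exists_chain_bot h3 (card_pos.1 (by omega))
    obtain ⟨x, hx⟩ := feet_nonempty (h1 hz)
    obtain ⟨h4, h5⟩ := mem_feet.1 hx
    refine card_pos.2 ⟨x, mem_filter.2 ⟨h4, fun y hy => ?_⟩⟩
    by_cases hyz : y = z
    · exact hyz ▸ h5
    · exact _root_.trans h5 (h y hy hyz)
  have : #(chains r (peel r P) q) + ∑ C ∈ chains r (peel r P) q,
      (#{x ∈ level r P 0 | ∀ y ∈ C, r x y} - 1) =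
      ∑ C ∈ chains r (peel r P) q, #{x ∈ level r P 0 | ∀ y ∈ C, r x y} := by
    rw [card_eq_sum_ones, ← sum_add_distrib]
    exact sum_congr rfl fun C hC => by have := hpos C hC; omega
  rw [this, ← card_sigma]
  apply card_le_card_of_injOn fun p => insert p.2 p.1
  · rintro ⟨C, x⟩ h
    simp only [mem_coe, mem_sigma, mem_filter] at h
    obtain ⟨h1, h2, h3⟩ := mem_chains.1 h.1
    refine mem_coe.2 (mem_chains.2 ⟨insert_subset (level_subset h.2.1) (h1.trans peel_subset), ?_,
      isChain_insert_below h3 h.2.2⟩)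
    rw [card_insert_of_notMem fun h' => irrefl (r := r) x (h.2.2 x h'), h2]
  · rintro ⟨C, x⟩ h ⟨C', x'⟩ h' he
    simp only [mem_coe, mem_sigma, mem_filter] at h h' he
    have key : ∀ C ∈ chains r (peel r P) q, ∀ x ∈ level r P 0, x ∉ C := fun C hC x hx hxC =>
      disjoint_left.1 disjoint_level_peel hx ((mem_chains.1 hC).1 hxC)
    have hxx : x = x' := by
      have : x ∈ insert x' C' := he ▸ mem_insert_self _ _
      exact (mem_insert.1 this).resolve_right (key C' h'.1 x h.2.1)
    subst hxx
    rw [← erase_insert (key C h.1 x h.2.1), he, erase_insert (key C' h'.1 x h.2.1)]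

theorem card_chains_peel_le (hq : 1 ≤ q) : #(chains r (peel r P) q) ≤ #(chains r P (q + 1)) :=
  (Nat.le_add_right _ _).trans (sum_feet_le hq)

theorem feet_eq_of_bot {C : Finset α} (hz : z ∈ C) (h : ∀ y ∈ C, y ≠ z → r z y) :
    {x ∈ level r P 0 | ∀ y ∈ C, r x y} = feet r P z := by
  apply filter_congr
  intro x _
  refine ⟨fun h' => h' z hz, fun h' y hy => ?_⟩
  by_cases hyz : y = z
  · exact hyz ▸ h'
  · exact _root_.trans h' (h y hy hyz)

theorem sum_bots_le (S : Finset α) (hS : S ⊆ bots r (peel r P) q) :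
    ∑ z ∈ S, (#(feet r P z) - 1) ≤
      ∑ C ∈ chains r (peel r P) q, (#{x ∈ level r P 0 | ∀ y ∈ C, r x y} - 1) := by
  have h0 : ∀ z ∈ S, ∃ C ∈ chains r (peel r P) q, z ∈ C ∧ ∀ y ∈ C, y ≠ z → r z y :=
    fun z hz => (mem_bots.1 (hS hz)).2
  choose! f hf hf1 hf2 using h0
  have hinj : Set.InjOn f S := by
    intro z hz z' hz' he
    by_contra hne
    have h1 := hf2 z hz z' (he ▸ hf1 z' hz') (Ne.symm hne)
    have h2 := hf2 z' hz' z (he ▸ hf1 z hz) hne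
    exact asymm (r := r) h1 h2
  calc _ = ∑ z ∈ S, (#{x ∈ level r P 0 | ∀ y ∈ f z, r x y} - 1) :=
        sum_congr rfl fun z hz => by rw [feet_eq_of_bot (hf1 z hz) (hf2 z hz)]
    _ = ∑ C ∈ S.image f, (#{x ∈ level r P 0 | ∀ y ∈ C, r x y} - 1) := by
        rw [sum_image hinj]
    _ ≤ _ := sum_le_sum_of_subset fun C hC => by
        obtain ⟨z, hz, rfl⟩ := mem_image.1 hC
        exact hf z hz

theorem hit_le_hit_peel (hq : 1 ≤ q) : hit r P (q + 1) ≤ hit r (peel r P) q := by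
  obtain ⟨Y, _, h2, h3⟩ := exists_hit r (peel r P) hq
  rw [← h3]
  refine hit_le_of_forall fun C hC => ?_
  obtain ⟨h4, h5, h6⟩ := mem_chains.1 hC
  obtain ⟨z, hz, hb⟩ := exists_chain_bot h6 (card_pos.1 (by omega))
  have hsub : C.erase z ⊆ peel r P := by
    intro y hy
    obtain ⟨h7, h8⟩ := mem_erase.1 hy
    exact mem_sdiff.2 ⟨h4 h8, fun h9 => not_rel_level_zero h9 (h4 hz) (hb y h8 h7)⟩
  obtain ⟨x, hx, hxY⟩ := h2 (C.erase z) (mem_chains.2 ⟨hsub, by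
    rw [card_erase_of_mem hz, h5, Nat.add_sub_cancel], h6.mono (by exact_mod_cast erase_subset _ _)⟩)
  exact ⟨x, mem_of_mem_erase hx, hxY⟩

omit [IsStrictOrder α r] in
theorem card_antis_peel_add (p : ℕ) :
    #(antis r (peel r P) p) + #{A ∈ antis r P p | ¬A ⊆ peel r P} = #(antis r P p) := by
  rw [← card_filter_add_card_filter_not (s := antis r P p) (fun A => A ⊆ peel r P)]
  congr 2
  ext A
  simp only [mem_filter, mem_antis]
  exact ⟨fun h => ⟨⟨h.1.trans peel_subset, h.2⟩, h.1⟩, fun h => ⟨h.2, h.1.2⟩⟩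

theorem hit_le_card_level (h : ∀ C ⊆ P, IsChain r (C : Set α) → #C ≤ q) (hi : i < q) :
    hit r P q ≤ #(level r P i) := by
  refine hit_le level_subset fun C hC => ?_
  obtain ⟨h1, h2, h3⟩ := mem_chains.1 hC
  obtain ⟨x, hx, hxi⟩ := exists_mem_rk_eq h1 h3
    (fun x hx => rk_lt_of_chains_le h (h1 hx)) h2.ge hi
  exact ⟨x, hx, mem_level.2 ⟨h1 hx, hxi⟩⟩

theorem hit_mul_le (h : ∀ C ⊆ P, IsChain r (C : Set α) → #C ≤ q) : q * hit r P q ≤ #P := by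
  rw [card_eq_sum_level fun x hx => rk_lt_of_chains_le h hx]
  calc _ = ∑ i ∈ range q, hit r P q := by simp
    _ ≤ _ := sum_le_sum fun i hi => hit_le_card_level h (by simpa using hi)

omit [IsStrictOrder α r] in
theorem no_chain_sdiff_hit (hY : ∀ C ∈ chains r P (q + 1), ∃ x ∈ C, x ∈ Z) :
    ∀ C ⊆ P \ Z, IsChain r (C : Set α) → #C ≤ q := by
  intro C hC hc
  by_contra! hlt
  obtain ⟨D, hD, hDC⟩ := exists_chain_of_le (hC.trans sdiff_subset) hc hlt
  obtain ⟨x, hx, hxZ⟩ := hY D hD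
  exact (mem_sdiff.1 (hC (hDC hx))).2 hxZ

/-- Deleting a set that meets all `(q + 1)`-chains leaves a set to which Mirsky's theorem
applies. -/
theorem card_le_hit_add (h' : ∀ A ⊆ P, IsAntichain r (A : Set α) → #A ≤ p) :
    #P ≤ q * p + hit r P (q + 1) := by
  obtain ⟨Y, h1, h2, h3⟩ := exists_hit r P (m := q + 1) (by omega)
  have := card_le_mul (no_chain_sdiff_hit h2)
    fun A hA ha => h' A (hA.trans sdiff_subset) ha
  have := le_card_sdiff Y P
  omega

/-! ### The gain of one layer -/

/-- The minimal elements without an element of `Z` above them, together with `Z`. -/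
noncomputable def freed (r : α → α → Prop) (P Z : Finset α) : Finset α :=
  {x ∈ level r P 0 | ∀ z ∈ Z, ¬r x z} ∪ Z

theorem freed_antichain (hZP : Z ⊆ peel r P) (hZ : IsAntichain r (Z : Set α)) :
    IsAntichain r (freed r P Z : Set α) := by
  intro x hx y hy hxy hr
  simp only [freed, coe_union, coe_filter, Set.mem_union, Set.mem_ofPred_eq, mem_coe] at hx hy
  rcases hx with hx | hx <;> rcases hy with hy | hy
  · exact level_antichain hx.1 hy.1 hxy hr
  · exact hx.2 y hy hr
  · exact not_rel_level_zero hy.1 (peel_subset (hZP hx)) hr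
  · exact hZ hx hy hxy hr

omit [IsStrictOrder α r] in
theorem freed_subset (hZP : Z ⊆ peel r P) : freed r P Z ⊆ P :=
  union_subset ((filter_subset _ _).trans level_subset) (hZP.trans peel_subset)

omit [IsStrictOrder α r] in
theorem card_freed (hZP : Z ⊆ peel r P) :
    #(freed r P Z) + #{x ∈ level r P 0 | ∃ z ∈ Z, r x z} = #(level r P 0) + #Z := by
  rw [freed, card_union_of_disjoint (disjoint_of_subset_left (filter_subset _ _)
    (disjoint_of_subset_right hZP disjoint_level_peel)),
    ← card_filter_add_card_filter_not (s := level r P 0) (fun x => ∃ z ∈ Z, r x z)]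
  push Not
  omega

end

section

variable {α : Type*} {r s : α → α → Prop} {P Q A Z W : Finset α} {x y z : α} {m k i p q : ℕ}

variable [IsStrictOrder α r]

omit [IsStrictOrder α r] in
theorem isAntichain_insert' (hA : IsAntichain r (A : Set α)) (h1 : ∀ b ∈ A, ¬r b x)
    (h2 : ∀ b ∈ A, ¬r x b) : IsAntichain r ((insert x A : Finset α) : Set α) := by
  rw [coe_insert]
  exact hA.insert (fun b hb _ => h1 b hb) fun b hb _ => h2 b hb

/-- New antichains that appear when the layer of minimal elements is put back: the antichain
`freed r P Z` itself, its modifications by an element `n` of the layer with a unique element of `Z`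
above it, and its modifications by an element of `bots r (peel r P) q` outside `Z` with a unique
foot. -/
theorem new_antis (hch : ∀ C ⊆ P, IsChain r (C : Set α) → #C ≤ q + 1)
    (han : ∀ A ⊆ P, IsAntichain r (A : Set α) → #A ≤ p) (hZ : Z ⊆ bots r (peel r P) q)
    (hcard : #(freed r P Z) = p) :
    #{n ∈ level r P 0 | #{z ∈ Z | r n z} = 1} +
      (if 1 ≤ #{x ∈ level r P 0 | ∀ z ∈ Z, ¬r x z} then 1 else 0) +
      (if 2 ≤ #{x ∈ level r P 0 | ∀ z ∈ Z, ¬r x z} then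
        #{z ∈ bots r (peel r P) q \ Z | #(feet r P z) = 1} else 0) ≤
      #{A ∈ antis r P p | ¬A ⊆ peel r P} := by
  set M := {x ∈ level r P 0 | ∀ z ∈ Z, ¬r x z} with hM
  set N := {n ∈ level r P 0 | #{z ∈ Z | r n z} = 1} with hN
  set J := {z ∈ bots r (peel r P) q \ Z | #(feet r P z) = 1} with hJ
  set W := freed r P Z with hW
  have hI := bots_antichain (chains_peel_le hch)
  have hZP : Z ⊆ peel r P := hZ.trans bots_subset
  have hWa : IsAntichain r (W : Set α) := freed_antichain hZP (hI.subset (by exact_mod_cast hZ))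
  have hWP : W ⊆ P := freed_subset hZP
  have memW : ∀ x ∈ W, x ∈ M ∨ x ∈ Z := fun x hx => mem_union.1 hx
  have hMD : ∀ x ∈ M, x ∈ level r P 0 := fun x hx => (mem_filter.1 hx).1
  have hDpeel : ∀ x ∈ level r P 0, x ∉ peel r P := fun x hx => disjoint_left.1 disjoint_level_peel hx
  have hNW : ∀ n ∈ N, n ∉ W := by
    intro n hn hnW
    obtain ⟨h1, h2⟩ := mem_filter.1 hn
    rcases memW n hnW with h | h
    · obtain ⟨z, hz⟩ := card_pos.1 (by omega : 0 < #{z ∈ Z | r n z})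
      obtain ⟨h3, h4⟩ := mem_filter.1 hz
      exact (mem_filter.1 h).2 z h3 h4
    · exact hDpeel n h1 (hZP h)
  have hJprop : ∀ z ∈ J, z ∈ bots r (peel r P) q ∧ z ∉ Z ∧ #(feet r P z) = 1 := by
    intro z hz
    obtain ⟨h1, h2⟩ := mem_filter.1 hz
    exact ⟨(mem_sdiff.1 h1).1, (mem_sdiff.1 h1).2, h2⟩
  have hJpeel : ∀ z ∈ J, z ∈ peel r P := fun z hz => bots_subset (hJprop z hz).1
  have hJW : ∀ z ∈ J, z ∉ W := by
    intro z hz hzW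
    rcases memW z hzW with h | h
    · exact hDpeel z (hMD z h) (hJpeel z hz)
    · exact (hJprop z hz).2.1 h
  have hJb1 : ∀ z ∈ J, ∀ b ∈ W, ¬r z b := by
    intro z hz b hb hr
    rcases memW b hb with h | h
    · exact not_rel_level_zero (hMD b h) (peel_subset (hJpeel z hz)) hr
    · exact hI (hJprop z hz).1 (hZ h) (by rintro rfl; exact (hJprop z hz).2.1 h) hr
  have hJb2 : ∀ z ∈ J, ∀ b ∈ W, r b z → b ∈ feet r P z := by
    intro z hz b hb hr
    rcases memW b hb with h | h
    · exact mem_feet.2 ⟨hMD b h, hr⟩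
    · exact absurd hr (hI (hZ h) (hJprop z hz).1 fun h' => (hJprop z hz).2.1 (h' ▸ h))
  have hJfeet : ∀ z ∈ J, feet r P z ⊆ W := by
    intro z hz
    obtain ⟨x, hx⟩ := card_eq_one.1 (hJprop z hz).2.2
    rw [hx, singleton_subset_iff]
    by_contra hxW
    have := han (insert z W) (insert_subset (peel_subset (hJpeel z hz)) hWP)
      (isAntichain_insert' hWa (fun b hb hr => by
        have := hJb2 z hz b hb hr
        rw [hx, mem_singleton] at this
        exact hxW (this ▸ hb)) (hJb1 z hz))
    rw [card_insert_of_notMem (hJW z hz)] at this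
    omega
  set 𝒲₁ : Finset (Finset α) := if 1 ≤ #M then {W} else ∅ with h𝒲₁
  set 𝒲₂ : Finset (Finset α) := N.image fun n => insert n (W \ {z ∈ Z | r n z}) with h𝒲₂
  set 𝒲₃ : Finset (Finset α) := if 2 ≤ #M then J.image fun z => insert z (W \ feet r P z) else ∅
    with h𝒲₃
  have c1 : #𝒲₁ = if 1 ≤ #M then 1 else 0 := by
    rw [h𝒲₁]; split_ifs <;> simp
  have c2 : #𝒲₂ = #N := by
    apply card_image_of_injOn
    intro n hn n' hn' he
    simp only at he
    have : n ∈ insert n' (W \ {z ∈ Z | r n' z}) := he ▸ mem_insert_self _ _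
    exact (mem_insert.1 this).resolve_right fun h => hNW n hn (mem_sdiff.1 h).1
  have c3 : #𝒲₃ = if 2 ≤ #M then #J else 0 := by
    rw [h𝒲₃]
    split_ifs
    · apply card_image_of_injOn
      intro n hn n' hn' he
      simp only at he
      have : n ∈ insert n' (W \ feet r P n') := he ▸ mem_insert_self _ _
      exact (mem_insert.1 this).resolve_right fun h => hJW n hn (mem_sdiff.1 h).1
    · simp
  have m1 : ∀ B ∈ 𝒲₁, B = W ∧ 1 ≤ #M := by
    intro B hB
    rw [h𝒲₁] at hB
    split_ifs at hB with h
    · exact ⟨mem_singleton.1 hB, h⟩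
    · simp at hB
  have m2 : ∀ B ∈ 𝒲₂, ∃ n ∈ N, insert n (W \ {z ∈ Z | r n z}) = B := fun B hB => by
    simpa [h𝒲₂] using hB
  have m3 : ∀ B ∈ 𝒲₃, 2 ≤ #M ∧ ∃ z ∈ J, insert z (W \ feet r P z) = B := by
    intro B hB
    rw [h𝒲₃] at hB
    split_ifs at hB with h
    · exact ⟨h, by simpa using hB⟩
    · simp at hB
  have d12 : Disjoint 𝒲₁ 𝒲₂ := by
    rw [disjoint_left]
    intro B h1 h2
    obtain ⟨rfl, _⟩ := m1 B h1
    obtain ⟨n, hn, he⟩ := m2 _ h2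
    exact hNW n hn (he ▸ mem_insert_self _ _)
  have d3 : Disjoint (𝒲₁ ∪ 𝒲₂) 𝒲₃ := by
    rw [disjoint_left]
    intro B h1 h2
    obtain ⟨_, z, hz, rfl⟩ := m3 _ h2
    rcases mem_union.1 h1 with h | h
    · exact hJW z hz ((m1 _ h).1 ▸ mem_insert_self _ _)
    · obtain ⟨n, hn, he⟩ := m2 _ h
      have h3 : n ∈ insert z (W \ feet r P z) := he ▸ mem_insert_self _ _
      rcases mem_insert.1 h3 with rfl | h4
      · exact hDpeel n (mem_filter.1 hn).1 (hJpeel n hz)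
      · exact hNW n hn (mem_sdiff.1 h4).1
  have hsub : 𝒲₁ ∪ 𝒲₂ ∪ 𝒲₃ ⊆ {A ∈ antis r P p | ¬A ⊆ peel r P} := by
    intro B hB
    rw [mem_union, mem_union] at hB
    rcases hB with (hB | hB) | hB
    · obtain ⟨rfl, h⟩ := m1 B hB
      obtain ⟨x, hx⟩ := card_pos.1 h
      exact mem_filter.2 ⟨mem_antis.2 ⟨hWP, hcard, hWa⟩, fun h' =>
        hDpeel x (hMD x hx) (h' (mem_union_left _ hx))⟩
    · obtain ⟨n, hn, rfl⟩ := m2 B hB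
      obtain ⟨h1, h2⟩ := mem_filter.1 hn
      refine mem_filter.2 ⟨mem_antis.2 ⟨insert_subset (level_subset h1) (sdiff_subset.trans hWP),
        ?_, ?_⟩, fun h' => hDpeel n h1 (h' (mem_insert_self _ _))⟩
      · have hsubW : {z ∈ Z | r n z} ⊆ W := (filter_subset _ _).trans subset_union_right
        rw [card_insert_of_notMem fun h => hNW n hn (mem_sdiff.1 h).1,
          card_sdiff_of_subset hsubW, h2]
        have := card_le_card hsubW
        omega
      · refine isAntichain_insert' (hWa.subset (by exact_mod_cast sdiff_subset))
          (fun b hb => not_rel_level_zero h1 (hWP (mem_sdiff.1 hb).1)) fun b hb hr => ?_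
        obtain ⟨h3, h4⟩ := mem_sdiff.1 hb
        rcases memW b h3 with h | h
        · exact level_antichain h1 (hMD b h) (by rintro rfl; exact hNW n hn h3) hr
        · exact h4 (mem_filter.2 ⟨h, hr⟩)
    · obtain ⟨h2M, z, hz, rfl⟩ := m3 B hB
      obtain ⟨x, hx⟩ := card_eq_one.1 (hJprop z hz).2.2
      refine mem_filter.2 ⟨mem_antis.2 ⟨insert_subset (peel_subset (hJpeel z hz))
        (sdiff_subset.trans hWP), ?_, ?_⟩, fun h' => ?_⟩
      · have := card_le_card (hJfeet z hz)
        rw [card_insert_of_notMem fun h => hJW z hz (mem_sdiff.1 h).1,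
          card_sdiff_of_subset (hJfeet z hz)]
        rw [hx, card_singleton] at *
        omega
      · exact isAntichain_insert' (hWa.subset (by exact_mod_cast sdiff_subset))
          (fun b hb hr => (mem_sdiff.1 hb).2 (hJb2 z hz b (mem_sdiff.1 hb).1 hr))
          fun b hb => hJb1 z hz b (mem_sdiff.1 hb).1
      · obtain ⟨y, hy, hyx⟩ := exists_mem_ne (by omega : 1 < #M) x
        refine hDpeel y (hMD y hy) (h' (mem_insert_of_mem (mem_sdiff.2 ⟨mem_union_left _ hy, ?_⟩)))
        rw [hx, mem_singleton]
        exact hyx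
  have := card_le_card hsub
  rw [card_union_of_disjoint d3, card_union_of_disjoint d12, c1, c2, c3] at this
  omega

/-- The gain of one layer: `e` is the number of elements that the layer lacks to be a largest
antichain, and `l` is a loss that has to be admitted if few minimal elements are left free by
`Z`. Feet contribute chains if an element has several, and antichains by `new_antis` if it has
only one; for the elements of `Z` these feet are counted from the side of the minimal elements.
-/
theorem gain_of_freed (hq : 1 ≤ q) (hch : ∀ C ⊆ P, IsChain r (C : Set α) → #C ≤ q + 1)
    (han : ∀ A ⊆ P, IsAntichain r (A : Set α) → #A ≤ p) (hZ : Z ⊆ bots r (peel r P) q)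
    (hcard : #(freed r P Z) = p) {e l : ℕ} (he : #(level r P 0) + e = p)
    (hl : l = 0 → 2 ≤ #{x ∈ level r P 0 | ∀ z ∈ Z, ¬r x z} ∨
      1 ≤ #{x ∈ level r P 0 | ∀ z ∈ Z, ¬r x z} ∧ bots r (peel r P) q ⊆ Z) :
    #(chains r (peel r P) q) + #(antis r (peel r P) p) + 1 + #(bots r (peel r P) q) ≤
      #(chains r P (q + 1)) + #(antis r P p) + 2 * e + l := by
  have h1 := new_antis hch han hZ hcard
  have h2 := card_antis_peel_add (r := r) (P := P) p
  have h3 := sum_feet_le (r := r) (P := P) hq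
  have h4 := sum_bots_le (r := r) (P := P) (q := q) _ Subset.rfl
  have hI := bots_antichain (chains_peel_le hch)
  have hIp := han _ (bots_subset.trans peel_subset) hI
  have hZP : Z ⊆ peel r P := hZ.trans bots_subset
  have h5 := card_freed (r := r) (P := P) hZP
  have h6 : #(freed r P Z) = #{x ∈ level r P 0 | ∀ z ∈ Z, ¬r x z} + #Z :=
    card_union_of_disjoint (disjoint_of_subset_left (filter_subset _ _)
    (disjoint_of_subset_right hZP disjoint_level_peel))
  have h7 : #(bots r (peel r P) q \ Z) + #Z = #(bots r (peel r P) q) :=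
    card_sdiff_add_card_eq_card hZ
  have h8 := sum_sdiff (f := fun z => #(feet r P z) - 1) hZ
  have h9 : #(bots r (peel r P) q \ Z) ≤ ∑ z ∈ bots r (peel r P) q \ Z, (#(feet r P z) - 1) +
      #{z ∈ bots r (peel r P) q \ Z | #(feet r P z) = 1} := by
    rw [card_filter, ← sum_add_distrib, card_eq_sum_ones]
    refine sum_le_sum fun z hz => ?_
    have := card_pos.2 (feet_nonempty (r := r) (bots_subset (mem_sdiff.1 hz).1))
    split_ifs <;> omega
  -- double counting of the comparable pairs between the layer and `Z`
  have h10 : ∑ z ∈ Z, #(feet r P z) = ∑ x ∈ level r P 0, #{z ∈ Z | r x z} :=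
    (sum_card_bipartiteAbove_eq_sum_card_bipartiteBelow r).symm
  have h11 : ∑ z ∈ Z, #(feet r P z) = ∑ z ∈ Z, (#(feet r P z) - 1) + #Z := by
    rw [card_eq_sum_ones, ← sum_add_distrib]
    refine sum_congr rfl fun z hz => ?_
    have := card_pos.2 (feet_nonempty (r := r) (hZP hz))
    omega
  have h12 : 2 * #{x ∈ level r P 0 | ∃ z ∈ Z, r x z} ≤ ∑ x ∈ level r P 0, #{z ∈ Z | r x z} +
      #{n ∈ level r P 0 | #{z ∈ Z | r n z} = 1} := by
    rw [card_filter, card_filter, ← sum_add_distrib, mul_sum]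
    refine sum_le_sum fun x hx => ?_
    by_cases h : ∃ z ∈ Z, r x z
    · obtain ⟨z, hz, hr⟩ := h
      have h' : 0 < #{z ∈ Z | r x z} := card_pos.2 ⟨z, mem_filter.2 ⟨hz, hr⟩⟩
      rw [if_pos ⟨z, hz, hr⟩]
      split_ifs <;> omega
    · rw [if_neg h]
      omega
  have h13 : #{z ∈ bots r (peel r P) q \ Z | #(feet r P z) = 1} ≤ #(bots r (peel r P) q \ Z) :=
    card_filter_le _ _
  have h14 : bots r (peel r P) q ⊆ Z → #(bots r (peel r P) q \ Z) = 0 := fun h => by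
    rw [sdiff_eq_empty_iff_subset.2 h, card_empty]
  generalize #{x ∈ level r P 0 | ∀ z ∈ Z, ¬r x z} = M at *
  generalize #{x ∈ level r P 0 | ∃ z ∈ Z, r x z} = NZ at *
  generalize #{n ∈ level r P 0 | #{z ∈ Z | r n z} = 1} = N1 at *
  generalize #{z ∈ bots r (peel r P) q \ Z | #(feet r P z) = 1} = J at *
  by_cases hM : 2 ≤ M
  · rw [if_pos hM, if_pos (by omega)] at h1
    omega
  · rw [if_neg hM] at h1
    by_cases hl0 : l = 0
    · obtain ⟨h, h'⟩ := (hl hl0).resolve_left hM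
      rw [if_pos h] at h1
      have := h14 h'
      omega
    · split_ifs at h1 <;> omega

end

/-! ### A lower bound from removing layer after layer -/

section

variable {α : Type*} {r s : α → α → Prop} {P Q A Z W : Finset α} {x y z : α} {m k i p q : ℕ}

variable [IsStrictOrder α r]

/-- From a smallest set `Y` meeting the `(q + 1)`-chains, a set meeting the `q`-chains of
`peel r P` arises by replacing the minimal elements of `Y` by the set `Z` of those least elements of
`q`-chains that start a chain avoiding `Y`. -/
theorem hit_peel_le (hq : 1 ≤ q) (hch : ∀ C ⊆ P, IsChain r (C : Set α) → #C ≤ q + 1)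
    (han : ∀ A ⊆ P, IsAntichain r (A : Set α) → #A ≤ p) {e : ℕ} (he : #(level r P 0) + e = p) :
    hit r (peel r P) q ≤ hit r P (q + 1) + e ∧
    (hit r (peel r P) q = hit r P (q + 1) + e → ∃ Z ⊆ bots r (peel r P) q,
      #(freed r P Z) = p ∧ (bots r (peel r P) q ⊆ Z ∨ #Z + 1 ≤ hit r (peel r P) q) ∧
      #Z ≤ hit r (peel r P) q) := by
  obtain ⟨Y, hYP, hY, hYc⟩ := exists_hit r P (m := q + 1) (by omega)
  set Z := {z ∈ bots r (peel r P) q | ∃ C ∈ chains r (peel r P) q,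
    z ∈ C ∧ (∀ y ∈ C, y ≠ z → r z y) ∧ ∀ y ∈ C, y ∉ Y} with hZdef
  have hZ : Z ⊆ bots r (peel r P) q := filter_subset _ _
  have hZP : Z ⊆ peel r P := hZ.trans bots_subset
  have hI := bots_antichain (chains_peel_le hch)
  have hf := han _ (freed_subset hZP) (freed_antichain hZP (hI.subset (by exact_mod_cast hZ)))
  have hfc := card_freed (r := r) (P := P) hZP
  have hN : {x ∈ level r P 0 | ∃ z ∈ Z, r x z} ⊆ Y ∩ level r P 0 := by
    intro x hx
    obtain ⟨hxD, z, hz, hr⟩ := mem_filter.1 hx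
    refine mem_inter.2 ⟨?_, hxD⟩
    obtain ⟨-, C, hC, h1, h2, h3⟩ := mem_filter.1 hz
    obtain ⟨h4, h5, h6⟩ := mem_chains.1 hC
    have hlt : ∀ y ∈ C, r x y := fun y hy => by
      by_cases hyz : y = z
      · exact hyz ▸ hr
      · exact _root_.trans hr (h2 y hy hyz)
    have hxC : x ∉ C := fun h' => irrefl (r := r) x (hlt x h')
    obtain ⟨y, hy, hyY⟩ := hY (insert x C) (mem_chains.2
      ⟨insert_subset (level_subset hxD) (h4.trans peel_subset),
        by rw [card_insert_of_notMem hxC, h5], isChain_insert_below h6 hlt⟩)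
    rcases mem_insert.1 hy with rfl | hy
    · exact hyY
    · exact absurd hyY (h3 y hy)
  have hNc := card_le_card hN
  have hYsplit : #(Y ∩ level r P 0) + #(Y \ level r P 0) = #Y := card_inter_add_card_sdiff _ _
  have hhit : hit r (peel r P) q ≤ #(Y \ level r P 0) + #Z := by
    refine (hit_le_of_forall (Y := Y \ level r P 0 ∪ Z) fun C hC => ?_).trans (card_union_le _ _)
    obtain ⟨h4, h5, h6⟩ := mem_chains.1 hC
    obtain ⟨z, hz, hb⟩ := exists_chain_bot h6 (card_pos.1 (by omega))
    by_cases hzZ : z ∈ Z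
    · exact ⟨z, hz, mem_union_right _ hzZ⟩
    · by_contra! hcon
      refine hzZ (mem_filter.2 ⟨mem_bots.2 ⟨h4 hz, C, hC, hz, hb⟩, C, hC, hz, hb,
        fun y hy hyY => hcon y hy (mem_union_left _ (mem_sdiff.2 ⟨hyY, fun h =>
          disjoint_left.1 disjoint_level_peel h (h4 hy)⟩))⟩)
  refine ⟨by omega, fun heq => ⟨Z, hZ, by omega, ?_, by omega⟩⟩
  by_cases hsub : bots r (peel r P) q ⊆ Z
  · exact Or.inl hsub
  right
  obtain ⟨z, hz, hzZ⟩ := not_subset.1 hsub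
  obtain ⟨-, C, hC, h1, h2⟩ := mem_bots.1 hz
  have : ∃ y ∈ C, y ∈ Y := by
    by_contra! hcon
    exact hzZ (mem_filter.2 ⟨hz, C, hC, h1, h2, hcon⟩)
  obtain ⟨y, hy, hyY⟩ := this
  have : 1 ≤ #(Y \ level r P 0) := card_pos.2 ⟨y, mem_sdiff.2 ⟨hyY, fun h =>
    disjoint_left.1 disjoint_level_peel h ((mem_chains.1 hC).1 hy)⟩⟩
  omega

/-- The lower bound for the numbers of `q`-chains and `p`-antichains of a set whose chains and
antichains have at most `q` and `p` elements, in terms of the least size of a set meeting all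
`q`-chains and of the complementary parameter `b`. -/
def LayerBound (r : α → α → Prop) (P : Finset α) (q p : ℕ) : Prop :=
  (∀ b, p * q + hit r P q + b + 1 = #P + p + q →
    (hit r P q + 1) * (b + 1) ≤ #(chains r P q) + #(antis r P p) + 1) ∧
  (#P = p * q → (p + 1) * q ≤ #(chains r P q) + #(antis r P p))

/-- The step of `layerBound` in the case where the removal of the minimal elements raises the
number of elements needed to meet all longest chains by the full amount `e`. The loss `l = 1` in
`gain_of_freed` occurs only if `peel r P` has the greatest possible size `p * q`, and then the
second bound of `LayerBound` makes up for it. -/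
theorem layer_step (hq : 1 ≤ q)
    (hch : ∀ C ⊆ P, IsChain r (C : Set α) → #C ≤ q + 1)
    (han : ∀ A ⊆ P, IsAntichain r (A : Set α) → #A ≤ p) {e b : ℕ} (he : #(level r P 0) + e = p)
    (hIH : LayerBound r (peel r P) q p) (hhit : hit r (peel r P) q = hit r P (q + 1) + e)
    (hb : p * (q + 1) + hit r P (q + 1) + (b + 1) + 1 = #P + p + (q + 1)) :
    (hit r P (q + 1) + 1) * (b + 2) + e * b ≤ #(chains r P (q + 1)) + #(antis r P p) + 1 := by
  have hc := card_peel (r := r) (P := P)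
  have hchp := chains_peel_le hch
  have hI := hit_le (r := r) (P := peel r P) (m := q) bots_subset (bots_hit hq)
  have hb' : p * q + hit r (peel r P) q + b + 1 = #(peel r P) + p + q := by
    rw [mul_add, mul_one] at hb
    omega
  have hN := hIH.1 b hb'
  obtain ⟨l, Z, hl1, hZ, hZc, hl⟩ : ∃ (l : ℕ) (Z : Finset α),
      (l = 0 ∨ l = 1 ∧ p ≤ hit r (peel r P) q) ∧ Z ⊆ bots r (peel r P) q ∧ #(freed r P Z) = p ∧
      (l = 0 → 2 ≤ #{x ∈ level r P 0 | ∀ z ∈ Z, ¬r x z} ∨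
      1 ≤ #{x ∈ level r P 0 | ∀ z ∈ Z, ¬r x z} ∧ bots r (peel r P) q ⊆ Z) := by
    obtain ⟨Z, h1, h2, h3, h4⟩ := (hit_peel_le hq hch han he).2 hhit
    have h6 : #(freed r P Z) = #{x ∈ level r P 0 | ∀ z ∈ Z, ¬r x z} + #Z :=
      card_union_of_disjoint (disjoint_of_subset_left (filter_subset _ _)
      (disjoint_of_subset_right (h1.trans bots_subset) disjoint_level_peel))
    by_cases hM : 2 ≤ #{x ∈ level r P 0 | ∀ z ∈ Z, ¬r x z}
    · exact ⟨0, Z, Or.inl rfl, h1, h2, fun _ => Or.inl hM⟩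
    by_cases hM1 : 1 ≤ #{x ∈ level r P 0 | ∀ z ∈ Z, ¬r x z}
    · rcases h3 with h3 | h3
      · exact ⟨0, Z, Or.inl rfl, h1, h2, fun _ => Or.inr ⟨hM1, h3⟩⟩
      · exact ⟨1, Z, Or.inr ⟨rfl, by omega⟩, h1, h2, fun h => by omega⟩
    · exact ⟨1, Z, Or.inr ⟨rfl, by omega⟩, h1, h2, fun h => by omega⟩
  have hg := gain_of_freed hq hch han hZ hZc he hl
  rcases hl1 with rfl | ⟨rfl, hpa⟩
  · rw [hhit] at hN hI
    linarith
  · have h1 := hit_mul_le hchp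
    have h2 : #(peel r P) ≤ q * p :=
      card_le_mul hchp fun A hA ha => han A (hA.trans peel_subset) ha
    have h3 : q * p ≤ q * hit r (peel r P) q := Nat.mul_le_mul_left q hpa
    have h4 : hit r (peel r P) q = p := Nat.eq_of_mul_eq_mul_left hq (by omega)
    have h5 := hIH.2 (by rw [mul_comm]; omega)
    have h6 : q = b + 1 := by
      rw [h4, mul_comm p q] at hb'
      omega
    have h7 : (hit r P (q + 1) + e + 1) * (b + 1) = (p + 1) * q := by
      rw [← hhit, h4, ← h6]
    rw [← h7] at h5
    rw [hhit] at hI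
    linarith

theorem card_level_le (han : ∀ A ⊆ P, IsAntichain r (A : Set α) → #A ≤ p) (i : ℕ) :
    #(level r P i) ≤ p := han _ level_subset level_antichain

/-- The bound is proved by removing the layer of minimal elements. If this raises the number
`hit` by less than `e`, where `e` is the number of elements that the layer lacks to be a largest
antichain, then the bound for the remaining layers is already large enough; otherwise
`layer_step` applies. -/
theorem layerBound (hp : 2 ≤ p) (hq : 1 ≤ q) (P : Finset α)
    (hch : ∀ C ⊆ P, IsChain r (C : Set α) → #C ≤ q)
    (han : ∀ A ⊆ P, IsAntichain r (A : Set α) → #A ≤ p) : LayerBound r P q p := by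
  induction q, hq using Nat.le_induction generalizing P with
  | base =>
    have h1 : #(chains r P 1) = #P := by
      rw [chains, filter_true_of_mem, card_powersetCard, Nat.choose_one_right]
      intro C hC
      obtain ⟨x, rfl⟩ := card_eq_one.1 (mem_powersetCard.1 hC).2
      simp
    have hP : IsAntichain r (P : Set α) := by
      intro x hx y hy hxy hr
      have := hch {x, y} (by simp [insert_subset_iff, mem_coe.1 hx, mem_coe.1 hy])
        (by simpa using IsChain.pair hr)
      rw [card_pair hxy] at this
      omega
    have h2 := hit_mul_le hch
    have h3 := hit_le_card_chains (r := r) (P := P) (m := 1) le_rfl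
    refine ⟨fun b hb => ?_, fun hPp => ?_⟩
    · have h4 : #P ≤ hit r P 1 := by
        obtain ⟨Y, h5, h6, h7⟩ := exists_hit r P (m := 1) le_rfl
        rw [← h7]
        refine card_le_card fun x hx => ?_
        obtain ⟨y, hy, hy'⟩ := h6 {x} (mem_chains.2 ⟨by simpa using hx, by simp, by simp⟩)
        rw [mem_singleton] at hy
        exact hy ▸ hy'
      have : b = 0 := by omega
      subst this
      rw [h1]
      omega
    · have : 1 ≤ #(antis r P p) :=
        card_pos.2 ⟨P, mem_antis.2 ⟨Subset.rfl, by omega, hP⟩⟩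
      omega
  | succ q hq ih =>
    have hchp := chains_peel_le hch
    have hanp : ∀ A ⊆ peel r P, IsAntichain r (A : Set α) → #A ≤ p :=
      fun A hA ha => han A (hA.trans peel_subset) ha
    have hIH := ih (peel r P) hchp hanp
    obtain ⟨e, he⟩ := Nat.exists_eq_add_of_le (card_level_le (r := r) han 0)
    have hc := card_peel (r := r) (P := P)
    have h1 := card_chains_peel_le (r := r) (P := P) hq
    have h2 := card_le_card (antis_mono (r := r) (m := p) (peel_subset (r := r) (P := P)))
    have h3 := hit_le_hit_peel (r := r) (P := P) hq
    have h4 := (hit_peel_le hq hch han he.symm).1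
    constructor
    · intro b hb
      rcases b.eq_zero_or_pos with rfl | hb0
      · have := hit_le_card_chains (r := r) (P := P) (m := q + 1) (by omega)
        omega
      obtain ⟨b, rfl⟩ : ∃ b', b = b' + 1 := ⟨b - 1, by omega⟩
      rcases h4.lt_or_eq with hlt | heq
      · obtain ⟨b', hb'⟩ := Nat.exists_eq_add_of_le hlt
        have h5 := hIH.1 (b + 1 + b') (by
          rw [mul_add, mul_one] at hb
          omega)
        have h6 : (hit r P (q + 1) + 1) * (b + 1 + 1) ≤
            (hit r (peel r P) q + 1) * (b + 1 + b' + 1) :=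
          Nat.mul_le_mul (by omega) (by omega)
        omega
      · have := layer_step hq hch han he.symm hIH heq hb
        have h7 : (hit r P (q + 1) + 1) * (b + 1 + 1) ≤
          (hit r P (q + 1) + 1) * (b + 2) + e * b := Nat.le_add_right _ _
        omega
    · intro hPp
      have h5 : #(peel r P) ≤ q * p := card_le_mul hchp hanp
      have h6 : #(level r P 0) = p := by
        have := card_level_le (r := r) han 0
        rw [mul_add, mul_one, mul_comm] at hPp
        omega
      have h7 : #(peel r P) = p * q := by rw [mul_add, mul_one] at hPp; omega
      have h8 := hIH.2 h7
      have hfr : freed r P ∅ = level r P 0 := by simp [freed]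
      have h9 := gain_of_freed hq hch han (Z := ∅) (empty_subset _) (by rw [hfr, h6])
        (e := 0) (l := 0) (by omega) (fun _ => Or.inl (by simpa using by omega))
      have hI := hit_le (r := r) (P := peel r P) (m := q) bots_subset (bots_hit hq)
      have h10 : p ≤ hit r P (q + 1) := by
        have := card_le_hit_add (q := q) han
        rw [hPp, mul_add, mul_one, mul_comm p q] at this
        omega
      rw [mul_add, mul_one]
      omega

/-- If the layer of minimal elements is a largest antichain, then its elements can be exchanged
independently for the least elements of longest chains that have a unique foot. All but at most
one of the resulting antichains contain minimal elements. -/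
theorem two_pow_exchange_feet (hch : ∀ C ⊆ P, IsChain r (C : Set α) → #C ≤ q + 1)
    (han : ∀ A ⊆ P, IsAntichain r (A : Set α) → #A ≤ p) (hD : #(level r P 0) = p)
    {S : Finset α} (hS : S ⊆ bots r (peel r P) q) (hS1 : ∀ z ∈ S, #(feet r P z) = 1) :
    2 ^ #S ≤ #(antis r P p) ∧
      2 ^ #S ≤ #{A ∈ antis r P p | ¬A ⊆ peel r P} + (if #S = p then 1 else 0) := by
  have h1 : ∀ z ∈ S, ∃ x, feet r P z = {x} := fun z hz => card_eq_one.1 (hS1 z hz)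
  choose! ξ hξ using h1
  have hI : IsAntichain r (S : Set α) :=
    (bots_antichain (chains_peel_le hch)).subset (by exact_mod_cast hS)
  have hSP : S ⊆ peel r P := hS.trans bots_subset
  have hξm : ∀ z ∈ S, ξ z ∈ level r P 0 := fun z hz =>
    (mem_feet.1 (show ξ z ∈ feet r P z by rw [hξ z hz]; simp)).1
  have hd : Disjoint (level r P 0) S := disjoint_of_subset_right hSP disjoint_level_peel
  have hcomp : ∀ z ∈ S, ∀ a ∈ level r P 0, (r a z ∨ r z a) → a = ξ z := by
    intro z hz a ha h
    rcases h with h | h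
    · have : a ∈ feet r P z := mem_feet.2 ⟨ha, h⟩
      rwa [hξ z hz, mem_singleton] at this
    · exact absurd h (not_rel_level_zero ha (peel_subset (hSP hz)))
  -- two elements with the same foot could both be exchanged for it
  have hinj : Set.InjOn ξ S := by
    intro z hz z' hz' heq
    by_contra hne
    have hsub : ({z, z'} : Finset α) ⊆ S := by
      simp [insert_subset_iff, mem_coe.1 hz, mem_coe.1 hz']
    have hA := isAntichain_exchange ξ level_antichain hI hcomp hsub
    have := han _ (union_subset (sdiff_subset.trans level_subset)
      (hsub.trans (hSP.trans peel_subset))) hA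
    rw [card_union_of_disjoint (disjoint_of_subset_left sdiff_subset
      (disjoint_of_subset_right hsub hd)), card_pair hne, image_insert, image_singleton, ← heq,
      insert_eq_of_mem (mem_singleton_self _), card_sdiff_of_subset
        (singleton_subset_iff.2 (hξm z hz)), card_singleton] at this
    have := card_pos.2 ⟨_, hξm z hz⟩
    omega
  have h2 := two_pow_le_card_antis ξ level_subset (hSP.trans peel_subset) level_antichain hI hξm
    hinj hd hcomp
  rw [hD] at h2
  refine ⟨h2, ?_⟩
  have key : ∀ T ⊆ S, T.image ξ ≠ level r P 0 → ¬ level r P 0 \ T.image ξ ∪ T ⊆ peel r P := by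
    intro T hT hne hsub
    apply hne
    apply Subset.antisymm
    · intro y hy
      obtain ⟨z, hz, rfl⟩ := mem_image.1 hy
      exact hξm z (hT hz)
    · intro x hx
      by_contra hx'
      exact disjoint_left.1 disjoint_level_peel hx
        (hsub (mem_union_left _ (mem_sdiff.2 ⟨hx, hx'⟩)))
  have hcard : ∀ T ⊆ S, T.image ξ = level r P 0 → #T = p := by
    intro T hT h
    rw [← hD, ← h, card_image_of_injOn (hinj.mono (by exact_mod_cast hT))]
  by_cases hSp : #S = p
  · rw [if_pos hSp]
    have := card_le_card_antis_exchange ξ level_subset (hSP.trans peel_subset) level_antichain hI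
      hξm hinj hd hcomp (fun A => ¬A ⊆ peel r P) (S.powerset.erase S) (fun T hT => by
        obtain ⟨h3, h4⟩ := mem_erase.1 hT
        rw [mem_powerset] at h4
        exact ⟨h4, key T h4 fun h => h3 (eq_of_subset_of_card_le h4 (by rw [hcard T h4 h, hSp]))⟩)
    rw [hD, card_erase_of_mem (mem_powerset_self S), card_powerset] at this
    omega
  · rw [if_neg hSp]
    have := card_le_card_antis_exchange ξ level_subset (hSP.trans peel_subset) level_antichain hI
      hξm hinj hd hcomp (fun A => ¬A ⊆ peel r P) S.powerset (fun T hT => by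
        have h4 := mem_powerset.1 hT
        refine ⟨h4, key T h4 fun h => hSp ?_⟩
        have := hcard T h4 h
        have := card_le_card h4
        have := han S (hSP.trans peel_subset) hI
        omega)
    rw [hD, card_powerset] at this
    omega

/-- If there are no more longest chains than elements needed to meet them, then there are many
largest antichains: in the first layer that is a largest antichain, every least element of a
longest chain of the layers above has a unique foot. -/
theorem two_pow_le_antis_of_chains_le_hit (hq : 1 ≤ q) (P : Finset α)
    (hch : ∀ C ⊆ P, IsChain r (C : Set α) → #C ≤ q)
    (han : ∀ A ⊆ P, IsAntichain r (A : Set α) → #A ≤ p) (hle : #(chains r P q) ≤ hit r P q) {b : ℕ}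
    (hb : p * q + hit r P q + (b + 1) + 1 = #P + p + q) : 2 ^ hit r P q ≤ #(antis r P p) := by
  induction q, hq using Nat.le_induction generalizing P b with
  | base =>
    exfalso
    have h1 : #P ≤ hit r P 1 := by
      obtain ⟨Y, h5, h6, h7⟩ := exists_hit r P (m := 1) le_rfl
      rw [← h7]
      refine card_le_card fun x hx => ?_
      obtain ⟨y, hy, hy'⟩ := h6 {x} (mem_chains.2 ⟨by simpa using hx, by simp, by simp⟩)
      rw [mem_singleton] at hy
      exact hy ▸ hy'
    omega
  | succ q hq ih =>
    have hchp := chains_peel_le hch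
    have hanp : ∀ A ⊆ peel r P, IsAntichain r (A : Set α) → #A ≤ p :=
      fun A hA ha => han A (hA.trans peel_subset) ha
    obtain ⟨e, he⟩ := Nat.exists_eq_add_of_le (card_level_le (r := r) han 0)
    have hc := card_peel (r := r) (P := P)
    have h2 := card_le_card (antis_mono (r := r) (m := p) (peel_subset (r := r) (P := P)))
    have h3 := hit_le_hit_peel (r := r) (P := P) hq
    have h4 := (hit_peel_le hq hch han he.symm).1
    have h5 := sum_feet_le (r := r) (P := P) hq
    have h6 := hit_le_card_chains (r := r) (P := peel r P) hq
    rcases e.eq_zero_or_pos with rfl | he0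
    · have hsum := sum_bots_le (r := r) (P := P) (q := q) _ Subset.rfl
      have h7 : ∀ z ∈ bots r (peel r P) q, #(feet r P z) = 1 := by
        intro z hz
        have h8 : #(feet r P z) - 1 ≤ ∑ z ∈ bots r (peel r P) q, (#(feet r P z) - 1) :=
          single_le_sum (f := fun z => #(feet r P z) - 1) (fun _ _ => Nat.zero_le _) hz
        have := card_pos.2 (feet_nonempty (r := r) (bots_subset hz))
        omega
      have hI := hit_le (r := r) (P := peel r P) (m := q) bots_subset (bots_hit hq)
      exact (Nat.pow_le_pow_right (by norm_num) (h3.trans hI)).trans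
        (two_pow_exchange_feet hch han (by omega) Subset.rfl h7).1
    · rw [mul_add, mul_one] at hb
      have h7 := ih (peel r P) hchp hanp (by omega)
        (b := b + (e - 1) + (hit r P (q + 1) - hit r (peel r P) q)) (by omega)
      exact (Nat.pow_le_pow_right (by norm_num) h3).trans (h7.trans h2)

end

/-! ### Sets without chains or antichains of size `k + 2` -/

section

variable {α : Type*} {r s : α → α → Prop} {P Q A Z W : Finset α} {x y z : α} {m k i p q : ℕ}

theorem hit_le_hit_erase_add_one (hq : 1 ≤ q) : hit r P q ≤ hit r (P.erase z) q + 1 := by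
  obtain ⟨Y, _, h2, h3⟩ := exists_hit r (P.erase z) hq
  rw [← h3]
  refine (hit_le_of_forall (Y := insert z Y) fun C hC => ?_).trans (card_insert_le _ _)
  by_cases hz : z ∈ C
  · exact ⟨z, hz, mem_insert_self _ _⟩
  · obtain ⟨h4, h5⟩ := mem_chains.1 hC
    obtain ⟨x, hx, hxY⟩ := h2 C (mem_chains.2 ⟨subset_erase.2 ⟨h4, hz⟩, h5⟩)
    exact ⟨x, hx, mem_insert_of_mem hxY⟩

theorem add_three_le_two_pow {m : ℕ} (hm : 3 ≤ m) : m + 3 ≤ 2 ^ m := by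
  induction m, hm using Nat.le_induction with
  | base => norm_num
  | succ m hm ih => rw [pow_succ]; omega

variable [IsStrictOrder α r]

/-- The case `b = 2` of `layerBound_strict` for a layer that is a largest antichain. The
argument depends on the number of least elements of longest chains with a unique foot:
exchanging them gives antichains, the other ones give chains. -/
theorem layer_step_two (hq : 1 ≤ q) (hp : 2 ≤ p)
    (hch : ∀ C ⊆ P, IsChain r (C : Set α) → #C ≤ q + 1)
    (han : ∀ A ⊆ P, IsAntichain r (A : Set α) → #A ≤ p) (hD : #(level r P 0) = p) {a : ℕ}
    (ha : hit r (peel r P) q = a) (ha4 : 4 ≤ a)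
    (hb : p * q + a + 2 = #(peel r P) + p + q) :
    3 * a + 3 ≤ #(chains r P (q + 1)) + #(antis r P p) := by
  have hchp := chains_peel_le hch
  have hanp : ∀ A ⊆ peel r P, IsAntichain r (A : Set α) → #A ≤ p :=
    fun A hA ha => han A (hA.trans peel_subset) ha
  have h1 := sum_feet_le (r := r) (P := P) hq
  have h2 := card_antis_peel_add (r := r) (P := P) p
  have h3 := (layerBound hp hq _ hchp hanp).1 1 (by omega)
  have h4 := hit_le_card_chains (r := r) (P := peel r P) hq
  have hI := hit_le (r := r) (P := peel r P) (m := q) bots_subset (bots_hit hq)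
  have hap : a ≤ p := by
    have := hit_le_card_level (i := 0) hchp (by omega)
    have := card_level_le hanp 0
    omega
  rw [ha] at h3 h4 hI
  set S := {z ∈ bots r (peel r P) q | #(feet r P z) = 1} with hS
  have h5 := (two_pow_exchange_feet hch han hD (S := S) (filter_subset _ _)
    fun z hz => (mem_filter.1 hz).2).2
  have hfeet : ∀ C ∈ chains r (peel r P) q, (∃ z ∈ C, z ∈ S) ∨
      2 ≤ #{x ∈ level r P 0 | ∀ y ∈ C, r x y} := by
    intro C hC
    obtain ⟨h6, h7, h8⟩ := mem_chains.1 hC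
    obtain ⟨z, hz, hbz⟩ := exists_chain_bot h8 (card_pos.1 (by omega))
    rw [feet_eq_of_bot hz hbz]
    by_cases hzS : z ∈ S
    · exact Or.inl ⟨z, hz, hzS⟩
    · right
      have h9 := card_pos.2 (feet_nonempty (r := r) (h6 hz))
      have h10 : #(feet r P z) ≠ 1 := fun h =>
        hzS (mem_filter.2 ⟨mem_bots.2 ⟨h6 hz, C, hC, hz, hbz⟩, h⟩)
      omega
  have hcases : #S = 0 ∨ #S = 1 ∨ 2 ≤ #S := by omega
  rcases hcases with h0 | h0 | h0
  -- all chains extend in two ways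
  · have h6 : #(chains r (peel r P) q) ≤ ∑ C ∈ chains r (peel r P) q,
        (#{x ∈ level r P 0 | ∀ y ∈ C, r x y} - 1) := by
      rw [card_eq_sum_ones]
      refine sum_le_sum fun C hC => ?_
      have := (hfeet C hC).resolve_left (by simp [card_eq_zero.1 h0])
      omega
    rw [h0, if_neg (by omega), pow_zero] at h5
    by_cases hnc : #(chains r (peel r P) q) ≤ a
    · have h7 := two_pow_le_antis_of_chains_le_hit hq (peel r P) hchp hanp (by omega) (b := 0)
        (by omega)
      rw [ha] at h7
      have := add_three_le_two_pow (by omega : 3 ≤ a)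
      omega
    · omega
  -- all chains that do not start in `z` extend in two ways
  · obtain ⟨z, hz⟩ := card_eq_one.1 h0
    have h6 := card_chains_eq_erase_add (r := r) (P := peel r P) (m := q) z
    have h7 : #(chains r ((peel r P).erase z) q) ≤ ∑ C ∈ chains r (peel r P) q,
        (#{x ∈ level r P 0 | ∀ y ∈ C, r x y} - 1) := by
      rw [card_eq_sum_ones]
      refine (sum_le_sum fun C hC => ?_).trans
        (sum_le_sum_of_subset (chains_mono (erase_subset z (peel r P))))
      have hzC : z ∉ C := fun h => notMem_erase z (peel r P) ((mem_chains.1 hC).1 h)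
      have := (hfeet C (chains_mono (erase_subset z (peel r P)) hC)).resolve_left (by
        rw [hz]
        simpa using hzC)
      omega
    rw [h0, if_neg (by omega), pow_one] at h5
    have h8 := hit_le_hit_erase_add_one (r := r) (P := peel r P) (z := z) hq
    have h9 := hit_le_card_chains (r := r) (P := (peel r P).erase z) hq
    by_cases hX : a ≤ #(chains r ((peel r P).erase z) q)
    · omega
    · have hzP : z ∈ peel r P := bots_subset (filter_subset _ _ (show z ∈ S by rw [hz]; simp))
      have h10 := card_erase_add_one hzP
      have h11 := two_pow_le_antis_of_chains_le_hit hq ((peel r P).erase z)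
        (fun C hC hc => hchp C (hC.trans (erase_subset _ _)) hc)
        (fun C hC hc => hanp C (hC.trans (erase_subset _ _)) hc) (by omega) (b := 0)
        (by omega)
      have h12 := card_le_card (antis_mono (r := r) (m := p) (erase_subset z (peel r P)))
      rw [show hit r ((peel r P).erase z) q = a - 1 by omega] at h11
      have := add_three_le_two_pow (by omega : 3 ≤ a - 1)
      omega
  · have h6 := sum_bots_le (r := r) (P := P) (q := q) _ Subset.rfl
    have h7 : #(bots r (peel r P) q) ≤ ∑ z ∈ bots r (peel r P) q, (#(feet r P z) - 1) + #S := by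
      rw [hS, card_filter, ← sum_add_distrib, card_eq_sum_ones]
      refine sum_le_sum fun z hz => ?_
      have := card_pos.2 (feet_nonempty (r := r) (bots_subset hz))
      split_ifs <;> omega
    by_cases h2S : #S = 2
    · rw [h2S, if_neg (by omega)] at h5
      omega
    · have := add_three_le_two_pow (by omega : 3 ≤ #S)
      split_ifs at h5 <;> omega

/-- The bound of `LayerBound` is not attained if `b ≥ 2` and at least four elements are needed to
meet all longest chains. -/
theorem layerBound_strict (hp : 2 ≤ p) (hq : 1 ≤ q) (P : Finset α)
    (hch : ∀ C ⊆ P, IsChain r (C : Set α) → #C ≤ q)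
    (han : ∀ A ⊆ P, IsAntichain r (A : Set α) → #A ≤ p) (ha : 4 ≤ hit r P q) {b : ℕ}
    (hb : p * q + hit r P q + (b + 2) + 1 = #P + p + q) :
    (hit r P q + 1) * (b + 3) ≤ #(chains r P q) + #(antis r P p) := by
  induction q, hq using Nat.le_induction generalizing P b with
  | base =>
    exfalso
    have h1 : #P ≤ hit r P 1 := by
      obtain ⟨Y, h5, h6, h7⟩ := exists_hit r P (m := 1) le_rfl
      rw [← h7]
      refine card_le_card fun x hx => ?_
      obtain ⟨y, hy, hy'⟩ := h6 {x} (mem_chains.2 ⟨by simpa using hx, by simp, by simp⟩)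
      rw [mem_singleton] at hy
      exact hy ▸ hy'
    omega
  | succ q hq ih =>
    have hchp := chains_peel_le hch
    have hanp : ∀ A ⊆ peel r P, IsAntichain r (A : Set α) → #A ≤ p :=
      fun A hA ha => han A (hA.trans peel_subset) ha
    have hIH := layerBound hp hq (peel r P) hchp hanp
    obtain ⟨e, he⟩ := Nat.exists_eq_add_of_le (card_level_le (r := r) han 0)
    have hc := card_peel (r := r) (P := P)
    have h1 := card_chains_peel_le (r := r) (P := P) hq
    have h2 := card_le_card (antis_mono (r := r) (m := p) (peel_subset (r := r) (P := P)))
    have h3 := hit_le_hit_peel (r := r) (P := P) hq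
    have h4 := (hit_peel_le hq hch han he.symm).1
    rcases h4.lt_or_eq with hlt | heq
    · obtain ⟨b', hb'⟩ := Nat.exists_eq_add_of_le hlt
      have h5 := ih (peel r P) hchp hanp (by omega) (b := b + b') (by
        rw [mul_add, mul_one] at hb
        omega)
      have h6 : (hit r P (q + 1) + 1) * (b + 3) ≤ (hit r (peel r P) q + 1) * (b + b' + 3) :=
        Nat.mul_le_mul (by omega) (by omega)
      omega
    · rcases e.eq_zero_or_pos with rfl | he0
      · have hb' := hb
        rw [mul_add, mul_one] at hb'
        rcases b.eq_zero_or_pos with rfl | hb0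
        · have := layer_step_two hq hp hch han (by omega) heq (by omega) (by omega)
          omega
        · obtain ⟨b, rfl⟩ : ∃ b', b = b' + 1 := ⟨b - 1, by omega⟩
          have h5 := ih (peel r P) hchp hanp (by omega) (b := b) (by omega)
          have hfr : freed r P ∅ = level r P 0 := by simp [freed]
          have h9 := gain_of_freed hq hch han (Z := ∅) (empty_subset _) (by rw [hfr]; omega)
            he.symm (l := 0) (fun _ => Or.inl (by simpa using by omega))
          have hI := hit_le (r := r) (P := peel r P) (m := q) bots_subset (bots_hit hq)
          rw [heq] at h5 hI
          linarith
      · have := layer_step hq hch han he.symm hIH heq (b := b + 1) hb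
        have h5 : 1 ≤ e * (b + 1) := Nat.mul_pos he0 (by omega)
        rw [show b + 1 + 2 = b + 3 by ring] at this
        omega

omit [IsStrictOrder α r] in
/-- The case of between `k² + k + 1` and `k² + 2k` elements without a chain or antichain of size
`k + 2`. Here `layerBound` gives `(a + 1) (b + 1) - 1` monotone sets, where `a = hit r P (k +
1)` and `a + b = k + t`. As `t ≤ a ≤ k`, this is smallest for `a = t` and `a = k`; at these two
ends the order itself or the conjugate one needs `k` elements to meet its longest chains, and
`layerBound_strict` excludes equality. -/
theorem extremal_le_mono_of_height_width [IsStrictOrder α r] [IsStrictOrder α s] (hc : Conj r s)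
    (hk : 4 ≤ k) {t : ℕ} (ht : 1 ≤ t) (htk : t ≤ k) (hn : #P = k * (k + 1) + t)
    (hch : ∀ C ⊆ P, IsChain r (C : Set α) → #C ≤ k + 1)
    (han : ∀ A ⊆ P, IsAntichain r (A : Set α) → #A ≤ k + 1) :
    extremal k #P ≤ mono r P (k + 1) ∧ (2 ≤ t → extremal k #P < mono r P (k + 1)) := by
  have hF : extremal k #P = k + t * (k + 1) := by
    rw [extremal_eq' (q := k + 1) htk ht hn]
    simp
  have hle : ∀ a, (k + 1) * a ≤ #P → a ≤ k := by
    intro a h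
    by_contra! hlt
    have : (k + 1) * (k + 1) ≤ (k + 1) * a := Nat.mul_le_mul_left _ hlt
    have h2 : (k + 1) * (k + 1) = k * (k + 1) + k + 1 := by ring
    omega
  have hmul : ∀ a, (k + 1) * (k + 1) + a + (k + t - a) + 1 = #P + (k + 1) + (k + 1) ↔ a ≤ k + t := by
    intro a
    have h2 : (k + 1) * (k + 1) = k * (k + 1) + k + 1 := by ring
    omega
  set a := hit r P (k + 1) with ha
  have h1 : a ≤ k := hle a (hit_mul_le hch)
  have h2 : t ≤ a := by
    have := card_le_hit_add (r := r) (P := P) (q := k) han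
    omega
  have h3 := (layerBound (by omega) (by omega) P hch han).1 (k + t - a) ((hmul a).2 (by omega))
  rw [← ha] at h3
  obtain ⟨d, hd⟩ := Nat.exists_eq_add_of_le h2
  obtain ⟨f, hf⟩ := Nat.exists_eq_add_of_le h1
  have h4 : (a + 1) * (k + t - a + 1) = (k + t * (k + 1)) + 1 + d * f := by
    rw [show k + t - a + 1 = f + t + 1 by omega, hf, hd]
    ring
  rw [hF]
  refine ⟨by unfold mono; omega, fun ht2 => ?_⟩
  have key : ∀ (s : α → α → Prop) [IsStrictOrder α s],
      (∀ C ⊆ P, IsChain s (C : Set α) → #C ≤ k + 1) →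
      (∀ A ⊆ P, IsAntichain s (A : Set α) → #A ≤ k + 1) → hit s P (k + 1) = k →
      k + t * (k + 1) < mono s P (k + 1) := by
    intro s _ hchs hans hs
    obtain ⟨t, rfl⟩ : ∃ t', t = t' + 2 := ⟨t - 2, by omega⟩
    have h5 := layerBound_strict (by omega) (by omega) P hchs hans (by omega) (b := t) (by
      have := (hmul k).2 (by omega)
      rw [hs]
      omega)
    rw [hs] at h5
    unfold mono
    nlinarith
  by_cases hak : a = k
  · exact key r hch han hak
  by_cases hat : a = t
  · rw [← hc.mono_eq]
    have hchs : ∀ C ⊆ P, IsChain s (C : Set α) → #C ≤ k + 1 :=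
      fun C hC h => han C hC (hc.isChain_iff.1 h)
    have hans : ∀ C ⊆ P, IsAntichain s (C : Set α) → #C ≤ k + 1 :=
      fun C hC h => hch C hC (hc.symm.isChain_iff.2 h)
    refine key s hchs hans (le_antisymm (hle _ (hit_mul_le hchs)) ?_)
    obtain ⟨Y, _, h6, h7⟩ := exists_hit r P (m := k + 1) (by omega)
    obtain ⟨Y', _, h8, h9⟩ := exists_hit s P (m := k + 1) (by omega)
    have h10 := card_le_of_hits (r := r) (P := P) (k := k) (Y := Y ∪ Y')
      (fun C hC => by
        obtain ⟨x, hx, hx'⟩ := h6 C hC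
        exact ⟨x, hx, mem_union_left _ hx'⟩)
      (fun C hC => by
        rw [← hc.chains_eq] at hC
        obtain ⟨x, hx, hx'⟩ := h8 C hC
        exact ⟨x, hx, mem_union_right _ hx'⟩)
    have h11 := card_union_le Y Y'
    have h12 : k * (k + 1) = k * k + k := by ring
    omega
  · have : 1 ≤ d * f := Nat.mul_pos (by omega) (by omega)
    unfold mono
    omega

end

section

variable {α : Type*} {r s : α → α → Prop} {P Q A U V Z W : Finset α} {x y z : α}
  {m k i j p q Λ : ℕ}

/-! ### Expansion between antichains -/

/-- If there are fewer than `2 ^ Λ` antichains of size `k + 1`, then between two antichains `U`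
and `V`, no element of `V` lying below an element of `U`, there is expansion: either all but few
elements of `V` have an element of `U` below them, or all but few have two. -/
theorem expansion (hUP : U ⊆ P) (hVP : V ⊆ P) (hU : IsAntichain r (U : Set α))
    (hV : IsAntichain r (V : Set α)) (hd : Disjoint U V) (h : ∀ u ∈ U, ∀ v ∈ V, ¬r v u)
    (han : ∀ A ⊆ P, IsAntichain r (A : Set α) → #A ≤ k + j)
    (hfew : #(antis r P (k + 1)) < 2 ^ Λ) (hΛ : Λ ≤ k + 1) :
    #U + #V ≤ #{v ∈ V | ∃ u ∈ U, r u v} + k ∨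
      #U + #V ≤ #{v ∈ V | 2 ≤ #{u ∈ U | r u v}} + k + (Λ + j) := by
  by_contra! hcon
  obtain ⟨h1, h2⟩ := hcon
  have hanti : ∀ U' ⊆ U, ∀ V' ⊆ V, (∀ u ∈ U', ∀ v ∈ V', ¬r u v) →
      IsAntichain r ((U' ∪ V' : Finset α) : Set α) := by
    intro U' hU' V' hV' h' x hx y hy hxy hr
    simp only [coe_union, Set.mem_union, mem_coe] at hx hy
    rcases hx with hx | hx <;> rcases hy with hy | hy
    · exact hU (hU' hx) (hU' hy) hxy hr
    · exact h' x hx y hy hr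
    · exact h y (hU' hy) x (hV' hx) hr
    · exact hV (hV' hx) (hV' hy) hxy hr
  -- the elements that are the only lower neighbour of some element of `V`; in a large antichain
  -- they could be exchanged independently for such elements of `V`
  set X := {u ∈ U | ∃ v ∈ V, ∀ u' ∈ U, r u' v ↔ u' = u} with hX
  have hXΛ : #X < Λ := by
    by_contra! hge
    obtain ⟨X', hX', hX'c⟩ := exists_subset_card_eq hge
    have hex : ∀ u ∈ X', ∃ v ∈ V, ∀ u' ∈ U, r u' v ↔ u' = u :=
      fun u hu => (mem_filter.1 (hX' hu)).2
    choose! ζ hζV hζ using hex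
    have hX'U : ∀ u ∈ X', u ∈ U := fun u hu => (mem_filter.1 (hX' hu)).1
    have hζinj : Set.InjOn ζ X' := by
      intro u hu u' hu' he
      have := (hζ u hu u (hX'U u hu)).2 rfl
      rw [he] at this
      exact (hζ u' hu' u (hX'U u hu)).1 this
    set Z := X'.image ζ with hZ
    have hex2 : ∀ v ∈ Z, ∃ u ∈ X', ζ u = v := fun v hv => by simpa [hZ] using hv
    choose! ξ hξX hξ using hex2
    set W := U ∪ {v ∈ V | ¬∃ u ∈ U, r u v} with hW
    have hWc : k + 1 ≤ #W := by
      rw [hW, card_union_of_disjoint (disjoint_of_subset_right (filter_subset _ _) hd)]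
      have := card_filter_add_card_filter_not (s := V) (fun v => ∃ u ∈ U, r u v)
      omega
    have hX'W : X' ⊆ W := fun u hu => mem_union_left _ (hX'U u hu)
    obtain ⟨A, hA1, hA2, hA3⟩ := exists_subsuperset_card_eq hX'W (by omega) hWc
    have hWanti : IsAntichain r (W : Set α) := hanti U Subset.rfl _ (filter_subset _ _)
      fun u hu v hv hr => (mem_filter.1 hv).2 ⟨u, hu, hr⟩
    have hZV : Z ⊆ V := by
      intro v hv
      obtain ⟨u, hu, rfl⟩ := mem_image.1 hv
      exact hζV u hu
    have hWP : W ⊆ P := union_subset hUP ((filter_subset _ _).trans hVP)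
    have := two_pow_le_card_antis ξ (hA2.trans hWP) (hZV.trans hVP)
      (hWanti.subset (by exact_mod_cast hA2)) (hV.subset (by exact_mod_cast hZV))
      (fun v hv => hA1 (hξX v hv))
      (fun v hv v' hv' he => by rw [← hξ v hv, he, hξ v' hv'])
      (by
        rw [disjoint_right]
        intro v hv hvA
        rcases mem_union.1 (hA2 hvA) with h3 | h3
        · exact disjoint_left.1 hd h3 (hZV hv)
        · refine (mem_filter.1 h3).2 ⟨ξ v, hX'U _ (hξX v hv), ?_⟩
          have := (hζ (ξ v) (hξX v hv) (ξ v) (hX'U _ (hξX v hv))).2 rfl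
          rwa [hξ v hv] at this)
      (by
        intro v hv a ha hr
        rcases mem_union.1 (hA2 ha) with h3 | h3
        · rcases hr with hr | hr
          · have := (hζ (ξ v) (hξX v hv) a h3)
            rw [hξ v hv] at this
            exact this.1 hr
          · exact absurd hr (h a h3 v (hZV hv))
        · exfalso
          have h4 := mem_filter.1 h3
          have hne : a ≠ v := by
            rintro rfl
            refine h4.2 ⟨ξ a, hX'U _ (hξX a hv), ?_⟩
            have := (hζ (ξ a) (hξX a hv) (ξ a) (hX'U _ (hξX a hv))).2 rfl
            rwa [hξ a hv] at this
          rcases hr with hr | hr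
          · exact hV h4.1 (hZV hv) hne hr
          · exact hV (hZV hv) h4.1 hne.symm hr)
    rw [hA3, hZ, card_image_of_injOn hζinj, hX'c] at this
    omega
  -- without them, `U` forms an antichain with the elements of `V` that have no two lower
  -- neighbours
  have h3 := hanti (U \ X) sdiff_subset {v ∈ V | ¬2 ≤ #{u ∈ U | r u v}} (filter_subset _ _) (by
    intro u hu v hv hr
    obtain ⟨huU, huX⟩ := mem_sdiff.1 hu
    obtain ⟨hvV, hv2⟩ := mem_filter.1 hv
    refine huX (mem_filter.2 ⟨huU, v, hvV, fun u' hu' => ⟨fun hr' => ?_, fun he => he ▸ hr⟩⟩)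
    by_contra hne
    have h4 : ({u', u} : Finset α) ⊆ {u ∈ U | r u v} := by
      simp [insert_subset_iff, hu', hr', huU, hr]
    have := card_le_card h4
    rw [card_pair hne] at this
    exact hv2 this)
  have h4 := han _ (union_subset (sdiff_subset.trans hUP) ((filter_subset _ _).trans hVP)) h3
  rw [card_union_of_disjoint (disjoint_of_subset_left sdiff_subset
    (disjoint_of_subset_right (filter_subset _ _) hd))] at h4
  have h5 := card_filter_add_card_filter_not (s := V) (fun v => 2 ≤ #{u ∈ U | r u v})
  have h6 := le_card_sdiff X U
  omega

variable [IsStrictOrder α r]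

/-! ### The number of longest chains below an element -/

/-- A longest chain below `x`, together with `x`, has exactly one element of each rank up to
that of `x`. -/
theorem card_union_rk_filter {C : Finset α} (hC : C ⊆ below r P x) (hc : IsChain r (C : Set α))
    (hcard : #C = rk r P x) {a b : ℕ} (hb : b ≤ rk r P x + 1) :
    #{y ∈ insert x C | a ≤ rk r P y ∧ rk r P y < b} = b - a := by
  have hlt : ∀ y ∈ C, rk r P y < rk r P x := fun y hy =>
    rk_lt_rk (mem_below.1 (hC hy)).1 (mem_below.1 (hC hy)).2
  have hinj : Set.InjOn (rk r P) (insert x C : Finset α) := by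
    intro y hy z hz he
    simp only [coe_insert, Set.mem_insert_iff, mem_coe] at hy hz
    rcases hy with rfl | hy <;> rcases hz with rfl | hz
    · rfl
    · have := hlt z hz; omega
    · have := hlt y hy; omega
    · exact rk_injOn_chain (hC.trans below_subset) hc hy hz he
  rw [← Nat.card_Ico, ← card_image_of_injOn (hinj.mono (by exact_mod_cast filter_subset _ _))]
  congr 1
  ext i
  simp only [mem_image, mem_filter, mem_Ico]
  constructor
  · rintro ⟨y, ⟨_, h⟩, rfl⟩
    exact h
  · intro hi
    rcases Nat.lt_or_ge i (rk r P x) with h | h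
    · obtain ⟨y, hy, rfl⟩ := exists_mem_rk_eq (hC.trans below_subset) hc hlt hcard.ge h
      exact ⟨y, ⟨mem_insert_of_mem hy, hi⟩, rfl⟩
    · have : i = rk r P x := by omega
      subst this
      exact ⟨x, ⟨mem_insert_self _ _, hi⟩, rfl⟩

/-- An element of a `(k + 1)`-chain has fewer than `2 ^ (2 * Λ)` longest chains below it, since
these chains give rise to different pairs of `(k + 1)`-chains. -/
theorem maxBelow_lt (hfew : #(chains r P (k + 1)) < 2 ^ Λ) {B : Finset α}
    (hB : B ∈ chains r P (k + 1)) (hx : x ∈ B) (hrk : rk r P x < 2 * (k + 1)) :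
    maxBelow r P x < 2 ^ (2 * Λ) := by
  obtain ⟨hBP, hBc, hBch⟩ := mem_chains.1 hB
  have hpow : 2 ^ (2 * Λ) = 2 ^ Λ * 2 ^ Λ := by rw [two_mul, pow_add]
  rcases Nat.lt_or_ge k (rk r P x) with hlt | hle
  -- a longest chain with at least `k + 1` elements, extended by `x`, is determined by its lowest
  -- and its highest `k + 1` elements
  · have : maxBelow r P x ≤ #(chains r P (k + 1) ×ˢ chains r P (k + 1)) := by
      apply card_le_card_of_injOn fun C : Finset α =>
        (({y ∈ insert x C | 0 ≤ rk r P y ∧ rk r P y < k + 1} : Finset α),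
        ({y ∈ insert x C | rk r P x - k ≤ rk r P y ∧ rk r P y < rk r P x + 1} : Finset α))
      · intro C hC
        obtain ⟨h1, h2, h3⟩ := mem_chains.1 (mem_coe.1 hC)
        have h4 := isChain_insert_above h3 fun y hy => (mem_below.1 (h1 hy)).2
        have h5 : insert x C ⊆ P := insert_subset (hBP hx) (h1.trans below_subset)
        refine mem_coe.2 (mem_product.2 ⟨mem_chains.2 ⟨(filter_subset _ _).trans h5, ?_,
          h4.mono (by exact_mod_cast filter_subset _ _)⟩, mem_chains.2
          ⟨(filter_subset _ _).trans h5, ?_, h4.mono (by exact_mod_cast filter_subset _ _)⟩⟩)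
        · rw [card_union_rk_filter h1 h3 h2 (by omega)]; omega
        · rw [card_union_rk_filter h1 h3 h2 (by omega)]; omega
      · intro C hC C' hC' he
        obtain ⟨h1, h2, h3⟩ := mem_chains.1 (mem_coe.1 hC)
        obtain ⟨h1', h2', h3'⟩ := mem_chains.1 (mem_coe.1 hC')
        simp only [Prod.mk.injEq] at he
        have key : ∀ C ⊆ below r P x, {y ∈ insert x C | 0 ≤ rk r P y ∧ rk r P y < k + 1} ∪
            {y ∈ insert x C | rk r P x - k ≤ rk r P y ∧ rk r P y < rk r P x + 1} = insert x C := by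
          intro C hC
          rw [← filter_or]
          apply filter_true_of_mem
          intro y hy
          have : rk r P y ≤ rk r P x := by
            rcases mem_insert.1 hy with rfl | hy
            · exact le_rfl
            · exact (rk_lt_rk (mem_below.1 (hC hy)).1 (mem_below.1 (hC hy)).2).le
          omega
        have h4 : insert x C = insert x C' := by rw [← key C h1, ← key C' h1', he.1, he.2]
        exact (insert_below_inj h1 h1' h4).2
    rw [card_product] at this
    rw [hpow]
    exact this.trans_lt (Nat.mul_self_lt_mul_self hfew)
  -- a shorter one is completed by elements of `B` from `x` upwards
  · have hR : k + 1 - rk r P x ≤ #{y ∈ B | ¬r y x} := by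
      have h1 := card_filter_add_card_filter_not (s := B) (fun y => r y x)
      have h2 : #{y ∈ B | r y x} ≤ rk r P x := card_le_rk
        (fun y hy => mem_below.2 ⟨hBP (mem_filter.1 hy).1, (mem_filter.1 hy).2⟩)
        (hBch.mono (by exact_mod_cast filter_subset _ _))
      omega
    obtain ⟨R, hR1, hR2⟩ := exists_subset_card_eq hR
    have hxR : ∀ y ∈ R, y = x ∨ r x y := by
      intro y hy
      obtain ⟨h1, h2⟩ := mem_filter.1 (hR1 hy)
      by_cases hyx : y = x
      · exact Or.inl hyx
      · exact Or.inr ((hBch h1 hx hyx).resolve_left h2)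
    have hRB : R ⊆ B := hR1.trans (filter_subset _ _)
    have : maxBelow r P x ≤ #(chains r P (k + 1)) := by
      apply card_le_card_of_injOn fun C => C ∪ R
      · intro C hC
        obtain ⟨h1, h2, h3⟩ := mem_chains.1 (mem_coe.1 hC)
        refine mem_coe.2 (mem_chains.2 ⟨union_subset (h1.trans below_subset) (hRB.trans hBP), ?_,
          isChain_union_of_lt h3 (hBch.mono (by exact_mod_cast hRB)) fun c hc y hy => ?_⟩)
        · rw [card_union_of_disjoint, h2, hR2]
          · omega
          · rw [disjoint_left]
            intro c hc hcR
            exact (mem_filter.1 (hR1 hcR)).2 (mem_below.1 (h1 hc)).2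
        · rcases hxR y hy with rfl | h
          · exact (mem_below.1 (h1 hc)).2
          · exact _root_.trans (mem_below.1 (h1 hc)).2 h
      · intro C hC C' hC' he
        have key : ∀ C ∈ chains r (below r P x) (rk r P x), {y ∈ C ∪ R | r y x} = C := by
          intro C hC
          obtain ⟨h1, h2, h3⟩ := mem_chains.1 hC
          ext y
          simp only [mem_filter, mem_union]
          constructor
          · rintro ⟨h | h, h'⟩
            · exact h
            · exact absurd h' (mem_filter.1 (hR1 h)).2
          · exact fun h => ⟨Or.inl h, (mem_below.1 (h1 h)).2⟩
        simp only at he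
        rw [← key C hC, he, key C' hC']
    exact (this.trans_lt hfew).trans_le (Nat.pow_le_pow_right (by norm_num) (by omega))

end

/-! ### Spreading of chains through the levels -/

section

variable {α : Type*} {r s : α → α → Prop} {P Q A U V Z W Y : Finset α} {x y z : α}
  {m k i j p q l θ Λ E : ℕ} {X : ℤ}

/-- Chains and antichains of `P` have at most `k + j` elements, and fewer than `2 ^ Λ` of them have
exactly `k + 1` elements. -/
structure Bounded (r : α → α → Prop) (P : Finset α) (k j Λ : ℕ) : Prop where
  chain_le : ∀ C ⊆ P, IsChain r (C : Set α) → #C ≤ k + j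
  anti_le : ∀ A ⊆ P, IsAntichain r (A : Set α) → #A ≤ k + j
  chains_lt : #(chains r P (k + 1)) < 2 ^ Λ
  antis_lt : #(antis r P (k + 1)) < 2 ^ Λ
  le_succ : Λ ≤ k + 1
  j_le : j ≤ k

theorem Bounded.subset (h : Bounded r P k j Λ) (hQ : Q ⊆ P) : Bounded r Q k j Λ where
  chain_le C hC := h.chain_le C (hC.trans hQ)
  anti_le C hC := h.anti_le C (hC.trans hQ)
  chains_lt := (card_le_card (chains_mono hQ)).trans_lt h.chains_lt
  antis_lt := (card_le_card (antis_mono hQ)).trans_lt h.antis_lt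
  le_succ := h.le_succ
  j_le := h.j_le

theorem Bounded.conj (h : Bounded r P k j Λ) (hc : Conj r s) : Bounded s P k j Λ where
  chain_le C hC h' := h.anti_le C hC (hc.isChain_iff.1 h')
  anti_le C hC h' := h.chain_le C hC (hc.symm.isChain_iff.2 h')
  chains_lt := hc.chains_eq ▸ h.antis_lt
  antis_lt := hc.antis_eq ▸ h.chains_lt
  le_succ := h.le_succ
  j_le := h.j_le

/-- The surplus of the first `l` levels over `k` elements per level. -/
noncomputable def excess (r : α → α → Prop) (P : Finset α) (k l : ℕ) : ℤ :=
  #{x ∈ P | rk r P x < l} - k * l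

/-- The elements of rank `l` with at least `θ` longest chains below them. -/
noncomputable def rich (r : α → α → Prop) (P : Finset α) (l θ : ℕ) : Finset α :=
  {x ∈ P | rk r P x = l ∧ θ ≤ maxBelow r P x}

/-- All but about `X` elements of level `l` have `θ` longest chains below them. The surplus of the
levels up to `l` is counted in favour of the elements with many chains, which makes the condition
pass from one level to the next. -/
def Spread (r : α → α → Prop) (P : Finset α) (k l θ : ℕ) (X : ℤ) : Prop :=
  k + excess r P k (l + 1) - X ≤ #(rich r P l θ)

theorem mem_rich : x ∈ rich r P l θ ↔ x ∈ P ∧ rk r P x = l ∧ θ ≤ maxBelow r P x := by simp [rich]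

theorem rich_subset_level : rich r P l θ ⊆ level r P l := fun x hx => by
  rw [mem_rich] at hx
  exact mem_level.2 ⟨hx.1, hx.2.1⟩

theorem rich_one : rich r P l 1 = level r P l := by
  ext x
  simp only [mem_rich, mem_level, maxBelow_pos, and_true]

theorem rich_anti {θ' : ℕ} (h : θ ≤ θ') : rich r P l θ' ⊆ rich r P l θ := fun x hx => by
  rw [mem_rich] at *
  exact ⟨hx.1, hx.2.1, h.trans hx.2.2⟩

theorem excess_zero : excess r P k 0 = 0 := by simp [excess]

theorem excess_succ : excess r P k (l + 1) = excess r P k l + #(level r P l) - k := by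
  have : {x ∈ P | rk r P x < l + 1} = {x ∈ P | rk r P x < l} ∪ level r P l := by
    ext x
    simp only [mem_filter, mem_union, mem_level, Nat.lt_succ_iff_lt_or_eq]
    tauto
  rw [excess, excess, this, card_union_of_disjoint]
  · push_cast
    ring
  · rw [disjoint_left]
    intro x h1 h2
    have := (mem_filter.1 h1).2
    have := (mem_level.1 h2).2
    omega

theorem excess_eq_card (h : ∀ x ∈ P, rk r P x < l) : excess r P k l = #P - k * l := by
  rw [excess, filter_true_of_mem h]

theorem Spread.weaken {θ' : ℕ} {X' : ℤ} (h : Spread r P k l θ X) (hθ : θ' ≤ θ) (hX : X ≤ X') :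
    Spread r P k l θ' X' := by
  have := card_le_card (rich_anti (r := r) (P := P) (l := l) hθ)
  unfold Spread at *
  omega

theorem spread_one : Spread r P k l 1 (excess r P k l) := by
  rw [Spread, rich_one, excess_succ]
  omega

/-- The elements of a level with fewer than `θ` longest chains below them. -/
theorem Spread.card_level_sdiff (h : Spread r P k l θ X) :
    (#(level r P l \ rich r P l θ) : ℤ) ≤ X - excess r P k l := by
  have := card_sdiff_add_card_eq_card (rich_subset_level (r := r) (P := P) (l := l) (θ := θ))
  unfold Spread at h
  rw [excess_succ] at h
  omega

variable [IsStrictOrder α r]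

theorem le_maxBelow_of_rich (hx : x ∈ rich r P l θ) (hz : rk r P z = l + 1) (hr : r x z) :
    θ ≤ maxBelow r P z := by
  have h := mem_rich.1 hx
  have := sum_maxBelow_le (r := r) (P := P) (z := z) (S := {x}) (by
    intro y hy
    rw [mem_singleton] at hy
    subst hy
    exact ⟨h.1, hr, by omega⟩)
  rw [sum_singleton] at this
  exact h.2.2.trans this

theorem add_le_maxBelow (hne : x ≠ y) {a b : ℕ} (hx : x ∈ rich r P l a) (hy : y ∈ rich r P l b)
    (hz : rk r P z = l + 1) (hxz : r x z) (hyz : r y z) : a + b ≤ maxBelow r P z := by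
  have h1 := mem_rich.1 hx
  have h2 := mem_rich.1 hy
  have := sum_maxBelow_le (r := r) (P := P) (z := z) (S := {x, y}) (by
    intro w hw
    rw [mem_insert, mem_singleton] at hw
    rcases hw with rfl | rfl
    · exact ⟨h1.1, hxz, by omega⟩
    · exact ⟨h2.1, hyz, by omega⟩)
  rw [sum_pair hne] at this
  omega

theorem Bounded.expansion_level (h : Bounded r P k j Λ) (hU : U ⊆ level r P l) :
    #U + #(level r P (l + 1)) ≤ #{v ∈ level r P (l + 1) | ∃ u ∈ U, r u v} + k ∨
      #U + #(level r P (l + 1)) ≤ #{v ∈ level r P (l + 1) | 2 ≤ #{u ∈ U | r u v}} + k +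
        (Λ + j) := by
  refine expansion (P := P) (hU.trans level_subset) level_subset
    (level_antichain.subset (by exact_mod_cast hU)) level_antichain ?_ ?_ h.anti_le h.antis_lt
    h.le_succ
  · rw [disjoint_left]
    intro x h1 h2
    have := (mem_level.1 (hU h1)).2
    have := (mem_level.1 h2).2
    omega
  · intro u hu v hv hr
    have := rk_lt_rk (mem_level.1 hv).1 hr
    have := (mem_level.1 (hU hu)).2
    have := (mem_level.1 hv).2
    omega

/-- For more than `k` elements of a level only the second alternative is possible. -/
theorem Bounded.expansion_level_of_lt (h : Bounded r P k j Λ) (hU : U ⊆ level r P l)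
    (hk : k < #U) : #{v ∈ level r P (l + 1) | ¬2 ≤ #{u ∈ U | r u v}} + #U ≤ k + (Λ + j) := by
  have h1 := card_filter_add_card_filter_not (s := level r P (l + 1))
    (fun v => 2 ≤ #{u ∈ U | r u v})
  rcases h.expansion_level hU with h2 | h2
  · have := card_filter_le (level r P (l + 1)) (fun v => ∃ u ∈ U, r u v)
    omega
  · omega

theorem subset_rich_of_exists :
    {v ∈ level r P (l + 1) | ∃ u ∈ rich r P l θ, r u v} ⊆ rich r P (l + 1) θ := by
  intro z hz
  obtain ⟨h1, u, hu, hr⟩ := mem_filter.1 hz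
  exact mem_rich.2 ⟨(mem_level.1 h1).1, (mem_level.1 h1).2,
    le_maxBelow_of_rich hu (mem_level.1 h1).2 hr⟩

theorem subset_rich_two_mul :
    {v ∈ level r P (l + 1) | 2 ≤ #{u ∈ rich r P l θ | r u v}} ⊆ rich r P (l + 1) (2 * θ) := by
  intro z hz
  obtain ⟨h1, h2⟩ := mem_filter.1 hz
  obtain ⟨u, hu, v, hv, hne⟩ := one_lt_card.1 h2
  rw [mem_filter] at hu hv
  refine mem_rich.2 ⟨(mem_level.1 h1).1, (mem_level.1 h1).2, ?_⟩
  rw [two_mul]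
  exact add_le_maxBelow hne hu.1 hv.1 (mem_level.1 h1).2 hu.2 hv.2

/-- Going up one level, either the number of chains is kept or it doubles. -/
theorem Bounded.step (h : Bounded r P k j Λ) (hS : Spread r P k l θ X) :
    Spread r P k (l + 1) θ X ∨ Spread r P k (l + 1) (2 * θ) (X + (Λ + j : ℕ)) := by
  unfold Spread at *
  rw [excess_succ (l := l + 1)]
  rcases h.expansion_level (rich_subset_level (l := l) (θ := θ)) with h1 | h1
  · have := card_le_card (subset_rich_of_exists (r := r) (P := P) (l := l) (θ := θ))
    left; omega
  · have := card_le_card (subset_rich_two_mul (r := r) (P := P) (l := l) (θ := θ))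
    right; omega

/-- Going up from a level with more than `k` elements, the number of chains grows. -/
theorem Bounded.raise (h : Bounded r P k j Λ) (hS : Spread r P k l θ X) (hθ : 1 ≤ θ)
    (hk : k < #(level r P l)) : Spread r P k (l + 1) (θ + 1) (X + (Λ + j : ℕ)) := by
  rcases h.expansion_level (rich_subset_level (l := l) (θ := θ)) with h1 | h1
  · have h2 := h.expansion_level_of_lt (l := l) Subset.rfl hk
    have h3 : {v ∈ level r P (l + 1) | ∃ u ∈ rich r P l θ, r u v} \
        {v ∈ level r P (l + 1) | ¬2 ≤ #{u ∈ level r P l | r u v}} ⊆ rich r P (l + 1) (θ + 1) := by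
      intro z hz
      obtain ⟨h4, h5⟩ := mem_sdiff.1 hz
      obtain ⟨h6, u, hu, hr⟩ := mem_filter.1 h4
      have h7 : 2 ≤ #{u ∈ level r P l | r u z} := by
        by_contra hcon
        exact h5 (mem_filter.2 ⟨h6, hcon⟩)
      obtain ⟨v, hv, hne⟩ := exists_mem_ne h7 u
      rw [mem_filter] at hv
      exact mem_rich.2 ⟨(mem_level.1 h6).1, (mem_level.1 h6).2,
        add_le_maxBelow hne.symm hu (rich_one (r := r) ▸ hv.1) (mem_level.1 h6).2 hr hv.2⟩
    have h4 := card_le_card h3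
    have h5 := le_card_sdiff {v ∈ level r P (l + 1) | ¬2 ≤ #{u ∈ level r P l | r u v}}
      {v ∈ level r P (l + 1) | ∃ u ∈ rich r P l θ, r u v}
    unfold Spread at *
    rw [excess_succ (l := l + 1)]
    omega
  · have := card_le_card (subset_rich_two_mul (r := r) (P := P) (l := l) (θ := θ))
    refine Spread.weaken (θ := 2 * θ) ?_ (by omega) le_rfl
    unfold Spread at *
    rw [excess_succ (l := l + 1)]
    omega

/-- Every set meeting all chains of the largest possible size has at least `k - E` elements. -/
def Robust (r : α → α → Prop) (P : Finset α) (k j E : ℕ) : Prop :=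
  ∀ Y : Finset α, (∀ C ∈ chains r P (k + j), ∃ x ∈ C, x ∈ Y) → k ≤ #Y + E

omit [IsStrictOrder α r] in
theorem exists_chain_mem {C : Finset α} (hC : C ⊆ P) (hc : IsChain r (C : Set α)) (hx : x ∈ C)
    (h : m + 1 ≤ #C) : ∃ D ∈ chains r P (m + 1), x ∈ D := by
  obtain ⟨D, h1, h2, h3⟩ := exists_subsuperset_card_eq (singleton_subset_iff.2 hx)
    (by simp : #{x} ≤ m + 1) h
  exact ⟨D, mem_chains.2 ⟨h2.trans hC, h3, hc.mono (by exact_mod_cast h2)⟩,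
    h1 (mem_singleton_self x)⟩

theorem Bounded.rk_lt (h : Bounded r P k j Λ) (hx : x ∈ P) : rk r P x < k + j :=
  rk_lt_of_chains_le h.chain_le hx

/-- In a robust order the number of chains below most elements of a level cannot be huge. -/
theorem Bounded.not_spread (h : Bounded r P k j Λ) (hj : 1 ≤ j) (hR : Robust r P k j E)
    (hl : l < k + j) (hθ : 2 ^ (2 * Λ) ≤ θ) (hX : X - excess r P k l + E < k) :
    ¬Spread r P k l θ X := by
  intro hS
  have h1 := hS.card_level_sdiff
  have h2 : ∃ C ∈ chains r P (k + j), ∀ x ∈ C, x ∉ level r P l \ rich r P l θ := by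
    by_contra! hcon
    have := hR _ hcon
    omega
  obtain ⟨C, hC, hCY⟩ := h2
  obtain ⟨h3, h4, h5⟩ := mem_chains.1 hC
  obtain ⟨x, hx, hxl⟩ := exists_mem_rk_eq h3 h5 (fun x hx => h.rk_lt (h3 hx)) h4.ge hl
  have h6 : x ∈ rich r P l θ := by
    by_contra hcon
    exact hCY x hx (mem_sdiff.2 ⟨mem_level.2 ⟨h3 hx, hxl⟩, hcon⟩)
  obtain ⟨D, hD, hxD⟩ := exists_chain_mem (m := k) h3 h5 hx (by omega)
  have := maxBelow_lt h.chains_lt hD hxD (by have := h.j_le; omega)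
  have := (mem_rich.1 h6).2.2
  omega

/-- The state of the climb: `σ` counts the additions made, up to the intended number `s`, and `y`
the doublings that occurred after them. -/
def Reach (r : α → α → Prop) (P : Finset α) (k j Λ s θ₀ : ℕ) (X₀ : ℤ) (l σ y : ℕ) : Prop :=
  σ ≤ s ∧ (0 < y → σ = s) ∧ y < 2 * Λ ∧
    Spread r P k l (2 ^ y * (θ₀ + σ)) (X₀ + (σ + y) * (Λ + j : ℕ))

/-- The indices in `[a, b)` of the levels with more than `k` elements. -/
noncomputable def bigLevels (r : α → α → Prop) (P : Finset α) (k a b : ℕ) : Finset ℕ :=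
  {i ∈ Ico a b | k < #(level r P i)}

omit [IsStrictOrder α r] in
theorem card_bigLevels_succ (hl : i ≤ l) : #(bigLevels r P k i (l + 1)) =
    #(bigLevels r P k i l) + (if k < #(level r P l) then 1 else 0) := by
  unfold bigLevels
  rw [show Ico i (l + 1) = insert l (Ico i l) by ext; simp only [mem_Ico, mem_insert]; omega,
    filter_insert]
  split_ifs with hif
  · rw [card_insert_of_notMem (by simp)]
  · rw [add_zero]

/-- Climbing from level `l₀` to level `l₁`: each level with more than `k` elements on the way adds
one, as long as fewer than `s` additions have been made. -/
theorem Bounded.climb (h : Bounded r P k j Λ) (hj : 1 ≤ j) (hR : Robust r P k j E) {s θ₀ : ℕ}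
    {X₀ β : ℤ} (hθ₀ : 1 ≤ θ₀) (hβ : ∀ l, l < k + j → -β ≤ excess r P k l)
    (hcap : X₀ + (s + 2 * Λ) * (Λ + j : ℕ) + β + E < k) {l₀ σ₀ y₀ : ℕ}
    (h₀ : Reach r P k j Λ s θ₀ X₀ l₀ σ₀ y₀) {l₁ : ℕ} (hl : l₀ ≤ l₁) (hl₁ : l₁ < k + j) :
    ∃ σ y, σ₀ ≤ σ ∧ y₀ ≤ y ∧ min s (σ₀ + #(bigLevels r P k l₀ l₁)) ≤ σ ∧
      Reach r P k j Λ s θ₀ X₀ l₁ σ y := by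
  induction l₁, hl using Nat.le_induction with
  | base => exact ⟨σ₀, y₀, le_rfl, le_rfl, by simp [bigLevels], h₀⟩
  | succ l hl ih =>
    obtain ⟨σ, y, h1, h2, h3, h4, h5, h6, h7⟩ := ih (by omega)
    rw [card_bigLevels_succ hl]
    -- one more doubling is possible, since huge numbers of chains are excluded
    have hdouble : Spread r P k (l + 1) (2 * (2 ^ y * (θ₀ + σ)))
        (X₀ + (σ + y) * (Λ + j : ℕ) + (Λ + j : ℕ)) → y + 1 < 2 * Λ := by
      intro hS
      by_contra! hge
      have hy : y + 1 = 2 * Λ := by omega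
      refine h.not_spread hj hR hl₁ (θ := 2 * (2 ^ y * (θ₀ + σ))) ?_ ?_ hS
      · rw [← mul_assoc, ← pow_succ', hy]
        exact Nat.le_mul_of_pos_right _ (by omega)
      · have := hβ (l + 1) hl₁
        have e1 : X₀ + (σ + y) * (Λ + j : ℕ) + (Λ + j : ℕ) =
            X₀ + (σ + (y + 1 : ℕ)) * (Λ + j : ℕ) := by push_cast; ring
        have e2 : ((σ : ℤ) + (y + 1 : ℕ)) * (Λ + j : ℕ) ≤ (s + 2 * Λ) * (Λ + j : ℕ) := by
          apply mul_le_mul_of_nonneg_right _ (by positivity)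
          omega
        omega
    have e1 : X₀ + (σ + y) * (Λ + j : ℕ) + (Λ + j : ℕ) =
        X₀ + (σ + (y + 1 : ℕ)) * (Λ + j : ℕ) := by push_cast; ring
    have e3 : X₀ + (σ + y) * (Λ + j : ℕ) + (Λ + j : ℕ) =
        X₀ + ((σ + 1 : ℕ) + y) * (Λ + j : ℕ) := by push_cast; ring
    by_cases hσ : σ = s
    · rcases h.step h7 with h8 | h8
      · exact ⟨σ, y, h1, h2, by omega, h4, h5, h6, h8⟩
      · refine ⟨σ, y + 1, h1, by omega, by omega, h4, fun _ => hσ, hdouble h8, ?_⟩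
        rw [← e1, pow_succ', mul_assoc]
        exact h8
    · have hy0 : y = 0 := by
        by_contra hy
        exact hσ (h5 (by omega))
      subst hy0
      by_cases hgood : k < #(level r P l)
      · rw [if_pos hgood]
        have h8 := h.raise h7 (by simp; omega) hgood
        refine ⟨σ + 1, 0, by omega, h2, by omega, by omega, by omega, h6, ?_⟩
        rw [← e3]
        simpa [add_assoc] using h8
      · rw [if_neg hgood]
        rcases h.step h7 with h8 | h8
        · exact ⟨σ, 0, h1, h2, by omega, h4, h5, h6, h8⟩
        · refine ⟨σ + 1, 0, by omega, h2, by omega, by omega, by omega, h6, ?_⟩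
          rw [← e3]
          refine h8.weaken ?_ le_rfl
          simp only [pow_zero, one_mul]
          omega

end

/-! ### Robustness of one of two conjugate orders -/

section

variable {α : Type*} {r s : α → α → Prop} {P Q A U V Z W Y : Finset α} {x y z : α}
  {m k i j p q l θ Λ E : ℕ} {X : ℤ}

variable [IsStrictOrder α r]

theorem exists_min_excess (r : α → α → Prop) (P : Finset α) (k m : ℕ) :
    ∃ i ≤ m, ∀ l ≤ m, excess r P k i ≤ excess r P k l := by
  obtain ⟨i, hi, h⟩ := exists_min_image (range (m + 1)) (excess r P k) ⟨0, by simp⟩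
  exact ⟨i, by simpa [Nat.lt_succ_iff] using hi, fun l hl => h l (by simp; omega)⟩

/-- A set without chains of size `k + j` that has clearly more than `k` elements per level. From
the level of least surplus on, the number of chains below most elements has to double again and
again, until it is too large for elements of `(k + 1)`-chains. Hence the `(k + 1)`-chains pass
`j - 1` consecutive levels only through a few exceptional elements. -/
theorem Bounded.exists_small_hit (h : Bounded r Q k j Λ) (hj : 2 ≤ j) (hΛ : 1 ≤ Λ)
    (hch : ∀ C ⊆ Q, IsChain r (C : Set α) → #C + 1 ≤ k + j)
    (hk : (2 * Λ + j) * (Λ + j) < k)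
    (hcard : k * (k + j - 1) + (j + (2 * Λ) * (Λ + j)) < #Q) :
    ∃ Y : Finset α, #Y ≤ j * ((2 * Λ + j) * (Λ + j)) ∧
      ∀ C ∈ chains r Q (k + 1), ∃ x ∈ C, x ∈ Y := by
  set m := k + j - 1 with hm
  have hrk : ∀ x ∈ Q, rk r Q x < m := fun x hx =>
    rk_lt_of_chains_le (fun C hC hc => by have := hch C hC hc; omega) hx
  obtain ⟨i₀, hi₀, hmin⟩ := exists_min_excess r Q k m
  have hex : excess r Q k m = #Q - k * m := excess_eq_card hrk
  have h0 : excess r Q k i₀ ≤ 0 := by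
    have := hmin 0 (Nat.zero_le _)
    rwa [excess_zero] at this
  have hcard' : (k : ℤ) * m + (j + (2 * Λ) * (Λ + j : ℕ)) < #Q := by exact_mod_cast hcard
  have hkk : ((2 * Λ : ℕ) * (Λ + j : ℕ) : ℤ) + j * (Λ + j : ℕ) < k := by
    have : (2 * Λ) * (Λ + j) + j * (Λ + j) < k := by rw [← add_mul]; exact hk
    exact_mod_cast this
  have hpos : (0 : ℤ) ≤ j * (Λ + j : ℕ) := by positivity
  -- a level from which on most elements have a huge number of chains below them
  have hmain : ∀ l, i₀ ≤ l → (∃ l' ≤ l, i₀ ≤ l' ∧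
      Spread r Q k l' (2 ^ (2 * Λ)) (excess r Q k i₀ + (2 * Λ : ℕ) * (Λ + j : ℕ))) ∨
      ∃ y < 2 * Λ, Spread r Q k l (2 ^ y) (excess r Q k i₀ + y * (Λ + j : ℕ)) := by
    intro l hl
    induction l, hl using Nat.le_induction with
    | base =>
      refine Or.inr ⟨0, by omega, ?_⟩
      simpa using spread_one (r := r) (P := Q) (k := k) (l := i₀)
    | succ l hl ih =>
      rcases ih with ⟨l', h1, h2⟩ | ⟨y, hy, h1⟩
      · exact Or.inl ⟨l', by omega, h2⟩
      · rcases h.step h1 with h2 | h2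
        · exact Or.inr ⟨y, hy, h2⟩
        · rw [← pow_succ', show excess r Q k i₀ + y * (Λ + j : ℕ) + (Λ + j : ℕ) =
            excess r Q k i₀ + (y + 1 : ℕ) * (Λ + j : ℕ) by push_cast; ring] at h2
          by_cases hy' : y + 1 = 2 * Λ
          · rw [hy'] at h2
            exact Or.inl ⟨l + 1, le_rfl, by omega, h2⟩
          · exact Or.inr ⟨y + 1, by omega, h2⟩
  have him : i₀ < m := by
    rcases hi₀.lt_or_eq with h1 | h1
    · exact h1
    · rw [h1] at h0
      have : (0 : ℤ) ≤ (2 * Λ) * (Λ + j : ℕ) := by positivity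
      omega
  obtain ⟨l₁, hl₁, hil, hS⟩ : ∃ l' ≤ m - 1, i₀ ≤ l' ∧
      Spread r Q k l' (2 ^ (2 * Λ)) (excess r Q k i₀ + (2 * Λ : ℕ) * (Λ + j : ℕ)) := by
    rcases hmain (m - 1) (by omega) with h1 | ⟨y, hy, h1⟩
    · exact h1
    · exfalso
      unfold Spread at h1
      rw [show m - 1 + 1 = m by omega] at h1
      have h2 := card_le_card (rich_subset_level (r := r) (P := Q) (l := m - 1) (θ := 2 ^ y))
      have h3 := card_level_le h.anti_le (m - 1)
      have h4 : (y : ℤ) * (Λ + j : ℕ) ≤ (2 * Λ : ℕ) * (Λ + j : ℕ) :=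
        mul_le_mul_of_nonneg_right (by omega) (by positivity)
      push_cast at *
      linarith
  -- an element of rank at least `k` is the top of a `(k + 1)`-chain, in contradiction to
  -- `maxBelow_lt`
  have hl₁k : l₁ < k := by
    by_contra! hge
    have h1 : 0 < #(rich r Q l₁ (2 ^ (2 * Λ))) := by
      unfold Spread at hS
      have := hmin (l₁ + 1) (by omega)
      omega
    obtain ⟨x, hx⟩ := card_pos.1 h1
    obtain ⟨h2, h3, h4⟩ := mem_rich.1 hx
    obtain ⟨C, h5, h6, h7⟩ := exists_rk_chain r Q x
    obtain ⟨D, hD, hxD⟩ := exists_chain_mem (m := k) (x := x) (C := insert x C)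
      (insert_subset h2 (h5.trans below_subset))
      (isChain_insert_above h6 fun y hy => (mem_below.1 (h5 hy)).2) (mem_insert_self _ _) (by
        rw [card_insert_of_notMem fun h' => irrefl (r := r) x (mem_below.1 (h5 h')).2]
        omega)
    have := maxBelow_lt h.chains_lt hD hxD (by have := h.j_le; omega)
    omega
  have hS' : ∀ d, Spread r Q k (l₁ + d) (2 ^ (2 * Λ))
      (excess r Q k i₀ + (2 * Λ : ℕ) * (Λ + j : ℕ) + d * (Λ + j : ℕ)) := by
    intro d
    induction d with
    | zero => simpa using hS
    | succ d ih =>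
      have e : (excess r Q k i₀ + (2 * Λ : ℕ) * (Λ + j : ℕ) + d * (Λ + j : ℕ)) + (Λ + j : ℕ) =
        (excess r Q k i₀ + (2 * Λ : ℕ) * (Λ + j : ℕ) + (d + 1 : ℕ) * (Λ + j : ℕ)) := by
        push_cast; ring
      rw [← e]
      rcases h.step ih with h1 | h1
      · exact h1.weaken le_rfl (by omega)
      · exact h1.weaken (by omega) le_rfl
  -- collect the exceptional elements of the `j - 1` levels from `l₁` on
  refine ⟨(range (j - 1)).biUnion fun d => level r Q (l₁ + d) \ rich r Q (l₁ + d) (2 ^ (2 * Λ)),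
    ?_, fun C hC => ?_⟩
  · refine card_biUnion_le.trans ((sum_le_card_nsmul _ _ ((2 * Λ + j) * (Λ + j))
      fun d hd => ?_).trans ?_)
    · rw [mem_range] at hd
      have h1 := (hS' d).card_level_sdiff
      have h2 := hmin (l₁ + d) (by omega)
      have h3 : (d : ℤ) * (Λ + j : ℕ) ≤ j * (Λ + j : ℕ) :=
        mul_le_mul_of_nonneg_right (by omega) (by positivity)
      have h4 : ((2 * Λ : ℕ) * (Λ + j : ℕ) + j * (Λ + j : ℕ) : ℤ) =
        ((2 * Λ + j) * (Λ + j) : ℕ) := by push_cast; ring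
      omega
    · rw [card_range, smul_eq_mul]
      exact Nat.mul_le_mul_right _ (by omega)
  · obtain ⟨h1, h2, h3⟩ := mem_chains.1 hC
    have h4 : ∃ x ∈ C, l₁ ≤ rk r Q x ∧ rk r Q x < l₁ + (j - 1) := by
      by_contra! hcon
      have h5 : C.image (rk r Q) ⊆ range m \ Ico l₁ (l₁ + (j - 1)) := by
        intro i hi
        obtain ⟨x, hx, rfl⟩ := mem_image.1 hi
        rw [mem_sdiff, mem_range, mem_Ico]
        exact ⟨hrk x (h1 hx), fun h6 => by have := hcon x hx h6.1; omega⟩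
      have h6 := card_le_card h5
      rw [card_image_of_injOn (rk_injOn_chain h1 h3), card_sdiff_of_subset, card_range,
        Nat.card_Ico] at h6
      · omega
      · intro i hi
        rw [mem_Ico] at hi
        rw [mem_range]
        omega
    obtain ⟨x, hx, h5, h6⟩ := h4
    refine ⟨x, hx, mem_biUnion.2 ⟨rk r Q x - l₁, by simp; omega, ?_⟩⟩
    rw [show l₁ + (rk r Q x - l₁) = rk r Q x by omega]
    refine mem_sdiff.2 ⟨mem_level.2 ⟨h1 hx, rfl⟩, fun h7 => ?_⟩
    have := maxBelow_lt h.chains_lt hC hx (by have := h.j_le; omega)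
    have := (mem_rich.1 h7).2.2
    omega

/-- If the order is not robust, then clearly fewer than `k` elements meet all `(k + j)`-chains,
and the rest is a set to which `Bounded.exists_small_hit` applies. -/
theorem Bounded.exists_hit_of_not_robust (h : Bounded r P k j Λ) (hj : 2 ≤ j) (hΛ : 1 ≤ Λ)
    (hn : k * (k + j) ≤ #P) (hk : (2 * Λ + j) * (Λ + j) < k)
    (hE : 2 * ((2 * Λ + j) * (Λ + j)) ≤ E) (hR : ¬Robust r P k j E) :
    ∃ Y : Finset α, #Y + E ≤ k + j * ((2 * Λ + j) * (Λ + j)) ∧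
      ∀ C ∈ chains r P (k + 1), ∃ x ∈ C, x ∈ Y := by
  unfold Robust at hR
  push Not at hR
  obtain ⟨Y, hY, hYc⟩ := hR
  have h1 := le_card_sdiff Y P
  have hmul : k * (k + j) = k * (k + j - 1) + k := by
    obtain ⟨i, hi⟩ : ∃ i, k + j = i + 1 := ⟨k + j - 1, by omega⟩
    rw [hi, Nat.add_sub_cancel]
    ring
  have hjL : j ≤ (2 * Λ + j) * (Λ + j) :=
    (Nat.le_add_left j (2 * Λ)).trans (Nat.le_mul_of_pos_right _ (by omega))
  have hjL2 : (2 * Λ) * (Λ + j) ≤ (2 * Λ + j) * (Λ + j) := Nat.mul_le_mul_right _ (by omega)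
  obtain ⟨Y', h2, h3⟩ := (h.subset (sdiff_subset (t := Y))).exists_small_hit hj hΛ
    (fun C hC hc => by
      have h4 := h.chain_le C (hC.trans sdiff_subset) hc
      rcases h4.lt_or_eq with h5 | h5
      · omega
      · exfalso
        obtain ⟨x, hx, hxY⟩ := hY C (mem_chains.2 ⟨hC.trans sdiff_subset, h5, hc⟩)
        exact (mem_sdiff.1 (hC hx)).2 hxY) hk (by omega)
  refine ⟨Y ∪ Y', ?_, fun C hC => ?_⟩
  · have := card_union_le Y Y'
    omega
  · by_cases hCY : ∃ x ∈ C, x ∈ Y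
    · obtain ⟨x, hx, hx'⟩ := hCY
      exact ⟨x, hx, mem_union_left _ hx'⟩
    · push Not at hCY
      obtain ⟨h4, h5⟩ := mem_chains.1 hC
      obtain ⟨x, hx, hx'⟩ := h3 C (mem_chains.2
        ⟨fun x hx => mem_sdiff.2 ⟨h4 hx, hCY x hx⟩, h5⟩)
      exact ⟨x, hx, mem_union_right _ hx'⟩

/-- One of two conjugate orders is robust, since otherwise at most `k * j` elements would meet
all monotone sets with `k + 1` elements, and more than `k * k` elements would be left. -/
theorem Bounded.robust_or [IsStrictOrder α s] (h : Bounded r P k j Λ) (hc : Conj r s) (hj : 2 ≤ j)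
    (hΛ : 1 ≤ Λ) (hn : k * (k + j) < #P) (hk : 6 * ((2 * Λ + j) * (Λ + j)) < k)
    (hE : 2 * ((2 * Λ + j) * (Λ + j)) ≤ E) : Robust r P k j E ∨ Robust s P k j E := by
  by_contra! hcon
  obtain ⟨Y, h1, h2⟩ := h.exists_hit_of_not_robust hj hΛ hn.le (by omega) hE hcon.1
  obtain ⟨Y', h3, h4⟩ := (h.conj hc).exists_hit_of_not_robust hj hΛ hn.le (by omega) hE hcon.2
  have h5 := card_le_of_hits (r := r) (P := P) (k := k) (Y := Y ∪ Y')
    (fun C hC => by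
      obtain ⟨x, hx, hx'⟩ := h2 C hC
      exact ⟨x, hx, mem_union_left _ hx'⟩)
    (fun C hC => by
      rw [← hc.chains_eq] at hC
      obtain ⟨x, hx, hx'⟩ := h4 C hC
      exact ⟨x, hx, mem_union_right _ hx'⟩)
  have h6 := card_union_le Y Y'
  set ρ := (2 * Λ + j) * (Λ + j)
  obtain ⟨i, rfl⟩ : ∃ i, j = i + 2 := ⟨j - 2, by omega⟩
  nlinarith

end

/-! ### Binomial estimates -/

theorem extremal_mono {k m n : ℕ} (h : m ≤ n) : extremal k m ≤ extremal k n :=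
  sum_le_sum_of_subset (range_subset_range.2 h)

/-- `C(n - u, m - u)` decreases slowly in `u`. -/
theorem choose_sub_sub {k j u : ℕ} (hj : 1 ≤ j) (hu : 2 * u ≤ k) :
    k * (k + j - 1).choose k ≤
      k * (k + j - 1 - u).choose (k - u) + 2 * u * j * (k + j - 1).choose k ∧
    (k + j - 1 - u).choose (k - u) ≤ (k + j - 1).choose k := by
  induction u with
  | zero => simp
  | succ u ih =>
    obtain ⟨h1, h2⟩ := ih (by omega)
    obtain ⟨m, hm⟩ : ∃ m, k - u = m + 1 := ⟨k - u - 1, by omega⟩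
    obtain ⟨n, hn⟩ : ∃ n, k + j - 1 - u = n + 1 := ⟨k + j - 1 - u - 1, by omega⟩
    rw [show k - (u + 1) = m by omega, show k + j - 1 - (u + 1) = n by omega]
    rw [hm, hn] at h1 h2
    have h3 := Nat.choose_succ_succ n m
    rw [Nat.succ_eq_add_one, Nat.succ_eq_add_one] at h3
    have h4 := Nat.choose_mul_succ_eq n (m + 1)
    rw [show n + 1 - (m + 1) = j - 1 by omega] at h4
    set w := (k + j - 1).choose k
    refine ⟨?_, by omega⟩
    have h5 : k * n.choose (m + 1) ≤ 2 * (j * w) := by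
      calc k * n.choose (m + 1) ≤ (2 * (n + 1)) * n.choose (m + 1) :=
            Nat.mul_le_mul_right _ (by omega)
        _ = 2 * (n.choose (m + 1) * (n + 1)) := by ring
        _ = 2 * ((n + 1).choose (m + 1) * (j - 1)) := by rw [h4]
        _ ≤ 2 * (w * j) := Nat.mul_le_mul_left _ (Nat.mul_le_mul h2 (by omega))
        _ = _ := by ring
    rw [h3] at h1
    nlinarith

theorem mul_sum_choose_ge {k j θ : ℕ} (hj : 1 ≤ j) (hθ : 2 * θ ≤ k + 2) :
    k * θ * (k + j - 1).choose k ≤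
      k * ∑ u ∈ range θ, (k + j - 1 - u).choose (k - u) + j * θ ^ 2 * (k + j - 1).choose k := by
  induction θ with
  | zero => simp
  | succ θ ih =>
    have h1 := ih (by omega)
    have h2 := (choose_sub_sub (k := k) (u := θ) hj (by omega)).1
    rw [sum_range_succ]
    set w := (k + j - 1).choose k
    have : 0 ≤ j * w := Nat.zero_le _
    nlinarith

theorem mul_choose_add {k j : ℕ} (hj : 1 ≤ j) :
    j * (k + j).choose k = (k + j) * (k + j - 1).choose k := by
  have := Nat.choose_mul_succ_eq (k + j - 1) k
  rw [show k + j - 1 + 1 = k + j by omega, show k + j - k = j by omega] at this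
  linarith

theorem mul_choose_sub_two {k j : ℕ} (hj : 2 ≤ j) :
    k * (k + j - 2).choose k ≤ j * (k + j - 1).choose k := by
  have := Nat.choose_mul_succ_eq (k + j - 2) k
  rw [show k + j - 2 + 1 = k + j - 1 by omega] at this
  calc _ ≤ (k + j - 2).choose k * (k + j - 1) := by
        rw [mul_comm]; exact Nat.mul_le_mul_left _ (by omega)
    _ = _ := this
    _ ≤ (k + j - 1).choose k * j := Nat.mul_le_mul_left _ (by omega)
    _ = _ := mul_comm _ _

section

variable {α : Type*} {r s : α → α → Prop} {P Q A U V Z W Y S D : Finset α} {x y z : α}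
  {m k i j p q l t θ Λ E L : ℕ} {X : ℤ}

/-! ### Chains through a given element -/

/-- Chains of equal size `n` that avoid `x` and can be extended by `x` supply many `(k +
1)`-chains through `x`. -/
theorem sum_choose_le_chains_through (𝒜 : Finset (Finset α)) (n : ℕ) (hx : x ∈ P)
    (h : ∀ A ∈ 𝒜, A ⊆ P ∧ #A = n ∧ x ∉ A ∧ IsChain r ((insert x A : Finset α) : Set α))
    (hk : θ ≤ k) (hθ : θ ≤ #𝒜) :
    ∑ u ∈ range θ, (n - u).choose (k - u) ≤ #{D ∈ chains r P (k + 1) | x ∈ D} := by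
  obtain ⟨ℬ, hℬ, rfl⟩ := exists_subset_card_eq hθ
  refine (sum_choose_le_card_subsets ℬ (fun A hA => (h A (hℬ hA)).2.1) hk).trans ?_
  have hmem : ∀ B ∈ ℬ.biUnion fun A => A.powersetCard k, ∃ A ∈ 𝒜, B ⊆ A ∧ #B = k := by
    intro B hB
    obtain ⟨A, hA, hB⟩ := mem_biUnion.1 hB
    exact ⟨A, hℬ hA, mem_powersetCard.1 hB⟩
  apply card_le_card_of_injOn (insert x)
  · intro B hB
    obtain ⟨A, hA, h1, h2⟩ := hmem B hB
    obtain ⟨h3, h4, h5, h6⟩ := h A hA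
    have hsub := insert_subset_insert x h1
    refine mem_coe.2 (mem_filter.2 ⟨mem_chains.2 ⟨insert_subset hx (h1.trans h3), ?_,
      h6.mono (by exact_mod_cast hsub)⟩, mem_insert_self _ _⟩)
    rw [card_insert_of_notMem fun h' => h5 (h1 h'), h2]
  · intro B hB B' hB' he
    obtain ⟨A, hA, h1, h2⟩ := hmem B hB
    obtain ⟨A', hA', h1', h2'⟩ := hmem B' hB'
    rw [← erase_insert (fun h' => (h A hA).2.2.1 (h1 h') : x ∉ B), he,
      erase_insert (fun h' => (h A' hA').2.2.1 (h1' h') : x ∉ B')]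

/-- Deleting an antichain `D` destroys all chains through its elements, and none of them is
counted twice. -/
theorem mono_sdiff_add_le (hDa : IsAntichain r (D : Set α)) :
    mono r (P \ D) m + ∑ x ∈ D, #{C ∈ chains r P m | x ∈ C} ≤ mono r P m := by
  have h1 : ∑ x ∈ D, #{C ∈ chains r P m | x ∈ C} =
      #(D.biUnion fun x => {C ∈ chains r P m | x ∈ C}) := by
    rw [card_biUnion]
    intro x hx y hy hxy
    rw [Function.onFun, disjoint_left]
    intro C hC hC'
    obtain ⟨h2, h3⟩ := mem_filter.1 hC
    rcases (mem_chains.1 h2).2.2 h3 (mem_filter.1 hC').2 hxy with h | h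
    · exact hDa hx hy hxy h
    · exact hDa hy hx hxy.symm h
  have h2 : Disjoint (chains r (P \ D) m) (D.biUnion fun x => {C ∈ chains r P m | x ∈ C}) := by
    rw [disjoint_left]
    intro C hC hC'
    obtain ⟨x, hx, h3⟩ := mem_biUnion.1 hC'
    exact (mem_sdiff.1 ((mem_chains.1 hC).1 (mem_filter.1 h3).2)).2 hx
  have h3 : chains r (P \ D) m ∪ (D.biUnion fun x => {C ∈ chains r P m | x ∈ C}) ⊆
      chains r P m := by
    refine union_subset (chains_mono sdiff_subset) fun C hC => ?_
    obtain ⟨x, hx, h3⟩ := mem_biUnion.1 hC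
    exact (mem_filter.1 h3).1
  have h4 := card_le_card h3
  rw [card_union_of_disjoint h2, ← h1] at h4
  have h5 := card_le_card (antis_mono (r := r) (m := m) (sdiff_subset (s := P) (t := D)))
  unfold mono
  omega

/-! ### A hypothetical set of least size with few monotone sets -/

/-- The sizes for which the estimates work; `L` is of the order of `log k`. -/
structure Sizes (k j L : ℕ) : Prop where
  two_le_j : 2 ≤ j
  two_le_L : 2 ≤ L
  lt_pow : k < 2 ^ L
  sq_le : 1000000 * (j * L) ^ 2 ≤ k
  pow_le : 100000 * (j * L ^ 5) ≤ k

/-- The consequences of `Sizes` in terms of `j`, `j * L` and `(j * L) ^ 2` that are needed for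
linear arithmetic. -/
theorem Sizes.facts (h : Sizes k j L) :
    j ≤ j * L ∧ j * L + j ≤ 2 * (j * L) ∧ 4 ≤ j * L ∧ 1000000 * (j * L) ≤ k ∧
    1000000 * (j * j) ≤ k ∧ 2 * (j * L) * (j * L + j) ≤ 4 * (j * L) ^ 2 ∧
    2 * ((2 * (j * L) + j) * (j * L + j)) ≤ 12 * (j * L) ^ 2 ∧ 1 ≤ (j * L) ^ 2 := by
  have h1 := h.two_le_j
  have h2 := h.two_le_L
  have h3 := h.sq_le
  have h5 : j * 2 ≤ j * L := Nat.mul_le_mul_left _ h2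
  have h4 : j * L ≤ (j * L) ^ 2 := by rw [sq]; exact Nat.le_mul_of_pos_left _ (by omega)
  have h7 : j * j ≤ (j * L) ^ 2 := by rw [sq]; exact Nat.mul_le_mul (by omega) (by omega)
  refine ⟨by omega, by omega, by omega, by omega, by omega, ?_, ?_, by omega⟩
  · calc 2 * (j * L) * (j * L + j) ≤ 2 * (j * L) * (2 * (j * L)) :=
        Nat.mul_le_mul_left _ (by omega)
      _ = _ := by ring
  · calc 2 * ((2 * (j * L) + j) * (j * L + j)) ≤ 2 * ((3 * (j * L)) * (2 * (j * L))) :=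
        Nat.mul_le_mul_left _ (Nat.mul_le_mul (by omega) (by omega))
      _ = _ := by ring

/-- The bound for `Robust` that is available for one of two conjugate orders. -/
def robustness (j L : ℕ) : ℕ := 2 * ((2 * (j * L) + j) * (j * L + j))

/-- The situation of a hypothetical set of least size, with `k * (k + j) + t` elements, that has
no more monotone sets than the extremal number, in the one of two conjugate orders that is
robust. The parameter `Λ` of `Bounded` is `j * L`. -/
structure Tight (r : α → α → Prop) (P : Finset α) (k j L t : ℕ) : Prop
    extends Bounded r P k j (j * L) where
  sizes : Sizes k j L
  one_le : 1 ≤ t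
  t_le : t ≤ k
  card_eq : #P = k * (k + j) + t
  extremal_le : ∀ Q ⊆ P, #Q < #P → extremal k #Q ≤ mono r Q (k + 1)
  robust : Robust r P k j (robustness j L)
  mono_le : mono r P (k + 1) ≤ extremal k #P

/-- If the elements of an antichain `D` lie in too many `(k + 1)`-chains, then after deleting
`D` fewer monotone sets remain than the extremal number for the remaining size. With `w = C(k +
j - 1, k)`, deleting up to `k + j` elements lowers the extremal number by little more than `k *
w + t * C(k + j, k)`, and `j * C(k + j, k) = (k + j) * w`. -/
theorem Tight.false_of_cut (h : Tight r P k j L t) (hD : D ⊆ P) (hDa : IsAntichain r (D : Set α))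
    (hD0 : D.Nonempty) {M : ℕ} (hM : M ≤ ∑ x ∈ D, #{C ∈ chains r P (k + 1) | x ∈ C})
    (hlt : (k + j - 1).choose k * (j * k + t * (k + j) + j) < j * M) :
    False := by
  refine lt_irrefl _ (h.mono_le.trans_lt (?_ : extremal k #P < mono r P (k + 1)))
  obtain ⟨f1, f2, f3, f4, f5, -⟩ := h.sizes.facts
  have hj := h.sizes.two_le_j
  have h1 := mono_sdiff_add_le (P := P) (m := k + 1) hDa
  have h2 := card_sdiff_add_card_eq_card hD
  have h3 := h.extremal_le (P \ D) sdiff_subset (by have := card_pos.2 hD0; omega)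
  have h4 : k * (k + j - 2) + (k - j) ≤ #(P \ D) := by
    have := h.anti_le D hD hDa
    have h5 := h.card_eq
    have h6 : k * (k + j) = k * (k + j - 2) + 2 * k := by
      obtain ⟨i, hi⟩ : ∃ i, k + j = i + 2 := ⟨k + j - 2, by omega⟩
      rw [hi, Nat.add_sub_cancel]
      ring
    omega
  have h5 := extremal_mono (k := k) h4
  rw [extremal_eq _ (k + j - 2) (k - j) (by omega) rfl] at h5
  rw [extremal_eq' h.t_le h.one_le h.card_eq]
  have h6 : (k + j).choose (k + 1) = (k + j - 1).choose k + (k + j - 1).choose (k + 1) := by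
    have := Nat.choose_succ_succ (k + j - 1) k
    rwa [show (k + j - 1).succ = k + j by omega] at this
  have h7 : (k + j - 1).choose (k + 1) =
      (k + j - 2).choose k + (k + j - 2).choose (k + 1) := by
    have := Nat.choose_succ_succ (k + j - 2) k
    rwa [show (k + j - 2).succ = k + j - 1 by omega] at this
  have h8 := mul_choose_add (k := k) (j := j) (by omega)
  have h9 := mul_choose_sub_two (k := k) hj
  have h10 : j * (k + j - 2).choose k ≤ (k + j - 1).choose k := by
    have h11 : k * (j * (k + j - 2).choose k) ≤ k * (k + j - 1).choose k := by
      calc _ = j * (k * (k + j - 2).choose k) := by ring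
        _ ≤ j * (j * (k + j - 1).choose k) := Nat.mul_le_mul_left _ h9
        _ = (j * j) * (k + j - 1).choose k := by ring
        _ ≤ _ := Nat.mul_le_mul_right _ (by omega)
    exact Nat.le_of_mul_le_mul_left h11 (by omega)
  rw [h6, h7]
  obtain ⟨d, hd⟩ : ∃ d, k = j + d := Nat.exists_eq_add_of_le (by omega)
  have h12 : (k - j) * (k + j - 2).choose k + j * (k + j - 2).choose k =
      k * (k + j - 2).choose k := by
    rw [← add_mul, Nat.sub_add_cancel (by omega)]
  generalize (k + j - 2).choose (k + 1) = a at *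
  generalize (k + j - 2).choose k = b at *
  generalize (k + j - 1).choose k = w at *
  generalize (k + j).choose k = v at *
  generalize (k - j) * b = kb at *
  have hN : k * a + kb + M ≤ mono r P (k + 1) := by omega
  have h13 : j * (k * (w + (b + a)) + t * v) < j * (k * a + kb + M) := by
    have e1 : j * (k * (w + (b + a)) + t * v) =
      j * k * w + j * (k * b) + j * (k * a) + t * (j * v) := by ring
    have e2 : j * (k * a + kb + M) = j * (k * a) + j * kb + j * M := by ring
    have e3 : j * (k * b) = j * kb + j * (j * b) := by rw [← h12]; ring
    have e4 : w * (j * k + t * (k + j) + j) = j * k * w + t * ((k + j) * w) + j * w := by ring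
    have e5 : j * (j * b) ≤ j * w := Nat.mul_le_mul_left _ h10
    rw [e1, e2, e3, h8]
    rw [e4] at hlt
    linarith
  exact (Nat.lt_of_mul_lt_mul_left h13).trans_le hN

/-- All but `X₁` elements of `D` lie in the chains supplied by `θ` chains of the largest size, and
all but `X₂` in those supplied by one more. -/
theorem Tight.false_of_two (h : Tight r P k j L t) (hD : D ⊆ P)
    (hDa : IsAntichain r (D : Set α)) {S₁ S₂ : Finset α} (hS₁ : S₁ ⊆ D) (hS₂ : S₂ ⊆ D)
    (h1 : ∀ x ∈ S₁, ∑ u ∈ range θ, (k + j - 1 - u).choose (k - u) ≤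
      #{C ∈ chains r P (k + 1) | x ∈ C})
    (h2 : ∀ x ∈ S₂, ∑ u ∈ range (θ + 1), (k + j - 1 - u).choose (k - u) ≤
      #{C ∈ chains r P (k + 1) | x ∈ C})
    {X₁ X₂ : ℕ} (hX₁ : k ≤ #S₁ + X₁) (hX₂ : k ≤ #S₂ + X₂) (ht : t + j ≤ j * θ)
    (hk : X₁ * θ + j * θ ^ 2 + X₂ + 2 * θ * j + t + 1 < k) :
    False := by
  obtain ⟨f1, f2, f3, f4, f5, -⟩ := h.sizes.facts
  have hj := h.sizes.two_le_j
  have hθ : 2 * θ ≤ 2 * θ * j := Nat.le_mul_of_pos_right _ (by omega)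
  have hS0 : D.Nonempty := by
    have : 0 < #S₂ := by omega
    exact (card_pos.1 this).mono hS₂
  refine h.false_of_cut hD hDa hS0 (M := #S₁ * ∑ u ∈ range θ, (k + j - 1 - u).choose (k - u) +
    #S₂ * (k + j - 1 - θ).choose (k - θ)) ?_ ?_
  · rw [card_eq_sum_ones S₁, card_eq_sum_ones S₂, sum_mul, sum_mul]
    have e : ∀ S ⊆ D, ∀ c : ℕ, ∑ x ∈ S, 1 * c = ∑ x ∈ D, if x ∈ S then c else 0 := by
      intro S hS c
      rw [sum_ite_mem, inter_eq_right.2 hS]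
      simp
    rw [e S₁ hS₁, e S₂ hS₂, ← sum_add_distrib]
    refine sum_le_sum fun x _ => ?_
    by_cases hx2 : x ∈ S₂
    · have := h2 x hx2
      rw [sum_range_succ] at this
      rw [if_pos hx2]
      split_ifs <;> omega
    · rw [if_neg hx2, add_zero]
      split_ifs with hx1
      · exact h1 x hx1
      · exact Nat.zero_le _
  · have h3 := mul_sum_choose_ge (k := k) (j := j) (θ := θ) (by omega) (by omega)
    have h4 := (choose_sub_sub (k := k) (j := j) (u := θ) (by omega) (by omega)).1
    have hw : 0 < (k + j - 1).choose k := Nat.choose_pos (by omega)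
    generalize ∑ u ∈ range θ, (k + j - 1 - u).choose (k - u) = Sg at *
    generalize (k + j - 1 - θ).choose (k - θ) = c at *
    generalize (k + j - 1).choose k = w at *
    -- work in the integers, where the sizes of `S₁` and `S₂` are `k - X₁` and `k - X₂`
    zify at *
    have hX1k : (X₁ : ℤ) ≤ k := by
      have hθ1 : (1 : ℤ) ≤ θ := by
        by_contra! hcon
        have : (θ : ℤ) = 0 := by omega
        rw [this] at ht
        omega
      nlinarith
    have a1 : ((k : ℤ) * θ - j * θ ^ 2) * w ≤ k * Sg := by linarith
    have a2 : ((k : ℤ) - 2 * θ * j) * w ≤ k * c := by linarith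
    have b1 : ((k : ℤ) - X₁) * (((k : ℤ) * θ - j * θ ^ 2) * w) ≤ #S₁ * (k * Sg) := by
      have p1 : (0 : ℤ) ≤ k * Sg := by positivity
      calc _ ≤ ((k : ℤ) - X₁) * (k * Sg) := mul_le_mul_of_nonneg_left a1 (by linarith)
        _ ≤ _ := mul_le_mul_of_nonneg_right (by linarith) p1
    have b2 : ((k : ℤ) - X₂) * (((k : ℤ) - 2 * θ * j) * w) ≤ #S₂ * (k * c) := by
      have p1 : (0 : ℤ) ≤ k * c := by positivity
      have p2 : (0 : ℤ) ≤ (k : ℤ) - X₂ := by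
        have : (0 : ℤ) ≤ X₁ * θ + j * θ ^ 2 + 2 * θ * j + t + 1 := by positivity
        linarith
      calc _ ≤ ((k : ℤ) - X₂) * (k * c) := mul_le_mul_of_nonneg_left a2 p2
        _ ≤ _ := mul_le_mul_of_nonneg_right (by linarith) p1
    have b3 : (k : ℤ) * (w * (j * k + t * (k + j) + j)) <
        j * (((k : ℤ) - X₁) * ((k * θ - j * θ ^ 2) * w) +
          ((k : ℤ) - X₂) * ((k - 2 * θ * j) * w)) := by
      have c1 : (0 : ℤ) ≤ X₁ * (j * θ ^ 2) := by positivity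
      have c2 : (0 : ℤ) ≤ X₂ * (2 * θ * j) := by positivity
      have c3 : (k : ℤ) * (j * k + t * (k + j) + j) < j * (((k : ℤ) - X₁) * (k * θ - j * θ ^ 2) +
          ((k : ℤ) - X₂) * (k - 2 * θ * j)) := by
        have hkpos : (0 : ℤ) < k := by linarith [f4, f3]
        have hjpos : (0 : ℤ) < j := by linarith
        have d1 : ((k : ℤ) - X₁) * (k * θ - j * θ ^ 2) + ((k : ℤ) - X₂) * (k - 2 * θ * j) =
          k * (k * θ + k - (X₁ * θ + j * θ ^ 2 + X₂ + 2 * θ * j)) + X₁ * (j * θ ^ 2) +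
            X₂ * (2 * θ * j) := by ring
        rw [d1]
        have d2 : (k : ℤ) * (k * θ + t + 1) <
            k * (k * θ + k - (X₁ * θ + j * θ ^ 2 + X₂ + 2 * θ * j)) :=
          mul_lt_mul_of_pos_left (by linarith) hkpos
        have d3 : (k : ℤ) * (t + j) ≤ k * (j * θ) := mul_le_mul_of_nonneg_left ht hkpos.le
        have d4 : (j : ℤ) * (k * (k * θ + t + 1)) <
            j * (k * (k * θ + k - (X₁ * θ + j * θ ^ 2 + X₂ + 2 * θ * j)) + X₁ * (j * θ ^ 2) +
            X₂ * (2 * θ * j)) := mul_lt_mul_of_pos_left (by linarith) hjpos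
        refine lt_of_le_of_lt ?_ d4
        have d5 : (k : ℤ) * (k * (t + j)) ≤ k * (k * (j * θ)) :=
          mul_le_mul_of_nonneg_left d3 hkpos.le
        linarith
      have := mul_lt_mul_of_pos_left c3 hw
      linarith
    have b4 : (k : ℤ) * (w * (j * k + t * (k + j) + j)) < k * (j * (#S₁ * Sg + #S₂ * c)) := by
      refine b3.trans_le ?_
      have : (j : ℤ) * (((k : ℤ) - X₁) * ((k * θ - j * θ ^ 2) * w) +
          ((k : ℤ) - X₂) * ((k - 2 * θ * j) * w)) ≤ j * (#S₁ * (k * Sg) + #S₂ * (k * c)) :=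
        mul_le_mul_of_nonneg_left (by linarith) (by positivity)
      linarith
    exact lt_of_mul_lt_mul_left b4 (by positivity)

end

/-! ### Cutting off an antichain near the top -/

section

variable {α : Type*} {r s : α → α → Prop} {P Q A U V Z W Y S D : Finset α} {x y z : α}
  {m k i j p q l t θ Λ E L : ℕ} {X : ℤ}

/-- All but `X` of about `k` elements lie in the chains supplied by `θ` chains of the largest
size, each of which accounts for about `w = C(k + j - 1, k)` chains through the element. -/
theorem Tight.false_of_one (h : Tight r P k j L t) (hS : S ⊆ P)
    (hSa : IsAntichain r (S : Set α))
    (h1 : ∀ x ∈ S, ∑ u ∈ range θ, (k + j - 1 - u).choose (k - u) ≤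
      #{C ∈ chains r P (k + 1) | x ∈ C})
    {X : ℕ} (hX : k ≤ #S + X) (hθ : 2 * θ ≤ k + 2)
    (hk : j * k + t * (k + j) + j + j * θ * (X + j * θ) < j * k * θ) : False := by
  obtain ⟨f1, f2, f3, f4, f5, -⟩ := h.sizes.facts
  have hj := h.sizes.two_le_j
  have hXk : X + j * θ < k := by
    have h2 : j * θ * (X + j * θ) < j * θ * k := by
      have : j * k * θ = j * θ * k := by ring
      omega
    exact Nat.lt_of_mul_lt_mul_left h2
  have hS0 : S.Nonempty := card_pos.1 (by omega)
  refine h.false_of_cut hS hSa hS0 (M := #S * ∑ u ∈ range θ, (k + j - 1 - u).choose (k - u)) ?_ ?_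
  · rw [← smul_eq_mul]
    exact card_nsmul_le_sum _ _ _ h1
  · have h3 := mul_sum_choose_ge (k := k) (j := j) (θ := θ) (by omega) hθ
    have hw : 0 < (k + j - 1).choose k := Nat.choose_pos (by omega)
    generalize ∑ u ∈ range θ, (k + j - 1 - u).choose (k - u) = Sg at *
    generalize (k + j - 1).choose k = w at *
    zify at *
    have a1 : ((k : ℤ) * θ - j * θ ^ 2) * w ≤ k * Sg := by linarith
    have a2 : (0 : ℤ) ≤ (j : ℤ) * θ := by positivity
    have b1 : ((k : ℤ) - X) * (((k : ℤ) * θ - j * θ ^ 2) * w) ≤ #S * (k * Sg) := by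
      have p1 : (0 : ℤ) ≤ k * Sg := by positivity
      calc _ ≤ ((k : ℤ) - X) * (k * Sg) := mul_le_mul_of_nonneg_left a1 (by linarith)
        _ ≤ _ := mul_le_mul_of_nonneg_right (by linarith) p1
    have hkpos : (0 : ℤ) < k := by linarith [f4, f3]
    have b2 : (k : ℤ) * (j * k + t * (k + j) + j) <
        j * (((k : ℤ) - X) * (k * θ - j * θ ^ 2)) := by
      have c1 : (0 : ℤ) ≤ j * (X * (j * θ ^ 2)) := by positivity
      have c2 := mul_lt_mul_of_pos_left hk hkpos
      linarith
    have b3 := mul_lt_mul_of_pos_left b2 hw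
    have b4 := mul_le_mul_of_nonneg_left b1 (by positivity : (0 : ℤ) ≤ j)
    refine lt_of_mul_lt_mul_left (?_ : (k : ℤ) * (w * (j * k + t * (k + j) + j)) <
      k * (j * (#S * Sg))) hkpos.le
    linarith

/-- Twice as many chains as are needed compensate for a positive proportion of exceptions. -/
theorem Tight.false_of_many (h : Tight r P k j L t) (ht : 100 * t ≤ k) (hS : S ⊆ P)
    (hSa : IsAntichain r (S : Set α))
    (h1 : ∀ x ∈ S, ∑ u ∈ range θ, (k + j - 1 - u).choose (k - u) ≤
      #{C ∈ chains r P (k + 1) | x ∈ C})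
    {X : ℕ} (hX : k ≤ #S + X) (hX' : 16 * X ≤ k) (hθ : 2 * t + 2 * j ≤ j * θ) : False := by
  obtain ⟨f1, f2, f3, f4, f5, -⟩ := h.sizes.facts
  have hj := h.sizes.two_le_j
  obtain ⟨θ', h2, h3, h4⟩ : ∃ θ' ≤ θ, 2 * t + 2 * j ≤ j * θ' ∧ j * θ' ≤ 2 * t + 3 * j := by
    refine ⟨(2 * t + j - 1) / j + 2, ?_, ?_, ?_⟩
    · obtain ⟨d, rfl⟩ : ∃ d, θ = d + 2 := by
        refine ⟨θ - 2, ?_⟩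
        have : 2 ≤ θ := by
          by_contra! hcon
          have : j * θ ≤ j * 1 := Nat.mul_le_mul_left _ (by omega)
          omega
        omega
      have : (2 * t + j - 1) / j < d + 1 := by
        rw [Nat.div_lt_iff_lt_mul (by omega)]
        have : j * (d + 2) = (d + 1) * j + j := by ring
        omega
      omega
    · have := Nat.lt_div_mul_add (a := 2 * t + j - 1) (b := j) (by omega)
      have e : j * ((2 * t + j - 1) / j + 2) = (2 * t + j - 1) / j * j + j + j := by ring
      omega
    · have := Nat.div_mul_le_self (2 * t + j - 1) j
      have e : j * ((2 * t + j - 1) / j + 2) = (2 * t + j - 1) / j * j + j + j := by ring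
      omega
  have h5 : θ' ≤ j * θ' := Nat.le_mul_of_pos_left _ (by omega)
  refine h.false_of_one (θ := θ') hS hSa (fun x hx => (sum_le_sum_of_subset
    (range_subset_range.2 h2)).trans (h1 x hx)) hX (by omega) ?_
  have e1 : j * k * θ' = j * θ' * k := by ring
  rw [e1]
  generalize j * θ' = p at *
  have e2 : 8 * (p * (X + p)) ≤ p * k := by
    calc _ = p * (8 * (X + p)) := by ring
      _ ≤ _ := Nat.mul_le_mul_left _ (by omega)
  have e3 : (2 * t + 2 * j) * k ≤ p * k := Nat.mul_le_mul_right _ h3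
  have e4 : t * j ≤ t * k := Nat.mul_le_mul_left _ h.j_le
  have e5 : j ≤ j * k := Nat.le_mul_of_pos_right _ (by omega)
  have e6 : 0 < j * k := Nat.mul_pos (by omega) (by omega)
  nlinarith

variable [IsStrictOrder α r]

/-- The surplus of all levels together is `t`. -/
theorem Tight.excess_top (h : Tight r P k j L t) : excess r P k (k + j - 1 + 1) = t := by
  have hj := h.sizes.two_le_j
  rw [show k + j - 1 + 1 = k + j by omega, excess_eq_card fun x hx => h.rk_lt hx, h.card_eq]
  push_cast
  ring

/-- An element of the last possible level lies in many `(k + 1)`-chains if it has `θ` longest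
chains below it. -/
theorem le_card_through_top (hx : x ∈ rich r P (k + j - 1) θ) (hθ : θ ≤ k) :
    ∑ u ∈ range θ, (k + j - 1 - u).choose (k - u) ≤ #{C ∈ chains r P (k + 1) | x ∈ C} := by
  obtain ⟨h1, h2, h3⟩ := mem_rich.1 hx
  rw [maxBelow, h2] at h3
  refine sum_choose_le_chains_through (chains r (below r P x) (k + j - 1)) _ h1 (fun A hA => ?_)
    hθ h3
  obtain ⟨h4, h5, h6⟩ := mem_chains.1 hA
  refine ⟨h4.trans below_subset, h5, fun h7 => ?_, isChain_insert_above h6 fun y hy =>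
    (mem_below.1 (h4 hy)).2⟩
  exact irrefl (r := r) x (mem_below.1 (h4 h7)).2

/-- For an element of the last level but one, two upper neighbours double the number of chains
of the largest size through it. -/
theorem le_card_through_pre (hkj : 2 ≤ k + j) (hx : x ∈ rich r P (k + j - 2) θ)
    (hx2 : 2 ≤ #{y ∈ level r P (k + j - 1) | r x y}) (hθ : 2 * θ ≤ k) :
    ∑ u ∈ range (2 * θ), (k + j - 1 - u).choose (k - u) ≤
      #{C ∈ chains r P (k + 1) | x ∈ C} := by
  obtain ⟨h1, h2, h3⟩ := mem_rich.1 hx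
  rw [maxBelow, h2] at h3
  obtain ⟨y, hy, y', hy', hne⟩ := one_lt_card.1 hx2
  have key : ∀ y ∈ level r P (k + j - 1), r x y → ∀ A ∈ chains r (below r P x) (k + j - 2),
      y ∉ A ∧ (insert y A ⊆ P ∧ #(insert y A) = k + j - 1 ∧ x ∉ insert y A ∧
        IsChain r ((insert x (insert y A) : Finset α) : Set α)) := by
    intro y hy hxy A hA
    obtain ⟨h4, h5, h6⟩ := mem_chains.1 hA
    have h7 : y ∉ A := fun h7 =>
      irrefl (r := r) x (_root_.trans hxy (mem_below.1 (h4 h7)).2)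
    refine ⟨h7, insert_subset (mem_level.1 hy).1 (h4.trans below_subset), ?_, ?_, ?_⟩
    · rw [card_insert_of_notMem h7, h5]
      omega
    · rw [mem_insert, not_or]
      exact ⟨fun h8 => irrefl (r := r) x (by rw [← h8] at hxy; exact hxy),
        fun h8 => irrefl (r := r) x (mem_below.1 (h4 h8)).2⟩
    · rw [insert_comm]
      have h8 := isChain_insert_above h6 fun z hz => (mem_below.1 (h4 hz)).2
      refine isChain_insert_above h8 fun z hz => ?_
      rcases mem_insert.1 hz with rfl | hz
      · exact hxy
      · exact _root_.trans (mem_below.1 (h4 hz)).2 hxy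
  rw [mem_filter] at hy hy'
  refine sum_choose_le_chains_through ((chains r (below r P x) (k + j - 2)).image (insert y) ∪
    (chains r (below r P x) (k + j - 2)).image (insert y')) _ h1 (fun B hB => ?_) hθ ?_
  · rcases mem_union.1 hB with hB | hB
    · obtain ⟨A, hA, rfl⟩ := mem_image.1 hB
      exact (key y hy.1 hy.2 A hA).2
    · obtain ⟨A, hA, rfl⟩ := mem_image.1 hB
      exact (key y' hy'.1 hy'.2 A hA).2
  · have hinj : ∀ y ∈ level r P (k + j - 1), r x y →
        #((chains r (below r P x) (k + j - 2)).image (insert y)) =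
          #(chains r (below r P x) (k + j - 2)) := by
      intro y hy hxy
      refine card_image_of_injOn fun A hA B hB he => ?_
      rw [← erase_insert (key y hy hxy A hA).1, ← erase_insert (key y hy hxy B hB).1, he]
    rw [card_union_of_disjoint, hinj y hy.1 hy.2, hinj y' hy'.1 hy'.2]
    · omega
    · rw [disjoint_left]
      intro B hB hB'
      obtain ⟨A, hA, rfl⟩ := mem_image.1 hB
      obtain ⟨A', hA', he⟩ := mem_image.1 hB'
      have h5 : y' ∈ insert y A := he ▸ mem_insert_self y' A'
      rcases mem_insert.1 h5 with h6 | h6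
      · exact hne h6.symm
      · exact irrefl (r := r) x
          (_root_.trans hy'.2 (mem_below.1 ((mem_chains.1 hA).1 h6)).2)

theorem rich_antichain : IsAntichain r (rich r P l θ : Set α) :=
  level_antichain.subset (by exact_mod_cast rich_subset_level)

omit [IsStrictOrder α r] in
theorem rich_subset : rich r P l θ ⊆ P := rich_subset_level.trans level_subset

theorem Tight.card_rich_top (h : Tight r P k j L t) {X : ℕ}
    (hS : Spread r P k (k + j - 1) θ X) : k + t ≤ #(rich r P (k + j - 1) θ) + X := by
  have := h.excess_top
  unfold Spread at hS
  omega

/-- The top level is cut off. -/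
theorem Tight.false_of_spread_one (h : Tight r P k j L t) {X : ℕ}
    (hS : Spread r P k (k + j - 1) θ X) (hθ : 2 * θ ≤ k)
    (hk : j * k + t * (k + j) + j + j * θ * (X + j * θ) < j * k * θ) : False := by
  have := h.card_rich_top hS
  exact h.false_of_one (S := rich r P (k + j - 1) θ) rich_subset rich_antichain
    (fun x hx => le_card_through_top hx (by omega)) (X := X) (by omega) (by omega) hk

/-- The top level is cut off, with twice as many chains as are needed. -/
theorem Tight.false_of_spread_many (h : Tight r P k j L t) (ht : 100 * t ≤ k) {X : ℕ}
    (hS : Spread r P k (k + j - 1) θ X) (hX' : 16 * X ≤ k) (hθ : 2 * t + 2 * j ≤ j * θ) :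
    False := by
  have hj := h.sizes.two_le_j
  -- more than `2 t + 2` longest chains are never needed
  have h1 : Spread r P k (k + j - 1) (min θ (2 * t + 2)) X := hS.weaken (min_le_left _ _) le_rfl
  have h2 := h.card_rich_top h1
  obtain ⟨f1, f2, f3, f4, f5, -⟩ := h.sizes.facts
  have h3 := min_le_right θ (2 * t + 2)
  refine h.false_of_many ht (S := rich r P (k + j - 1) (min θ (2 * t + 2))) rich_subset
    rich_antichain (fun x hx => le_card_through_top hx (by omega)) (X := X) (by omega) hX' ?_
  rcases min_choice θ (2 * t + 2) with h4 | h4 <;> rw [h4]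
  · exact hθ
  · have : t * 2 ≤ t * j := Nat.mul_le_mul_left _ hj
    have e : j * (2 * t + 2) = 2 * (t * j) + 2 * j := by ring
    omega

end

/-! ### Climbing from the bottom to the top level -/

section

variable {α : Type*} {r s : α → α → Prop} {P Q A U V Z W Y S D : Finset α} {x y z : α}
  {m k i j p q l t θ Λ E L : ℕ} {X : ℤ}

/-- The error terms that arise from at most `4 * L ^ 2` additions are small compared with `k`.
-/
theorem Sizes.bounds (h : Sizes k j L) {σ : ℕ} (hθ : θ ≤ 4 * L ^ 2) (hσ : σ ≤ 4 * L ^ 2) :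
    σ * (j * L + j) * θ ≤ 24 * (j * L ^ 5) ∧ σ * (j * L + j) ≤ 6 * (j * L ^ 5) ∧
    j * θ ^ 2 ≤ 8 * (j * L ^ 5) ∧ θ * j ≤ j * L ^ 5 ∧ j * L ^ 2 ≤ j * L ^ 5 := by
  have h1 := h.two_le_j
  have h2 := h.two_le_L
  have h3 : 2 * (j * L + j) ≤ 3 * (j * L) := by
    have : j * 2 ≤ j * L := Nat.mul_le_mul_left _ h2
    omega
  have h4 : j * L ^ 3 * 1 ≤ j * L ^ 3 * L ^ 2 :=
    Nat.mul_le_mul_left _ (Nat.one_le_pow _ _ (by omega))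
  have h5 : j * L ^ 4 * 2 ≤ j * L ^ 4 * L := Nat.mul_le_mul_left _ h2
  have h6 : j * L ^ 2 * 2 ^ 3 ≤ j * L ^ 2 * L ^ 3 :=
    Nat.mul_le_mul_left _ (Nat.pow_le_pow_left h2 3)
  have h7 : 2 * (σ * (j * L + j)) ≤ 12 * (j * L ^ 3) := by
    calc 2 * (σ * (j * L + j)) = σ * (2 * (j * L + j)) := by ring
      _ ≤ (4 * L ^ 2) * (3 * (j * L)) := Nat.mul_le_mul hσ h3
      _ = _ := by ring
  have e1 : j * L ^ 3 * L ^ 2 = j * L ^ 5 := by ring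
  have e2 : j * L ^ 4 * L = j * L ^ 5 := by ring
  have e3 : j * L ^ 2 * L ^ 3 = j * L ^ 5 := by ring
  refine ⟨?_, by omega, ?_, ?_, by omega⟩
  · calc _ ≤ (6 * (j * L ^ 3)) * (4 * L ^ 2) := Nat.mul_le_mul (by omega) hθ
      _ = _ := by ring
  · calc j * θ ^ 2 ≤ j * (4 * L ^ 2) ^ 2 :=
        Nat.mul_le_mul_left _ (Nat.pow_le_pow_left hθ 2)
      _ = 8 * (j * L ^ 4 * 2) := by ring
      _ ≤ _ := by omega
  · calc θ * j ≤ (4 * L ^ 2) * j := Nat.mul_le_mul_right _ hθ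
      _ = 4 * (j * L ^ 2) := by ring
      _ ≤ _ := by omega

theorem bigLevels_add {a b c : ℕ} (hab : a ≤ b) (hbc : b ≤ c) :
    #(bigLevels r P k a c) = #(bigLevels r P k a b) + #(bigLevels r P k b c) := by
  induction c, hbc using Nat.le_induction with
  | base => simp [bigLevels]
  | succ c hc ih => rw [card_bigLevels_succ (by omega), card_bigLevels_succ hc, ih, add_assoc]

theorem excess_eq_sum : excess r P k m = ∑ l ∈ range m, ((#(level r P l) : ℤ) - k) := by
  induction m with
  | zero => simp [excess_zero]
  | succ m ih => rw [excess_succ, sum_range_succ, ih]; ring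

variable [IsStrictOrder α r]

theorem Bounded.card_level_le (h : Bounded r P k j Λ) : #(level r P l) ≤ k + j :=
  h.anti_le _ level_subset level_antichain

theorem Bounded.excess_le (h : Bounded r P k j Λ) {a b : ℕ} (hab : a ≤ b) :
    excess r P k b ≤ excess r P k a + j * #(bigLevels r P k a b) := by
  induction b, hab using Nat.le_induction with
  | base => simp [bigLevels]
  | succ b hb ih =>
    rw [card_bigLevels_succ hb, excess_succ]
    have := h.card_level_le (l := b)
    split_ifs with hif
    · push_cast
      linarith [(by exact_mod_cast this : (#(level r P b) : ℤ) ≤ k + j)]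
    · push Not at hif
      push_cast
      linarith [(by exact_mod_cast hif : (#(level r P b) : ℤ) ≤ k)]

/-- The surplus `t` is small and the surplus of an initial segment of levels is never very
negative. Indeed, climbing from the level of least surplus to the top without additions, fewer
than `L` doublings can occur, since `2 ^ L > k` chains below most elements of the top level are
too many; the surplus is then limited by the size of the top level and the number of doublings.
-/
theorem Tight.bounds (h : Tight r P k j L t) :
    t ≤ j * L ^ 2 ∧ ∀ l < k + j, -((j * L ^ 2 : ℕ) : ℤ) ≤ excess r P k l := by
  obtain ⟨f1, f2, f3, f4, f5, f6, f7, f8⟩ := h.sizes.facts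
  have hj := h.sizes.two_le_j
  have hL := h.sizes.two_le_L
  have hk := h.sizes.sq_le
  obtain ⟨i₀, hi₀, hmin⟩ := exists_min_excess r P k (k + j - 1)
  have h0 : excess r P k i₀ ≤ 0 := by
    have := hmin 0 (Nat.zero_le _)
    rwa [excess_zero] at this
  have hcap : ((2 * (j * L) * (j * L + j) : ℕ) : ℤ) + robustness j L < k := by
    unfold robustness
    omega
  obtain ⟨σ, y, -, -, -, h1, h2, h3, h4⟩ := h.toBounded.climb (s := 0) (θ₀ := 1)
    (X₀ := excess r P k i₀) (β := -excess r P k i₀) (l₀ := i₀) (σ₀ := 0) (y₀ := 0)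
    (by omega) h.robust le_rfl (fun l hl => by rw [neg_neg]; exact hmin l (by omega))
    (by push_cast at hcap ⊢; linarith)
    ⟨le_rfl, by simp, by omega, by simpa using spread_one⟩ hi₀ (by omega)
  obtain rfl : σ = 0 := by omega
  rw [Nat.cast_zero, zero_add, add_zero, mul_one] at h4
  have hy : y * (j * L + j) ≤ 2 * (j * L) * (j * L + j) := Nat.mul_le_mul_right _ (by omega)
  have h5 := h.excess_top
  have h6 := (card_le_card (rich_subset_level (r := r) (P := P) (l := k + j - 1)
    (θ := 2 ^ y))).trans h.card_level_le
  have h7 := h4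
  unfold Spread at h7
  have hyL : y < L := by
    by_contra! hcon
    have h8 : 2 ^ L ≤ 2 ^ y := Nat.pow_le_pow_right (by omega) hcon
    have h9 := h.sizes.lt_pow
    have h10 : Spread r P k (k + j - 1) (2 ^ y) ((y * (j * L + j) : ℕ) : ℤ) :=
      h4.weaken le_rfl (by push_cast; linarith)
    have ht : t ≤ j + y * (j * L + j) := by
      rw [h5] at h7
      push_cast at h7 ⊢
      have : (#(rich r P (k + j - 1) (2 ^ y)) : ℤ) ≤ k + j := by exact_mod_cast h6
      linarith
    refine h.false_of_spread_many (by omega) h10 (by omega) ?_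
    calc 2 * t + 2 * j ≤ j * (t + 2) := by
          have : 2 * t ≤ j * t := Nat.mul_le_mul_right _ hj
          linarith
      _ ≤ _ := Nat.mul_le_mul_left _ (by omega)
  have h8 : j + y * (j * L + j) ≤ j * L ^ 2 := by
    obtain ⟨d, rfl⟩ : ∃ d, L = y + 1 + d := ⟨L - (y + 1), by omega⟩
    nlinarith [Nat.zero_le (j * d * y), Nat.zero_le (j * d), Nat.zero_le (j * y),
      Nat.zero_le (j * d * d)]
  have h9 : (t : ℤ) - excess r P k i₀ ≤ (j * L ^ 2 : ℕ) := by
    rw [h5] at h7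
    have : (#(rich r P (k + j - 1) (2 ^ y)) : ℤ) ≤ k + j := by exact_mod_cast h6
    have : ((j + y * (j * L + j) : ℕ) : ℤ) ≤ (j * L ^ 2 : ℕ) := by exact_mod_cast h8
    push_cast at this h7 ⊢
    linarith
  refine ⟨by omega, fun l hl => ?_⟩
  have := hmin l (by omega)
  omega

/-- `Bounded.climb` with the error terms estimated. -/
theorem Tight.climb (h : Tight r P k j L t) {s θ₀ X₀ : ℕ} (hs : s ≤ 4 * L ^ 2) (hθ₀ : 1 ≤ θ₀)
    (hX₀ : 1000 * X₀ ≤ 999 * k) {l₀ σ₀ y₀ : ℕ} (h₀ : Reach r P k j (j * L) s θ₀ X₀ l₀ σ₀ y₀)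
    {l₁ : ℕ} (hl : l₀ ≤ l₁) (hl₁ : l₁ < k + j) :
    ∃ σ y, σ₀ ≤ σ ∧ y₀ ≤ y ∧ min s (σ₀ + #(bigLevels r P k l₀ l₁)) ≤ σ ∧
      Reach r P k j (j * L) s θ₀ X₀ l₁ σ y := by
  obtain ⟨f1, f2, f3, f4, f5, f6, f7, f8⟩ := h.sizes.facts
  obtain ⟨-, g2, g3, g4, g5⟩ := h.sizes.bounds hs hs
  have hk := h.sizes.sq_le
  have hk' := h.sizes.pow_le
  refine h.toBounded.climb (by have := h.sizes.two_le_j; omega) h.robust hθ₀ h.bounds.2 ?_ h₀ hl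
    hl₁
  have : X₀ + (s * (j * L + j) + 2 * (j * L) * (j * L + j)) + j * L ^ 2 + robustness j L < k := by
    unfold robustness
    omega
  rw [← add_mul] at this
  exact_mod_cast this

omit [IsStrictOrder α r] in
/-- The start of a climb at the bottom level. -/
theorem Tight.reach_zero (h : Tight r P k j L t) (s : ℕ) :
    Reach r P k j (j * L) s 1 (0 : ℕ) 0 0 0 := by
  obtain ⟨f1, f2, f3, -⟩ := h.sizes.facts
  refine ⟨Nat.zero_le _, by simp, by omega, ?_⟩
  have := spread_one (r := r) (P := P) (k := k) (l := 0)
  rw [excess_zero] at this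
  simpa using this

/-- If a doubling occurred after all `s` additions, then twice as many chains are available as
are needed. -/
theorem Tight.false_of_pos (h : Tight r P k j L t) {s θ₀ X₀ y : ℕ} (hs : s ≤ 4 * L ^ 2)
    (hX₀ : 32 * X₀ ≤ k) (hR : Reach r P k j (j * L) s θ₀ X₀ (k + j - 1) s y) (hy : 1 ≤ y)
    (ht : t + j ≤ j * (θ₀ + s)) : False := by
  obtain ⟨f1, f2, f3, f4, f5, f6, f7, f8⟩ := h.sizes.facts
  obtain ⟨-, g2, g3, g4, g5⟩ := h.sizes.bounds hs hs
  have hk := h.sizes.sq_le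
  have hk' := h.sizes.pow_le
  have htb := h.bounds.1
  obtain ⟨-, -, h1, h2⟩ := hR
  have h3 : y * (j * L + j) ≤ 2 * (j * L) * (j * L + j) := Nat.mul_le_mul_right _ (by omega)
  refine h.false_of_spread_many (θ := 2 ^ y * (θ₀ + s))
    (X := X₀ + (s * (j * L + j) + y * (j * L + j))) (by omega) ?_ (by omega) ?_
  · rw [← add_mul]
    exact_mod_cast h2
  · have h4 : 2 ^ 1 ≤ 2 ^ y := Nat.pow_le_pow_right (by omega) hy
    calc 2 * t + 2 * j = 2 * (t + j) := by ring
      _ ≤ 2 ^ y * (j * (θ₀ + s)) := Nat.mul_le_mul h4 ht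
      _ = _ := by ring

/-- A climb from the bottom to the top with one addition more than is needed in the ratio `t /
j`. -/
theorem Tight.false_of_reach (h : Tight r P k j L t) {s y : ℕ} (hs : s + 1 ≤ 4 * L ^ 2)
    (hR : Reach r P k j (j * L) s 1 (0 : ℕ) (k + j - 1) s y) (ht : t + j ≤ j * s + 1) :
    False := by
  obtain ⟨f1, f2, f3, f4, f5, f6, f7, f8⟩ := h.sizes.facts
  obtain ⟨g1, g2, g3, g4, g5⟩ := h.sizes.bounds (θ := 1 + s) (σ := s) (by omega) (by omega)
  have hk := h.sizes.sq_le
  have hk' := h.sizes.pow_le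
  have hj := h.sizes.two_le_j
  have htb := h.bounds.1
  rcases Nat.eq_zero_or_pos y with rfl | hy
  · obtain ⟨-, -, h1, h2⟩ := hR
    refine h.false_of_spread_one (θ := 1 + s) (X := s * (j * L + j)) ?_ ?_ ?_
    · simpa using h2
    · have : (1 + s) * 1 ≤ (1 + s) * j := Nat.mul_le_mul_left _ (by omega)
      omega
    · have e1 : j * (1 + s) * (s * (j * L + j) + j * (1 + s)) =
          j * (s * (j * L + j) * (1 + s) + j * (1 + s) ^ 2) := by ring
      have e2 : j * (s * (j * L + j) * (1 + s) + j * (1 + s) ^ 2) ≤ j * (32 * (j * L ^ 5)) :=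
        Nat.mul_le_mul_left _ (by omega)
      have e3 : 4 * (j * (32 * (j * L ^ 5)) + t * j + j) ≤ j * k := by
        calc _ = j * (4 * (32 * (j * L ^ 5) + t + 1)) := by ring
          _ ≤ _ := Nat.mul_le_mul_left _ (by omega)
      have e4 : k * (t + 2 * j) ≤ k * (j * (1 + s) + 1) := Nat.mul_le_mul_left _ (by linarith)
      have e5 : 2 * k ≤ j * k := Nat.mul_le_mul_right _ hj
      nlinarith
  · exact h.false_of_pos (by omega) (by omega) hR hy (by linarith)

/-- A big level below the top is enough if the surplus is less than `j`. -/
theorem Tight.false_of_lt (h : Tight r P k j L t) (ht : t < j)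
    (hG : 1 ≤ #(bigLevels r P k 0 (k + j - 1))) : False := by
  obtain ⟨f1, f2, f3, f4, f5, f6, f7, f8⟩ := h.sizes.facts
  have hk := h.sizes.sq_le
  have hj := h.sizes.two_le_j
  have hs : 1 ≤ 4 * L ^ 2 := by have := Nat.one_le_pow 2 L (by have := h.sizes.two_le_L; omega); omega
  obtain ⟨σ, y, -, -, h1, hR⟩ := h.climb (s := 1) hs le_rfl (by omega) (h.reach_zero 1)
    (Nat.zero_le (k + j - 1)) (by omega)
  obtain rfl : σ = 1 := by have := hR.1; omega
  rcases Nat.eq_zero_or_pos y with rfl | hy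
  · obtain ⟨-, -, h2, h3⟩ := hR
    refine h.false_of_spread_one (θ := 2) (X := j * L + j) ?_ (by omega) ?_
    · simpa using h3
    · have e1 : j * 2 * (j * L + j + j * 2) ≤ 8 * (j * L) ^ 2 := by
        calc _ ≤ (j * L) * (8 * (j * L)) := Nat.mul_le_mul (by
              have := Nat.mul_le_mul_left j h.sizes.two_le_L; omega) (by
              have := Nat.mul_le_mul_left j h.sizes.two_le_L; omega)
          _ = _ := by ring
      have e2 : (t + 1) * k ≤ j * k := Nat.mul_le_mul_right _ ht
      have e3 : t * j ≤ j * j := Nat.mul_le_mul_right _ ht.le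
      nlinarith
  · exact h.false_of_pos hs (by omega) hR hy (by omega)

end

/-! ### Several big levels -/

section

variable {α : Type*} {r s : α → α → Prop} {P Q A U V Z W Y S D : Finset α} {x y z : α}
  {m k i j p q l t θ Λ E L : ℕ} {X : ℤ}

variable [IsStrictOrder α r]

/-- Going up from a level with at least `k + 2` elements, most of which have two longest chains
below them, the number of these chains doubles: an element of the next level without enough
chains has at most one neighbour among the poor elements, and is counted when that one is
removed. -/
theorem Bounded.raise_two (h : Bounded r P k j Λ) (hS : Spread r P k l 2 ((Λ + j : ℕ) : ℤ))
    (hk : k + 2 ≤ #(level r P l)) (he : 0 ≤ excess r P k l) :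
    Spread r P k (l + 1) 4 (((Λ + j) ^ 2 + 2 * (Λ + j) : ℕ) : ℤ) := by
  have hpoor := hS.card_level_sdiff
  rcases h.expansion_level (rich_subset_level (l := l) (θ := 2)) with h1 | h1
  · set R := rich r P l 2 with hR
    set V := level r P l \ R with hV
    set B := {z ∈ level r P (l + 1) | ¬4 ≤ maxBelow r P z} with hB
    set N := {z ∈ level r P (l + 1) | ¬∃ u ∈ R, r u z} with hN
    have hsub : B ⊆ (N ∪ {z ∈ level r P (l + 1) | ¬2 ≤ #{u ∈ level r P l | r u z}}) ∪
        V.biUnion fun v => {z ∈ level r P (l + 1) | ¬2 ≤ #{u ∈ (level r P l).erase v | r u z}} := by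
      intro z hz
      obtain ⟨hz1, hz2⟩ := mem_filter.1 hz
      have hzr := (mem_level.1 hz1).2
      by_contra hcon
      simp only [mem_union, mem_biUnion, not_or, not_exists, not_and] at hcon
      obtain ⟨⟨h2, h3⟩, h4⟩ := hcon
      obtain ⟨u, hu, huz⟩ : ∃ u ∈ R, r u z := by
        by_contra hno
        exact h2 (mem_filter.2 ⟨hz1, hno⟩)
      replace h3 : 2 ≤ #{u ∈ level r P l | r u z} := by
        by_contra hno
        exact h3 (mem_filter.2 ⟨hz1, hno⟩)
      replace h4 : ∀ v ∈ V, 2 ≤ #{u ∈ (level r P l).erase v | r u z} := by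
        intro v hv
        by_contra hno
        exact h4 v hv (mem_filter.2 ⟨hz1, hno⟩)
      obtain ⟨v, hv, hvu⟩ := exists_mem_ne h3 u
      rw [mem_filter] at hv
      have hmin : 4 ≤ maxBelow r P z := by
        by_cases hvR : v ∈ R
        · exact add_le_maxBelow hvu.symm hu hvR hzr huz hv.2
        · have h5 := h4 v (mem_sdiff.2 ⟨hv.1, hvR⟩)
          obtain ⟨v', hv', hvu'⟩ := exists_mem_ne h5 u
          rw [mem_filter, mem_erase] at hv'
          have h6 := sum_maxBelow_le (r := r) (P := P) (z := z) (S := {u, v, v'}) (by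
            intro y hy
            simp only [mem_insert, mem_singleton] at hy
            rcases hy with rfl | rfl | rfl
            · exact ⟨(mem_rich.1 hu).1, huz, by rw [(mem_rich.1 hu).2.1, hzr]⟩
            · exact ⟨(mem_level.1 hv.1).1, hv.2, by rw [(mem_level.1 hv.1).2, hzr]⟩
            · exact ⟨(mem_level.1 hv'.1.2).1, hv'.2, by rw [(mem_level.1 hv'.1.2).2, hzr]⟩)
          rw [sum_insert (by simp [hvu.symm, hvu'.symm]),
            sum_pair hv'.1.1.symm] at h6
          have h7 := (mem_rich.1 hu).2.2
          have h8 : 1 ≤ maxBelow r P v := maxBelow_pos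
          have h9 : 1 ≤ maxBelow r P v' := maxBelow_pos
          omega
      exact hz2 hmin
    have h2 := card_le_card hsub
    have h3 := card_union_le (N ∪ {z ∈ level r P (l + 1) | ¬2 ≤ #{u ∈ level r P l | r u z}})
      (V.biUnion fun v => {z ∈ level r P (l + 1) | ¬2 ≤ #{u ∈ (level r P l).erase v | r u z}})
    have h4 := card_union_le N {z ∈ level r P (l + 1) | ¬2 ≤ #{u ∈ level r P l | r u z}}
    have h5 : #(V.biUnion fun v =>
        {z ∈ level r P (l + 1) | ¬2 ≤ #{u ∈ (level r P l).erase v | r u z}}) ≤ #V * (Λ + j) := by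
      refine card_biUnion_le_card_mul _ _ _ fun v hv => ?_
      have h6 := card_erase_of_mem (mem_sdiff.1 hv).1
      have := h.expansion_level_of_lt (l := l) (U := (level r P l).erase v) (erase_subset _ _)
        (by omega)
      omega
    have h6 := h.expansion_level_of_lt (l := l) Subset.rfl (by omega)
    have h7 : #{z ∈ level r P (l + 1) | ∃ u ∈ R, r u z} + #N = #(level r P (l + 1)) :=
      card_filter_add_card_filter_not _
    have h8 : #(rich r P (l + 1) 4) + #B = #(level r P (l + 1)) := by
      rw [← card_filter_add_card_filter_not (s := level r P (l + 1)) (fun z => 4 ≤ maxBelow r P z)]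
      congr 2
      ext z
      simp only [mem_rich, mem_filter, mem_level, and_assoc]
    have h9 : #V * (Λ + j) ≤ (Λ + j) ^ 2 := by
      rw [sq]
      exact Nat.mul_le_mul_right _ (by omega)
    unfold Spread at hS ⊢
    rw [← hR] at hS
    rw [excess_succ (l := l + 1)]
    generalize (Λ + j) ^ 2 = C2 at *
    generalize Λ + j = C at *
    generalize #V * C = e at *
    omega
  · have := card_le_card (subset_rich_two_mul (r := r) (P := P) (l := l) (θ := 2))
    rw [show 2 * 2 = 4 from rfl] at this
    have h2 : Λ + j ≤ (Λ + j) ^ 2 :=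
      Nat.le_self_pow (by norm_num) _
    unfold Spread at hS ⊢
    rw [excess_succ (l := l + 1)]
    omega

/-- The case of several big levels below the top which almost all have `k + j` elements. Two
climbs are combined: one counts each big level once and leaves few exceptions; the other uses
that the second big level doubles the number of chains (`Bounded.raise_two`), so that one chain
more is reached at the price of more exceptions. -/
theorem Tight.false_of_two_le (h : Tight r P k j L t)
    (hG : 2 ≤ #(bigLevels r P k 0 (k + j - 1)))
    (ht : j * (#(bigLevels r P k 0 (k + j - 1)) - 1) + 2 ≤ t)
    (ht' : (t : ℤ) ≤ excess r P k (k + j - 1)) : False := by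
  obtain ⟨f1, f2, f3, f4, f5, f6, f7, f8⟩ := h.sizes.facts
  have hk := h.sizes.sq_le
  have hk' := h.sizes.pow_le
  have hj := h.sizes.two_le_j
  have hL := h.sizes.two_le_L
  have htb := h.bounds.1
  set G := #(bigLevels r P k 0 (k + j - 1)) with hGdef
  obtain ⟨g, hg⟩ : ∃ g, G = g + 2 := ⟨G - 2, by omega⟩
  have hgL : g + 1 ≤ L ^ 2 := by
    have : j * (g + 1) ≤ j * L ^ 2 := by
      rw [hg] at ht
      have : j * (g + 2 - 1) = j * (g + 1) := rfl
      omega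
    exact Nat.le_of_mul_le_mul_left this (by omega)
  have hL2 : 2 ^ 2 ≤ L ^ 2 := Nat.pow_le_pow_left hL 2
  -- the second big level
  obtain ⟨l, hl1, hl2⟩ : ∃ l, #(bigLevels r P k 0 l) < 2 ∧ 2 ≤ #(bigLevels r P k 0 (l + 1)) := by
    have hex : ∃ l, 2 ≤ #(bigLevels r P k 0 l) := ⟨_, hG⟩
    obtain ⟨l, hl⟩ : ∃ l, Nat.find hex = l + 1 := by
      refine Nat.exists_eq_succ_of_ne_zero fun h0 => ?_
      have := Nat.find_spec hex
      rw [h0] at this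
      simp [bigLevels] at this
    refine ⟨l, ?_, hl ▸ Nat.find_spec hex⟩
    have := Nat.find_min hex (m := l) (by omega)
    omega
  have hl3 := card_bigLevels_succ (r := r) (P := P) (k := k) (Nat.zero_le l)
  have hbig : k < #(level r P l) := by
    by_contra hcon
    rw [if_neg hcon] at hl3
    omega
  rw [if_pos hbig] at hl3
  have hlq : l < k + j - 1 := by
    by_contra! hcon
    have := bigLevels_add (r := r) (P := P) (k := k) (Nat.zero_le _) hcon
    omega
  have hsplit := bigLevels_add (r := r) (P := P) (k := k) (Nat.zero_le (l + 1)) hlq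
  have hsplit' := bigLevels_add (r := r) (P := P) (k := k) (Nat.zero_le l) hlq.le
  have e1 := h.toBounded.excess_le (a := l + 1) (b := k + j - 1) hlq
  have e2 := h.toBounded.excess_le (a := 0) (b := l) (Nat.zero_le _)
  have e3 := h.toBounded.excess_le (a := l) (b := k + j - 1) hlq.le
  rw [excess_succ] at e1
  rw [excess_zero, show #(bigLevels r P k 0 l) = 1 by omega] at e2
  rw [show #(bigLevels r P k (l + 1) (k + j - 1)) = g by omega] at e1
  rw [show #(bigLevels r P k l (k + j - 1)) = g + 1 by omega] at e3
  push_cast at e2 e3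
  have ht2 : (j : ℤ) * (g + 1) + 2 ≤ t := by
    rw [hg] at ht
    exact_mod_cast ht
  have hbig2 : k + 2 ≤ #(level r P l) := by
    have : (k : ℤ) + 2 ≤ #(level r P l) := by linarith
    exact_mod_cast this
  have hpos : 0 ≤ excess r P k l := by
    linarith
  have htG : t ≤ j * (g + 2) := by
    have : (t : ℤ) ≤ j * (g + 2) := by
      have := h.toBounded.card_level_le (l := l)
      have : (#(level r P l) : ℤ) ≤ k + j := by exact_mod_cast this
      linarith
    exact_mod_cast this
  obtain ⟨σ, y, -, -, h1, hR⟩ := h.climb (s := g + 3) (by omega) le_rfl (by omega)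
    (h.reach_zero (g + 3)) (Nat.zero_le l) (by omega)
  have hfin : ∀ y, ¬Reach r P k j (j * L) (g + 3) 1 (0 : ℕ) (k + j - 1) (g + 3) y := fun y hR =>
    h.false_of_reach (by omega) hR (by linarith)
  by_cases hσ : 2 ≤ σ
  · obtain ⟨σ', y', -, -, h2, hR'⟩ := h.climb (by omega) le_rfl (by omega) hR hlq.le (by omega)
    obtain rfl : σ' = g + 3 := by have := hR'.1; omega
    exact hfin _ hR'
  obtain rfl : σ = 1 := by omega
  obtain rfl : y = 0 := by
    by_contra hy
    have := hR.2.1 (by omega)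
    omega
  have hS : Spread r P k l 2 ((j * L + j : ℕ) : ℤ) := by
    have := hR.2.2.2
    simpa using this
  -- the two climbs from level `l + 1`, with few exceptions and with one chain more
  have hA := h.toBounded.raise hS (by omega) hbig
  have hB := h.toBounded.raise_two hS hbig2 hpos
  obtain ⟨σA, yA, -, -, hA1, hRA⟩ := h.climb (s := g + 3) (θ₀ := 1) (X₀ := 0) (l₀ := l + 1)
    (σ₀ := 2) (y₀ := 0) (by omega) le_rfl (by omega)
    ⟨by omega, by omega, by omega, by
      have e : (((0 : ℕ) : ℤ) + ((2 : ℕ) + (0 : ℕ)) * (j * L + j : ℕ)) =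
        (j * L + j : ℕ) + (j * L + j : ℕ) := by push_cast; ring
      rw [e]
      exact hA⟩
    (show l + 1 ≤ k + j - 1 by omega) (by omega)
  by_cases hσA : σA = g + 3
  · subst hσA
    exact hfin _ hRA
  obtain rfl : σA = g + 2 := by have := hRA.1; omega
  obtain rfl : yA = 0 := by
    by_contra hy
    have := hRA.2.1 (by omega)
    omega
  have hC2 : (j * L + j) ^ 2 + 2 * (j * L + j) ≤ 8 * (j * L) ^ 2 := by
    have : (j * L + j) ^ 2 ≤ (2 * (j * L)) ^ 2 := Nat.pow_le_pow_left (by omega) 2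
    have e : (2 * (j * L)) ^ 2 = 4 * (j * L) ^ 2 := by ring
    have : 4 * (j * L) ≤ 4 * (j * L) ^ 2 := by
      have : j * L * 1 ≤ j * L * (j * L) := Nat.mul_le_mul_left _ (by omega)
      rw [sq]
      omega
    omega
  obtain ⟨σB, yB, -, -, hB1, hRB⟩ := h.climb (s := g) (θ₀ := 4) (l₀ := l + 1)
    (X₀ := (j * L + j) ^ 2 + 2 * (j * L + j)) (σ₀ := 0) (y₀ := 0) (by omega) (by omega) (by omega)
    ⟨by omega, by omega, by omega, by simpa using hB⟩ (show l + 1 ≤ k + j - 1 by omega) (by omega)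
  obtain rfl : g = σB := by have := hRB.1; omega
  rcases Nat.eq_zero_or_pos yB with rfl | hy
  · obtain ⟨b1, b2, b3, b4, b5⟩ := h.sizes.bounds (θ := g + 3) (σ := g + 2) (by omega) (by omega)
    have b6 := (h.sizes.bounds (θ := g + 3) (σ := g) (by omega) (by omega)).2.1
    have hA2 : Spread r P k (k + j - 1) (g + 3) (((g + 2) * (j * L + j) : ℕ) : ℤ) := by
      have := hRA.2.2.2
      simp only [pow_zero, one_mul, Nat.cast_zero, zero_add, add_zero] at this
      refine this.weaken (by omega) (by push_cast; linarith)
    have hB2 : Spread r P k (k + j - 1) (g + 4)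
        (((j * L + j) ^ 2 + 2 * (j * L + j) + g * (j * L + j) : ℕ) : ℤ) := by
      have := hRB.2.2.2
      simp only [pow_zero, one_mul, Nat.cast_zero, add_zero] at this
      refine this.weaken (by omega) (by push_cast; linarith)
    have c1 := h.card_rich_top hA2
    have c2 := h.card_rich_top hB2
    refine h.false_of_two (D := level r P (k + j - 1)) (θ := g + 3)
      (S₁ := rich r P (k + j - 1) (g + 3)) (S₂ := rich r P (k + j - 1) (g + 4)) level_subset
      level_antichain rich_subset_level rich_subset_level
      (fun x hx => le_card_through_top hx ?_) (fun x hx => le_card_through_top hx ?_)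
      (X₁ := (g + 2) * (j * L + j))
      (X₂ := (j * L + j) ^ 2 + 2 * (j * L + j) + g * (j * L + j)) (by omega) (by omega)
      (by linarith) ?_
    · have : (g + 3) * 1 ≤ (g + 3) * j := Nat.mul_le_mul_left _ (by omega)
      omega
    · have : (g + 3) * 1 ≤ (g + 3) * j := Nat.mul_le_mul_left _ (by omega)
      omega
    · rw [show 2 * (g + 3) * j = 2 * ((g + 3) * j) by ring]
      omega
  · exact h.false_of_pos (by omega) (by omega) hRB hy (by linarith)

/-- If the top level has at most `k` elements, only one profile of level sizes remains: one
level below the top has `k + j` elements, and all other levels have `k`. -/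
theorem Tight.profile (h : Tight r P k j L t) (hd : #(level r P (k + j - 1)) ≤ k) :
    t = j ∧ ∃ i < k + j - 1, #(level r P i) = k + j ∧
      ∀ l < k + j, l ≠ i → #(level r P l) = k := by
  have hj := h.sizes.two_le_j
  have hL := h.sizes.two_le_L
  have htb := h.bounds.1
  have h1 := h.one_le
  have hL2 : 2 ^ 2 ≤ L ^ 2 := Nat.pow_le_pow_left hL 2
  have ht' : (t : ℤ) ≤ excess r P k (k + j - 1) := by
    have := h.excess_top
    rw [excess_succ] at this
    omega
  have hG := h.toBounded.excess_le (Nat.zero_le (k + j - 1))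
  rw [excess_zero, zero_add] at hG
  set G := #(bigLevels r P k 0 (k + j - 1)) with hGdef
  have htG : t ≤ j * G := by exact_mod_cast ht'.trans hG
  have hG1 : 1 ≤ G := by
    by_contra! hcon
    have : G = 0 := by omega
    rw [this] at htG
    omega
  obtain ⟨g, hg⟩ : ∃ g, G = g + 1 := ⟨G - 1, by omega⟩
  rw [hg] at htG
  -- otherwise enough big levels for a large number of chains at the top
  have hα : j * g + 2 ≤ t := by
    by_contra! hcon
    obtain ⟨a, ha1, ha2, ha3⟩ : ∃ a, t ≤ j * a + 1 ∧ a ≤ g ∧ a ≤ L ^ 2 + 1 := by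
      refine ⟨(t + j - 2) / j, ?_, ?_, ?_⟩
      · have := Nat.lt_div_mul_add (a := t + j - 2) (b := j) (by omega)
        rw [mul_comm]
        omega
      · rw [← Nat.lt_succ_iff, Nat.div_lt_iff_lt_mul (by omega)]
        have : g.succ * j = j * g + j := by rw [Nat.succ_eq_add_one]; ring
        omega
      · rw [← Nat.lt_succ_iff, Nat.div_lt_iff_lt_mul (by omega)]
        have : (L ^ 2 + 1).succ * j = j * L ^ 2 + 2 * j := by rw [Nat.succ_eq_add_one]; ring
        omega
    obtain ⟨σ, y, -, -, h2, hR⟩ := h.climb (s := a + 1) (by omega) le_rfl (by omega)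
      (h.reach_zero (a + 1)) (Nat.zero_le (k + j - 1)) (by omega)
    obtain rfl : σ = a + 1 := by have := hR.1; omega
    exact h.false_of_reach (by omega) hR (by linarith)
  have hg0 : g = 0 := by
    by_contra hg0
    refine h.false_of_two_le (by omega) ?_ ht'
    rw [← hGdef, hg]
    exact hα
  subst hg0
  rw [zero_add, mul_one] at htG
  have htj : t = j := by
    by_contra hne
    exact h.false_of_lt (by omega) (by omega)
  refine ⟨htj, ?_⟩
  obtain ⟨i, hi⟩ := card_eq_one.1 hg
  have hi1 : i ∈ bigLevels r P k 0 (k + j - 1) := hi ▸ mem_singleton_self i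
  obtain ⟨hi2, hi3⟩ := mem_filter.1 hi1
  have hi4 := (mem_Ico.1 hi2).2
  have hsum := h.excess_top
  rw [excess_eq_sum, show k + j - 1 + 1 = k + j by omega] at hsum
  have hle : ∀ l ∈ range (k + j), ((#(level r P l) : ℤ) - k) ≤ if l = i then (j : ℤ) else 0 := by
    intro l hl
    split_ifs with hli
    · have := h.toBounded.card_level_le (l := l)
      omega
    · have : #(level r P l) ≤ k := by
        by_contra! hcon
        by_cases hl2 : l = k + j - 1
        · rw [hl2] at hcon
          omega
        · have : l ∈ bigLevels r P k 0 (k + j - 1) :=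
            mem_filter.2 ⟨mem_Ico.2 ⟨Nat.zero_le _, by have := mem_range.1 hl; omega⟩, hcon⟩
          rw [hi, mem_singleton] at this
          exact hli this
      omega
  have heq := (sum_eq_sum_iff_of_le hle).1 (by
    rw [hsum, sum_ite_eq', if_pos (mem_range.2 (by omega)), htj])
  refine ⟨i, hi4, ?_, fun l hl hli => ?_⟩
  · have := heq i (mem_range.2 (by omega))
    rw [if_pos rfl] at this
    omega
  · have := heq l (mem_range.2 hl)
    rw [if_neg hli] at this
    omega

end

section

variable {α : Type*} {r s : α → α → Prop} {P Q A U V Z W Y S D : Finset α} {x y z : α}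
  {m k i j p q l t θ Λ E L : ℕ} {X : ℤ}

/-! ### One big level -/

theorem sum_range_choose_eq (n k : ℕ) : ∑ l ∈ range n, l.choose k = n.choose (k + 1) := by
  induction n with
  | zero => simp
  | succ n ih => rw [sum_range_succ, ih, Nat.choose_succ_succ', add_comm]

theorem sum_Ico_choose_add (h : i ≤ m) (hk : 1 ≤ k) :
    ∑ l ∈ Ico i m, l.choose (k - 1) + i.choose k = m.choose k := by
  induction m, h using Nat.le_induction with
  | base => simp
  | succ m hm ih =>
    obtain ⟨k, rfl⟩ : ∃ k', k = k' + 1 := ⟨k - 1, by omega⟩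
    rw [Nat.choose_succ_succ', sum_Ico_succ_top hm, ← ih, Nat.add_sub_cancel]
    ring

/-- Among two-element subsets of `V`, intersecting pairs are frequent. -/
theorem two_mul_card_le_pairs (N : α → Finset α) (Z : Finset α) (h2 : ∀ z ∈ Z, #(N z) = 2)
    (hV : ∀ z ∈ Z, N z ⊆ V) :
    2 * #Z ≤ #V + 2 * #{B ∈ Z.powersetCard 2 | #(B.biUnion N) ≤ 3} := by
  induction Z using Finset.strongInduction with
  | H Z ih =>
    by_cases hdis : ∀ z ∈ Z, ∀ z' ∈ Z, z ≠ z' → Disjoint (N z) (N z')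
    · have h3 := card_biUnion hdis
      rw [sum_congr rfl h2, sum_const, smul_eq_mul] at h3
      have h4 := card_le_card (biUnion_subset.2 hV)
      omega
    · push Not at hdis
      obtain ⟨z, hz, z', hz', hne, hint⟩ := hdis
      have h3 := ih (Z.erase z) (erase_ssubset hz) (fun y hy => h2 y (mem_of_mem_erase hy))
        (fun y hy => hV y (mem_of_mem_erase hy))
      rw [card_erase_of_mem hz] at h3
      have h4 : ({z, z'} : Finset α) ∉ {B ∈ (Z.erase z).powersetCard 2 | #(B.biUnion N) ≤ 3} := by
        intro hB
        have := (mem_powersetCard.1 (mem_filter.1 hB).1).1 (mem_insert_self z {z'})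
        exact (mem_erase.1 this).1 rfl
      have h5 : insert {z, z'} {B ∈ (Z.erase z).powersetCard 2 | #(B.biUnion N) ≤ 3} ⊆
          {B ∈ Z.powersetCard 2 | #(B.biUnion N) ≤ 3} := by
        refine insert_subset (mem_filter.2 ⟨mem_powersetCard.2
          ⟨insert_subset hz (singleton_subset_iff.2 hz'), card_pair hne⟩, ?_⟩) ?_
        · rw [biUnion_insert, singleton_biUnion]
          have h6 := card_union_add_card_inter (N z) (N z')
          rw [h2 z hz, h2 z' hz'] at h6
          rw [not_disjoint_iff_nonempty_inter] at hint
          have := card_pos.2 hint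
          omega
        · exact filter_subset_filter _ (powersetCard_mono (erase_subset _ _))
      have h6 := card_le_card h5
      rw [card_insert_of_notMem h4] at h6
      omega

theorem card_sdiff_biUnion_ge (N : α → Finset α) (D B : Finset α) {c : ℕ}
    (h : #(B.biUnion N) ≤ c) : #D - c ≤ #(D \ B.biUnion N) := by
  have := le_card_sdiff (B.biUnion N) D
  omega

/-- Comparisons of binomial coefficients with `w = C(k + j - 1, k)`: the first one is
negligible, the other two are nearly `(j - 1) * w` after multiplication by `k`. -/
theorem through_bounds {i : ℕ} (h : Sizes k j L) (hi : i + 3 ≤ k + j) :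
    1000000 * (k * i.choose k) ≤ (k + j - 1).choose k ∧
    1000 * ((j - 1) * (k + j - 1).choose k) ≤ 1001 * (k * (k + j - 2).choose k) ∧
    100 * ((j - 1) * (k + j - 1).choose k) ≤ 101 * (k * (k + j - 3).choose (k - 1)) := by
  obtain ⟨f1, f2, f3, f4, f5, -⟩ := h.facts
  have hj := h.two_le_j
  have h1 := mul_choose_sub_two (k := k) hj
  have h2 := Nat.choose_mul_succ_eq (k + j - 3) k
  rw [show k + j - 3 + 1 = k + j - 2 by omega] at h2
  have h3 := Nat.choose_mul_succ_eq (k + j - 2) k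
  rw [show k + j - 2 + 1 = k + j - 1 by omega, show k + j - 1 - k = j - 1 by omega] at h3
  have h4 := Nat.add_one_mul_choose_eq (k + j - 2) (k - 1)
  rw [show k + j - 2 + 1 = k + j - 1 by omega, show k - 1 + 1 = k by omega] at h4
  have h5 := Nat.choose_mul_succ_eq (k + j - 3) (k - 1)
  rw [show k + j - 3 + 1 = k + j - 2 by omega, show k + j - 2 - (k - 1) = j - 1 by omega] at h5
  have h6 : i.choose k ≤ (k + j - 3).choose k := Nat.choose_le_choose _ (by omega)
  generalize i.choose k = e at *
  generalize (k + j - 3).choose k = d at *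
  generalize (k + j - 2).choose k = b at *
  generalize (k + j - 2).choose (k - 1) = b' at *
  generalize (k + j - 3).choose (k - 1) = p at *
  generalize (k + j - 1).choose k = w at *
  refine ⟨?_, ?_, ?_⟩
  · have g1 : k * d ≤ j * b := by
      calc k * d ≤ d * (k + j - 2) := by rw [mul_comm]; exact Nat.mul_le_mul_left _ (by omega)
        _ = b * (k + j - 2 - k) := h2
        _ ≤ b * j := Nat.mul_le_mul_left _ (by omega)
        _ = _ := mul_comm _ _
    have g2 : k * (1000000 * (k * e)) ≤ k * w := by
      calc k * (1000000 * (k * e)) ≤ k * (1000000 * (k * d)) := by gcongr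
        _ ≤ k * (1000000 * (j * b)) := by gcongr
        _ = 1000000 * j * (k * b) := by ring
        _ ≤ 1000000 * j * (j * w) := by gcongr
        _ = 1000000 * (j * j) * w := by ring
        _ ≤ _ := Nat.mul_le_mul_right _ f5
    exact Nat.le_of_mul_le_mul_left g2 (by omega)
  · calc 1000 * ((j - 1) * w) = 1000 * (w * (j - 1)) := by ring
      _ = b * (1000 * (k + j - 1)) := by rw [← h3]; ring
      _ ≤ b * (1001 * k) := Nat.mul_le_mul_left _ (by omega)
      _ = _ := by ring
  · have g1 : k * (100 * ((j - 1) * w)) ≤ k * (101 * (k * p)) := by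
      calc k * (100 * ((j - 1) * w)) = 100 * ((j - 1) * (w * k)) := by ring
        _ = 100 * ((k + j - 1) * (b' * (j - 1))) := by rw [← h4]; ring
        _ = (100 * (k + j - 1)) * ((k + j - 2) * p) := by rw [← h5]; ring
        _ ≤ (100 * (k + j)) * ((k + j) * p) := Nat.mul_le_mul
          (Nat.mul_le_mul_left _ (by omega)) (Nat.mul_le_mul_right _ (by omega))
        _ = (100 * ((k + j) * (k + j))) * p := by ring
        _ ≤ (101 * (k * k)) * p := by
          refine Nat.mul_le_mul_right _ ?_
          have : 1000 * j ≤ k := by omega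
          nlinarith
        _ = _ := by ring
    exact Nat.le_of_mul_le_mul_left g1 (by omega)

variable [IsStrictOrder α r]

/-- Antichains in two consecutive levels, sorted by their part in the upper one. -/
theorem sum_choose_le_card_antis (ℬ : Finset (Finset α))
    (hℬ : ∀ B ∈ ℬ, B ⊆ level r P (i + 1) ∧ #B ≤ m) :
    ∑ B ∈ ℬ, (#(level r P i \ B.biUnion fun z => {u ∈ level r P i | r u z})).choose (m - #B) ≤
      #(antis r P m) := by
  have hdis : ∀ u, u ∈ level r P i → u ∉ level r P (i + 1) := by
    intro u h1 h2
    have := (mem_level.1 h1).2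
    have := (mem_level.1 h2).2
    omega
  rw [← sum_congr rfl fun B _ => card_powersetCard (m - #B)
    (level r P i \ B.biUnion fun z => {u ∈ level r P i | r u z}), ← card_sigma]
  apply card_le_card_of_injOn fun x => x.1 ∪ x.2
  · rintro ⟨B, A⟩ hx
    obtain ⟨hB, hA⟩ := mem_sigma.1 hx
    obtain ⟨h1, h2⟩ := hℬ B hB
    obtain ⟨h3, h4⟩ := mem_powersetCard.1 hA
    have h5 := h3.trans sdiff_subset
    refine mem_coe.2 (mem_antis.2 ⟨union_subset (h1.trans level_subset)
      (h5.trans level_subset), ?_, ?_⟩)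
    · change #(B ∪ A) = m
      replace h4 : #A = m - #B := h4
      replace h2 : #B ≤ m := h2
      rw [card_union_of_disjoint, h4]
      · omega
      · rw [disjoint_left]
        exact fun u hu hu' => hdis u (h5 hu') (h1 hu)
    · rw [coe_union, isAntichain_union]
      refine ⟨level_antichain.subset (by exact_mod_cast h1),
        level_antichain.subset (by exact_mod_cast h5), ?_⟩
      intro b hb a ha _
      have hb' := mem_level.1 (h1 hb)
      have ha' := mem_level.1 (h5 ha)
      constructor
      · intro hr
        have := rk_lt_rk hb'.1 hr
        omega
      · intro hr
        exact (mem_sdiff.1 (h3 ha)).2 (mem_biUnion.2 ⟨b, hb, mem_filter.2 ⟨h5 ha, hr⟩⟩)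
  · rintro ⟨B, A⟩ hx ⟨B', A'⟩ hx' he
    obtain ⟨hB, hA⟩ := mem_sigma.1 hx
    obtain ⟨hB', hA'⟩ := mem_sigma.1 hx'
    have h5 := (mem_powersetCard.1 hA).1.trans sdiff_subset
    have h5' := (mem_powersetCard.1 hA').1.trans sdiff_subset
    have h1 := (hℬ B hB).1
    have h1' := (hℬ B' hB').1
    have he' : B ∪ A = B' ∪ A' := he
    have hBB : B = B' := by
      ext u
      constructor
      · intro hu
        rcases mem_union.1 (he' ▸ mem_union_left A hu) with h6 | h6
        · exact h6
        · exact (hdis u (h5' h6) (h1 hu)).elim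
      · intro hu
        rcases mem_union.1 (he' ▸ mem_union_left A' hu : u ∈ B ∪ A) with h6 | h6
        · exact h6
        · exact (hdis u (h5 h6) (h1' hu)).elim
    have hAA : A = A' := by
      ext u
      constructor
      · intro hu
        rcases mem_union.1 (he' ▸ mem_union_right B hu) with h6 | h6
        · exact (hdis u (h5 hu) (h1' h6)).elim
        · exact h6
      · intro hu
        rcases mem_union.1 (he' ▸ mem_union_right B' hu : u ∈ B ∪ A) with h6 | h6
        · exact (hdis u (h5' hu) (h1 h6)).elim
        · exact h6
    subst hBB hAA
    rfl

/-- Antichains in a level with `k + j` elements and the following one, where `Z₁` consists of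
elements with at most one lower neighbour and `Z₂` of elements with two. -/
theorem le_card_antis_of_neighbours (hk : 1 ≤ k) (hi : k + j ≤ #(level r P i))
    (hkj : 3 ≤ k + j)
    {Z₁ Z₂ : Finset α} (h1 : Z₁ ⊆ level r P (i + 1)) (h2 : Z₂ ⊆ level r P (i + 1))
    (hd : Disjoint Z₁ Z₂) (hn1 : ∀ z ∈ Z₁, #{u ∈ level r P i | r u z} ≤ 1)
    (hn2 : ∀ z ∈ Z₂, #{u ∈ level r P i | r u z} = 2) :
    ∃ p, 2 * #Z₂ ≤ #(level r P i) + 2 * p ∧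
      (k + j - 1).choose k + #Z₁ * (k + j - 1).choose k + #Z₂ * (k + j - 2).choose k +
        p * (k + j - 3).choose (k - 1) ≤ #(antis r P (k + 1)) := by
  set N : α → Finset α := fun z => {u ∈ level r P i | r u z} with hN
  set 𝒯 := {B ∈ Z₂.powersetCard 2 | #(B.biUnion N) ≤ 3} with h𝒯
  refine ⟨#𝒯, two_mul_card_le_pairs N Z₂ hn2 (fun z _ => filter_subset _ _), ?_⟩
  set f : Finset α → ℕ := fun B => (#(level r P i \ B.biUnion N)).choose (k + 1 - #B) with hf
  have hsum := sum_choose_le_card_antis (r := r) (P := P) (i := i) (m := k + 1)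
    (({∅} : Finset (Finset α)) ∪ (Z₁.image singleton ∪ (Z₂.image singleton ∪ 𝒯))) (by
      intro B hB
      rcases mem_union.1 hB with hB | hB
      · rw [mem_singleton.1 hB]
        simp
      rcases mem_union.1 hB with hB | hB
      · obtain ⟨z, hz, rfl⟩ := mem_image.1 hB
        exact ⟨singleton_subset_iff.2 (h1 hz), by simp⟩
      rcases mem_union.1 hB with hB | hB
      · obtain ⟨z, hz, rfl⟩ := mem_image.1 hB
        exact ⟨singleton_subset_iff.2 (h2 hz), by simp⟩
      · obtain ⟨h3, h4⟩ := mem_powersetCard.1 (mem_filter.1 hB).1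
        exact ⟨h3.trans h2, by omega⟩)
  change ∑ B ∈ _, f B ≤ _ at hsum
  have h𝒯2 : ∀ B ∈ 𝒯, #B = 2 := fun B hB => (mem_powersetCard.1 (mem_filter.1 hB).1).2
  rw [sum_union, sum_union, sum_union, sum_singleton,
    sum_image (fun a _ b _ h => singleton_injective h),
    sum_image (fun a _ b _ h => singleton_injective h)] at hsum
  rotate_left
  · rw [disjoint_left]
    intro B hB hB'
    obtain ⟨z, hz, rfl⟩ := mem_image.1 hB
    have := h𝒯2 _ hB'
    simp at this
  · rw [disjoint_left]
    intro B hB hB'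
    obtain ⟨z, hz, rfl⟩ := mem_image.1 hB
    rcases mem_union.1 hB' with hB' | hB'
    · obtain ⟨z', hz', he⟩ := mem_image.1 hB'
      obtain rfl := singleton_injective he
      exact (disjoint_left.1 hd hz) hz'
    · have := h𝒯2 _ hB'
      simp at this
  · rw [disjoint_left]
    intro B hB hB'
    obtain rfl := mem_singleton.1 hB
    rcases mem_union.1 hB' with hB' | hB'
    · obtain ⟨z', hz', he⟩ := mem_image.1 hB'
      simp at he
    rcases mem_union.1 hB' with hB' | hB'
    · obtain ⟨z', hz', he⟩ := mem_image.1 hB'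
      simp at he
    · have := h𝒯2 _ hB'
      simp at this
  have g0 : (k + j - 1).choose k ≤ f ∅ := by
    have e1 : (k + j - 1).choose k ≤ (k + j).choose (k + 1) := by
      obtain ⟨n, hn⟩ : ∃ n, k + j = n + 1 := ⟨k + j - 1, by omega⟩
      rw [hn, Nat.choose_succ_succ', Nat.add_sub_cancel]
      exact Nat.le_add_right _ _
    refine e1.trans ?_
    simp only [hf, biUnion_empty, sdiff_empty, card_empty, Nat.sub_zero]
    exact Nat.choose_le_choose _ hi
  have g1 : #Z₁ * (k + j - 1).choose k ≤ ∑ z ∈ Z₁, f {z} := by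
    rw [← smul_eq_mul]
    refine card_nsmul_le_sum _ _ _ fun z hz => ?_
    simp only [hf, card_singleton, Nat.add_sub_cancel]
    refine Nat.choose_le_choose _ (le_trans (by omega)
      (card_sdiff_biUnion_ge N _ _ (c := 1) (by rw [singleton_biUnion]; exact hn1 z hz)))
  have g2 : #Z₂ * (k + j - 2).choose k ≤ ∑ z ∈ Z₂, f {z} := by
    rw [← smul_eq_mul]
    refine card_nsmul_le_sum _ _ _ fun z hz => ?_
    simp only [hf, card_singleton, Nat.add_sub_cancel]
    refine Nat.choose_le_choose _ (le_trans (by omega)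
      (card_sdiff_biUnion_ge N _ _ (c := 2) (by rw [singleton_biUnion]; exact (hn2 z hz).le)))
  have g3 : #𝒯 * (k + j - 3).choose (k - 1) ≤ ∑ B ∈ 𝒯, f B := by
    rw [← smul_eq_mul]
    refine card_nsmul_le_sum _ _ _ fun B hB => ?_
    simp only [hf, h𝒯2 B hB, show k + 1 - 2 = k - 1 by omega]
    exact Nat.choose_le_choose _ (le_trans (by omega)
      (card_sdiff_biUnion_ge N _ _ (c := 3) (mem_filter.1 hB).2))
  omega

/-- Chains counted by their top element, with a second and third longest chain below it where
available. -/
theorem le_card_chains_of_rich (hk : 3 ≤ k) (hrk : ∀ x ∈ P, rk r P x < m) (hi : i < m)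
    {d e : ℕ} (hd : ∀ l < m, k ≤ #(level r P l))
    (h2 : ∀ l, i < l → l < m → d ≤ #(rich r P l 2)) (h3 : e ≤ #(rich r P (m - 1) 3)) :
    k * m.choose (k + 1) + d * (m - 1).choose k + e * (m - 3).choose (k - 2) ≤
      #(chains r P (k + 1)) + d * i.choose k := by
  have h0 := sum_chains_below_le (r := r) (P := P) (m := k) (S := P) Subset.rfl
  have hx : ∀ x ∈ P, (rk r P x).choose k + (if 2 ≤ maxBelow r P x then (rk r P x - 1).choose (k - 1)
      else 0) + (if 3 ≤ maxBelow r P x then (rk r P x - 2).choose (k - 2) else 0) ≤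
      #(chains r (below r P x) k) := by
    intro x _
    split_ifs with c2 c3 c3
    · have := sum_choose_le_chains_below c3 hk
      rw [sum_range_succ, sum_range_succ, sum_range_one] at this
      simpa using this
    · have := sum_choose_le_chains_below c2 (by omega : 2 ≤ k)
      rw [sum_range_succ, sum_range_one] at this
      simpa using this
    · omega
    · have := choose_rk_le_chains_below (r := r) (P := P) (x := x) (k := k)
      simpa using this
  have h4 := (sum_le_sum hx).trans h0
  rw [sum_add_distrib, sum_add_distrib, sum_eq_sum_level hrk, sum_eq_sum_level hrk,
    sum_eq_sum_level hrk] at h4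
  have a1 : k * m.choose (k + 1) ≤ ∑ l ∈ range m, ∑ x ∈ level r P l, (rk r P x).choose k := by
    rw [← sum_range_choose_eq, mul_sum]
    refine sum_le_sum fun l hl => ?_
    rw [sum_congr rfl (g := fun _ => l.choose k) fun x hx => by rw [(mem_level.1 hx).2], sum_const,
      smul_eq_mul]
    exact Nat.mul_le_mul_right _ (hd l (mem_range.1 hl))
  have hrich : ∀ l θ, {x ∈ level r P l | θ ≤ maxBelow r P x} = rich r P l θ := by
    intro l θ
    ext x
    simp only [mem_filter, mem_level, mem_rich, and_assoc]
  have a2 : d * (m - 1).choose k ≤ (∑ l ∈ range m, ∑ x ∈ level r P l,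
      if 2 ≤ maxBelow r P x then (rk r P x - 1).choose (k - 1) else 0) + d * i.choose k := by
    have e1 : ∑ l ∈ Ico (i + 1) m, d * (l - 1).choose (k - 1) ≤ ∑ l ∈ range m,
        ∑ x ∈ level r P l, if 2 ≤ maxBelow r P x then (rk r P x - 1).choose (k - 1) else 0 := by
      refine le_trans (sum_le_sum fun l hl => ?_) (sum_le_sum_of_subset (s := Ico (i + 1) m) ?_)
      · obtain ⟨b1, b2⟩ := mem_Ico.1 hl
        rw [← sum_filter, hrich, sum_congr rfl (g := fun _ => (l - 1).choose (k - 1))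
          fun x hx => by rw [(mem_rich.1 hx).2.1], sum_const, smul_eq_mul]
        exact Nat.mul_le_mul_right _ (h2 l (by omega) b2)
      · intro l hl
        exact mem_range.2 (mem_Ico.1 hl).2
    have e2 := sum_Ico_choose_add (i := i) (m := m - 1) (k := k) (by omega) (by omega)
    have e3 : ∑ l ∈ Ico (i + 1) m, d * (l - 1).choose (k - 1) =
        d * ∑ l ∈ Ico i (m - 1), l.choose (k - 1) := by
      rw [mul_sum, show m = m - 1 + 1 by omega, ← sum_Ico_add' _ i (m - 1) 1]
      simp
    rw [← e2, mul_add, ← e3]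
    omega
  have a3 : e * (m - 3).choose (k - 2) ≤ ∑ l ∈ range m, ∑ x ∈ level r P l,
      if 3 ≤ maxBelow r P x then (rk r P x - 2).choose (k - 2) else 0 := by
    refine le_trans ?_ (single_le_sum (fun _ _ => Nat.zero_le _) (mem_range.2 (by omega : m - 1 < m)))
    rw [← sum_filter, hrich, sum_congr rfl (g := fun _ => (m - 3).choose (k - 2))
      fun x hx => by rw [(mem_rich.1 hx).2.1, show m - 1 - 2 = m - 3 by omega], sum_const,
      smul_eq_mul]
    exact Nat.mul_le_mul_right _ h3
  omega

/-- The case of one level with `k + j` elements, below the last two levels, all others having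
`k`. The elements of the following level are sorted by the number of their lower neighbours:
`Z₁` (at most one), `Z₂` (two), `Z₃` (at least three). Most elements above the big level have
two longest chains below them. If `Z₃` is large, then many have three; otherwise `Z₂` gives many
antichains inside the two levels. Either way the number of monotone sets exceeds the extremal
number. -/
theorem Tight.false_of_one_big (h : Tight r P k j L j) (hi : i + 3 ≤ k + j)
    (hbig : #(level r P i) = k + j) (ho : ∀ l < k + j, l ≠ i → #(level r P l) = k) : False := by
  obtain ⟨f1, f2, f3, f4, f5, f6, f7, f8⟩ := h.sizes.facts
  have hk := h.sizes.sq_le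
  have hj := h.sizes.two_le_j
  set N : α → Finset α := fun z => {u ∈ level r P i | r u z} with hN
  set Z₁ := {z ∈ level r P (i + 1) | ¬2 ≤ #(N z)} with hZ₁
  set Z₂ := {z ∈ level r P (i + 1) | #(N z) = 2} with hZ₂
  set Z₃ := {z ∈ level r P (i + 1) | 3 ≤ #(N z)} with hZ₃
  have hZ1 : #Z₁ + (k + j) ≤ k + (j * L + j) := by
    have := h.toBounded.expansion_level_of_lt (l := i) Subset.rfl (by omega)
    rw [hbig] at this
    exact this
  have hZc : #Z₁ + (#Z₂ + #Z₃) = k := by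
    rw [← ho (i + 1) (by omega) (by omega), ← card_union_of_disjoint, ← card_union_of_disjoint]
    · congr 1
      ext z
      simp only [Z₁, Z₂, Z₃, mem_union, mem_filter, ← and_or_left]
      refine and_iff_left ?_
      omega
    · rw [disjoint_left]
      intro z h1 h2
      have := (mem_filter.1 h1).2
      rcases mem_union.1 h2 with h2 | h2 <;> have := (mem_filter.1 h2).2 <;> omega
    · rw [disjoint_left]
      intro z h1 h2
      have := (mem_filter.1 h1).2
      have := (mem_filter.1 h2).2
      omega
  have hone : level r P i = rich r P i 1 := rich_one.symm
  have hr2 : k ≤ #(rich r P (i + 1) 2) + #Z₁ := by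
    have h1 := subset_rich_two_mul (r := r) (P := P) (l := i) (θ := 1)
    rw [rich_one, mul_one] at h1
    have h2 := card_le_card h1
    have h3 : #{z ∈ level r P (i + 1) | 2 ≤ #(N z)} + #Z₁ = #(level r P (i + 1)) :=
      card_filter_add_card_filter_not _
    rw [ho (i + 1) (by omega) (by omega)] at h3
    change #{z ∈ level r P (i + 1) | 2 ≤ #(N z)} ≤ _ at h2
    omega
  have hr3 : #Z₃ ≤ #(rich r P (i + 1) 3) := by
    refine card_le_card fun z hz => ?_
    obtain ⟨h1, h2⟩ := mem_filter.1 hz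
    have h3 := sum_maxBelow_le (r := r) (P := P) (z := z) (S := N z) (by
      intro u hu
      obtain ⟨h4, h5⟩ := mem_filter.1 hu
      exact ⟨(mem_level.1 h4).1, h5, by rw [(mem_level.1 h4).2, (mem_level.1 h1).2]⟩)
    have h4 : #(N z) ≤ ∑ u ∈ N z, maxBelow r P u := by
      rw [card_eq_sum_ones]
      exact sum_le_sum fun u _ => maxBelow_pos
    exact mem_rich.2 ⟨(mem_level.1 h1).1, (mem_level.1 h1).2, by omega⟩
  have hex : ∀ l, i < l → l ≤ k + j → excess r P k l = j := by
    intro l hl hl'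
    rw [excess_eq_sum, sum_eq_single_of_mem i (mem_range.2 hl), hbig]
    · push_cast; ring
    · intro l' h1 h2
      rw [ho l' (by have := mem_range.1 h1; omega) h2, sub_self]
  have hL2 := Nat.one_le_pow 2 L (by have := h.sizes.two_le_L; omega)
  have h2all : ∀ l, i < l → l < k + j → k - #Z₁ ≤ #(rich r P l 2) := by
    intro l hl hl'
    have hS : Spread r P k (i + 1) 2 ((j + #Z₁ : ℕ) : ℤ) := by
      rw [Spread, hex _ (by omega) (by omega)]
      omega
    obtain ⟨σ, y, -, -, -, hR⟩ := h.climb (s := 0) (θ₀ := 2) (X₀ := j + #Z₁) (σ₀ := 0) (y₀ := 0)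
      (Nat.zero_le _) (by omega) (by omega) ⟨le_rfl, by omega, by omega, by simpa using hS⟩
      (show i + 1 ≤ l by omega) hl'
    rcases Nat.eq_zero_or_pos y with rfl | hy
    · obtain rfl : σ = 0 := by have := hR.1; omega
      have h1 := hR.2.2.2
      rw [Spread, hex _ (by omega) (by omega)] at h1
      simp only [pow_zero, one_mul, Nat.cast_zero, add_zero, zero_mul] at h1
      omega
    · obtain ⟨σ', y', -, hy', -, hR'⟩ := h.climb (s := 0) (θ₀ := 2) (X₀ := j + #Z₁)
        (Nat.zero_le _) (by omega) (by omega) hR (show l ≤ k + j - 1 by omega) (by omega)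
      obtain rfl : σ' = 0 := by have := hR'.1; omega
      exact (h.false_of_pos (Nat.zero_le _) (by omega) hR' (by omega) (by omega)).elim
  have hF := h.mono_le
  rw [extremal_eq' h.t_le h.one_le h.card_eq, mul_choose_add (by omega)] at hF
  have hmono : mono r P (k + 1) = #(chains r P (k + 1)) + #(antis r P (k + 1)) := rfl
  rw [hmono] at hF
  obtain ⟨b1, b2, b3⟩ := through_bounds h.sizes hi
  have hlev : ∀ l < k + j, k ≤ #(level r P l) := by
    intro l hl
    by_cases hli : l = i
    · rw [hli, hbig]; omega
    · exact (ho l hl hli).ge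
  have hrk : ∀ x ∈ P, rk r P x < k + j := fun x hx => h.rk_lt hx
  have hw : 0 < (k + j - 1).choose k := Nat.choose_pos (by omega)
  obtain ⟨d, hd⟩ : ∃ d, k = #Z₁ + d := ⟨k - #Z₁, by omega⟩
  have e1 : d * i.choose k ≤ k * i.choose k := Nat.mul_le_mul_right _ (by omega)
  have e2 : (k + j) * (k + j - 1).choose k = d * (k + j - 1).choose k +
      (#Z₁ + j) * (k + j - 1).choose k := by
    have : k + j = d + (#Z₁ + j) := by omega
    conv_lhs => rw [this]
    rw [add_mul]
    rw [this]
  by_cases hm : k ≤ 10 * #Z₃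
  · -- many elements with three longest chains below them
    have hS : Spread r P k (i + 1) 3 ((k + j - #Z₃ : ℕ) : ℤ) := by
      rw [Spread, hex _ (by omega) (by omega)]
      omega
    obtain ⟨σ, y, -, -, -, hR⟩ := h.climb (s := 0) (θ₀ := 3) (X₀ := k + j - #Z₃) (σ₀ := 0)
      (y₀ := 0) (Nat.zero_le _) (by omega) (by omega)
      ⟨le_rfl, by omega, by omega, by simpa using hS⟩
      (show i + 1 ≤ k + j - 1 by omega) (by omega)
    obtain rfl : σ = 0 := by have := hR.1; omega
    have h1 := hR.2.2.2
    have hy : y * (j * L + j) ≤ 2 * (j * L) * (j * L + j) :=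
      Nat.mul_le_mul_right _ hR.2.2.1.le
    have h2 : Spread r P k (k + j - 1) 3 ((k + j - #Z₃ + y * (j * L + j) : ℕ) : ℤ) := by
      refine h1.weaken ?_ (by push_cast; simp)
      have := Nat.one_le_two_pow (n := y)
      omega
    have h3 := h.card_rich_top h2
    obtain ⟨e, he⟩ : ∃ e, e = k / 20 := ⟨_, rfl⟩
    have h4 := le_card_chains_of_rich (r := r) (P := P) (i := i) (d := d) (e := e) (by omega) hrk
      (by omega) hlev (fun l h5 h6 => by have := h2all l h5 h6; omega) (by omega)
    have h5 := (choose_sub_sub (k := k) (j := j) (u := 2) (by omega) (by omega)).1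
    rw [show k + j - 1 - 2 = k + j - 3 by omega] at h5
    have h6 : (k + j - 1).choose k ≤ 2 * (k + j - 3).choose (k - 2) := by
      have : k * (k + j - 1).choose k ≤ k * (2 * (k + j - 3).choose (k - 2)) := by
        have : 2 * (2 * 2 * j * (k + j - 1).choose k) ≤ k * (k + j - 1).choose k := by
          rw [← mul_assoc]
          exact Nat.mul_le_mul_right _ (by omega)
        linarith
      exact Nat.le_of_mul_le_mul_left this (by omega)
    have h7 : (2 * (#Z₁ + j + 1)) * (k + j - 1).choose k ≤ e * (k + j - 1).choose k :=
      Nat.mul_le_mul_right _ (by omega)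
    have h8 : e * (k + j - 1).choose k ≤ e * (2 * (k + j - 3).choose (k - 2)) :=
      Nat.mul_le_mul_left _ h6
    have e3 : 2 * (#Z₁ + j + 1) * (k + j - 1).choose k =
      2 * ((#Z₁ + j) * (k + j - 1).choose k) + 2 * (k + j - 1).choose k := by ring
    have e4 : e * (2 * (k + j - 3).choose (k - 2)) = 2 * (e * (k + j - 3).choose (k - 2)) := by
      ring
    omega
  · -- many pairs of elements with a common lower neighbour
    have h4 := le_card_chains_of_rich (r := r) (P := P) (i := i) (d := d) (e := 0) (by omega) hrk
      (by omega) hlev (fun l h5 h6 => by have := h2all l h5 h6; omega) (by omega)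
    obtain ⟨p, hp, hna⟩ := le_card_antis_of_neighbours (r := r) (P := P) (k := k) (j := j) (i := i)
      (Z₁ := Z₁) (Z₂ := Z₂) (by omega) hbig.ge (by omega) (filter_subset _ _) (filter_subset _ _)
      (by
        rw [disjoint_left]
        intro z h1 h2
        have := (mem_filter.1 h1).2
        have := (mem_filter.1 h2).2
        omega)
      (fun z hz => by have : ¬2 ≤ #(N z) := (mem_filter.1 hz).2; change #(N z) ≤ 1; omega)
      (fun z hz => (mem_filter.1 hz).2)
    rw [hbig] at hp
    have g1 : 1000 * (k + j) ≤ 1001 * k := by omega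
    have g2 : (88 * k) * (k + j - 2).choose k ≤ (100 * #Z₂) * (k + j - 2).choose k :=
      Nat.mul_le_mul_right _ (by omega)
    have g3 : (35 * k) * (k + j - 3).choose (k - 1) ≤ (100 * p) * (k + j - 3).choose (k - 1) :=
      Nat.mul_le_mul_right _ (by omega)
    obtain ⟨j', rfl⟩ : ∃ j', j = j' + 2 := ⟨j - 2, by omega⟩
    rw [show j' + 2 - 1 = j' + 1 by omega] at b2 b3
    generalize (k + (j' + 2) - 1).choose k = w at *
    generalize (k + (j' + 2) - 2).choose k = b at *
    generalize (k + (j' + 2) - 3).choose (k - 1) = c at *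
    generalize k * i.choose k = g at *
    have e3 : (#Z₁ + (j' + 2)) * w = #Z₁ * w + (j' + 1) * w + w := by ring
    have e4 : (j' + 1) * w = j' * w + w := by ring
    have e5 : 88 * k * b = 88 * (k * b) := by ring
    have e6 : 35 * k * c = 35 * (k * c) := by ring
    have e7 : 100 * #Z₂ * b = 100 * (#Z₂ * b) := by ring
    have e8 : 100 * p * c = 100 * (p * c) := by ring
    rw [e3] at e2
    rw [e2] at hF
    rw [e5, e7] at g2
    rw [e6, e8] at g3
    rw [zero_mul, add_zero] at h4
    generalize k * (k + (j' + 2)).choose (k + 1) = kk at *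
    omega

end

section

variable {α : Type*} {r s : α → α → Prop} {P Q A U V Z W Y S D : Finset α} {x y z : α}
  {m k i j p q l t θ Λ E L : ℕ} {X : ℤ}

/-! ### The reversed order -/

theorem isChain_flip {C : Set α} : IsChain (flip r) C ↔ IsChain r C :=
  ⟨fun h => h.symm, fun h => h.symm⟩

theorem isAntichain_flip {C : Set α} : IsAntichain (flip r) C ↔ IsAntichain r C :=
  ⟨fun h => h.flip, fun h => h.flip⟩

theorem chains_flip : chains (flip r) P m = chains r P m := by
  ext C
  rw [mem_chains, mem_chains, isChain_flip]

theorem antis_flip : antis (flip r) P m = antis r P m := by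
  ext C
  rw [mem_antis, mem_antis, isAntichain_flip]

theorem mono_flip : mono (flip r) P m = mono r P m := by
  rw [mono, mono, chains_flip, antis_flip]

theorem Tight.flip (h : Tight r P k j L t) : Tight (flip r) P k j L t where
  chain_le C hC hc := h.chain_le C hC (isChain_flip.1 hc)
  anti_le C hC hc := h.anti_le C hC (isAntichain_flip.1 hc)
  chains_lt := by rw [chains_flip]; exact h.chains_lt
  antis_lt := by rw [antis_flip]; exact h.antis_lt
  le_succ := h.le_succ
  j_le := h.j_le
  sizes := h.sizes
  one_le := h.one_le
  t_le := h.t_le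
  card_eq := h.card_eq
  extremal_le Q hQ hlt := by rw [mono_flip]; exact h.extremal_le Q hQ hlt
  robust := by
    intro Y hY
    rw [chains_flip] at hY
    exact h.robust Y hY
  mono_le := by rw [mono_flip]; exact h.mono_le

theorem isStrictOrder_flip [IsStrictOrder α r] : IsStrictOrder α (flip r) where
  irrefl a := irrefl (r := r) a
  trans _ _ _ h1 h2 := _root_.trans (r := r) h2 h1

variable [IsStrictOrder α r]

/-- The longest chains below and above an element form a chain. -/
theorem Bounded.rk_add_rk_flip_lt (h : Bounded r P k j Λ) (hx : x ∈ P) :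
    rk r P x + rk (flip r) P x < k + j := by
  obtain ⟨C, h1, h2, h3⟩ := exists_rk_chain r P x
  obtain ⟨C', h1', h2', h3'⟩ := exists_rk_chain (flip r) P x
  have hx1 : ∀ c ∈ C, r c x := fun c hc => (mem_below.1 (h1 hc)).2
  have hx2 : ∀ c ∈ C', r x c := fun c hc => (mem_below.1 (h1' hc)).2
  have h4 : IsChain r ((insert x C' : Finset α) : Set α) := by
    rw [coe_insert]
    exact (isChain_flip.1 h2').insert fun c hc _ => Or.inl (hx2 c hc)
  have h5 : ∀ c ∈ C, ∀ d ∈ insert x C', r c d := by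
    intro c hc d hd
    rcases mem_insert.1 hd with rfl | hd
    · exact hx1 c hc
    · exact _root_.trans (hx1 c hc) (hx2 d hd)
  have h6 := h.chain_le (C ∪ insert x C') (union_subset (h1.trans below_subset)
    (insert_subset hx (h1'.trans below_subset))) (isChain_union_of_lt h2 h4 h5)
  rw [card_union_of_disjoint, card_insert_of_notMem, h3, h3'] at h6
  · omega
  · exact fun hcon => irrefl (r := r) x (hx2 x hcon)
  · rw [disjoint_left]
    exact fun c hc hc' => irrefl (r := r) c (h5 c hc c hc')

theorem Bounded.level_flip_subset (h : Bounded r P k j Λ) (hl : l + i + 1 = k + j) :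
    level (_root_.flip r) P l ⊆ {x ∈ P | rk r P x < i + 1} := fun x hx => by
  have h1 := mem_level.1 hx
  have := h.rk_add_rk_flip_lt h1.1
  exact mem_filter.2 ⟨h1.1, by omega⟩

omit [IsStrictOrder α r] in
theorem filter_rk_lt_one : {x ∈ P | rk r P x < 1} = level r P 0 := by
  ext x
  rw [mem_filter, mem_level, Nat.lt_one_iff]

theorem Bounded.card_level_flip_le (h : Bounded r P k j Λ) (hk : 1 ≤ k) :
    #(level (_root_.flip r) P (k + j - 1)) ≤ #(level r P 0) := by
  have := card_le_card (h.level_flip_subset (l := k + j - 1) (i := 0) (by omega))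
  rwa [filter_rk_lt_one] at this

/-- The last two levels of the reversed order consist of elements of the first two levels. -/
theorem Bounded.card_two_levels_flip_le (h : Bounded r P k j Λ) (hk : 2 ≤ k) :
    #(level (_root_.flip r) P (k + j - 2)) + #(level (_root_.flip r) P (k + j - 1)) ≤
      #(level r P 0) + #(level r P 1) := by
  have h1 := h.level_flip_subset (l := k + j - 2) (i := 1) (by omega)
  have h2 := h.level_flip_subset (l := k + j - 1) (i := 0) (by omega)
  have h3 : Disjoint (level (_root_.flip r) P (k + j - 2)) (level (_root_.flip r) P (k + j - 1)) := by
    rw [disjoint_left]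
    intro x hx hx'
    have := (mem_level.1 hx).2
    have := (mem_level.1 hx').2
    omega
  have h4 : {x ∈ P | rk r P x < 1 + 1} ⊆ level r P 0 ∪ level r P 1 := fun x hx => by
    obtain ⟨h5, h6⟩ := mem_filter.1 hx
    rw [mem_union, mem_level, mem_level]
    rcases Nat.lt_succ_iff_lt_or_eq.1 h6 with h7 | h7
    · exact Or.inl ⟨h5, by omega⟩
    · exact Or.inr ⟨h5, h7⟩
  rw [← card_union_of_disjoint h3]
  refine (card_le_card ((union_subset h1 (fun x hx => ?_)).trans h4)).trans (card_union_le _ _)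
  have := mem_filter.1 (h2 hx)
  exact mem_filter.2 ⟨this.1, by omega⟩

/-! ### A big top level -/

/-- The elements of the last level but one with enough chains below them and two upper
neighbours. -/
noncomputable def forked (r : α → α → Prop) (P : Finset α) (k j θ : ℕ) : Finset α :=
  {x ∈ rich r P (k + j - 2) θ | 2 ≤ #{y ∈ level r P (k + j - 1) | r x y}}

/-- If the top level is big, most elements of the level before have two upper neighbours, by
expansion in the reversed order. -/
theorem Tight.card_forked (h : Tight r P k j L t) (hq : k < #(level r P (k + j - 1))) {X : ℕ}
    (hS : Spread r P k (k + j - 2) θ X) :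
    k ≤ #(forked r P k j θ) + (X + (j * L + j) + j) := by
  have hj := h.sizes.two_le_j
  have hk := h.j_le
  have h1 := h.excess_top
  rw [excess_succ, show k + j - 1 = k + j - 2 + 1 by omega] at h1
  have h2 := h.toBounded.card_level_le (l := k + j - 2 + 1)
  have h3 : #{x ∈ level r P (k + j - 2) | ¬2 ≤ #{y ∈ level r P (k + j - 1) | r x y}} ≤
      j * L + j := by
    have hexp := expansion (r := _root_.flip r) (P := P) (U := level r P (k + j - 1))
      (V := level r P (k + j - 2)) (k := k) (j := j) (Λ := j * L) level_subset level_subset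
      (isAntichain_flip.2 level_antichain) (isAntichain_flip.2 level_antichain) (by
        rw [disjoint_left]
        intro x hx hx'
        have := (mem_level.1 hx).2
        have := (mem_level.1 hx').2
        omega) (by
        intro u hu v hv hr
        have := rk_lt_rk (mem_level.1 hu).1 (hr : r u v)
        have := (mem_level.1 hu).2
        have := (mem_level.1 hv).2
        omega) h.flip.anti_le h.flip.antis_lt h.le_succ
    have h4 : #{x ∈ level r P (k + j - 2) | 2 ≤ #{y ∈ level r P (k + j - 1) | r x y}} +
        #{x ∈ level r P (k + j - 2) | ¬2 ≤ #{y ∈ level r P (k + j - 1) | r x y}} =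
        #(level r P (k + j - 2)) := card_filter_add_card_filter_not _
    rcases hexp with h5 | h5
    · have := h5.trans (Nat.add_le_add_right (card_filter_le _ _) _)
      omega
    · change _ ≤ #{x ∈ level r P (k + j - 2) | 2 ≤ #{y ∈ level r P (k + j - 1) | r x y}} + _ + _
        at h5
      omega
  have h4 : rich r P (k + j - 2) θ ⊆ forked r P k j θ ∪
      {x ∈ level r P (k + j - 2) | ¬2 ≤ #{y ∈ level r P (k + j - 1) | r x y}} := by
    intro x hx
    by_cases hx2 : 2 ≤ #{y ∈ level r P (k + j - 1) | r x y}
    · exact mem_union_left _ (mem_filter.2 ⟨hx, hx2⟩)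
    · exact mem_union_right _ (mem_filter.2 ⟨rich_subset_level hx, hx2⟩)
  have h5 := (card_le_card h4).trans (card_union_le _ _)
  unfold Spread at hS
  omega

omit [IsStrictOrder α r] in
theorem forked_subset : forked r P k j θ ⊆ rich r P (k + j - 2) θ := filter_subset _ _

/-- If the top level is big, it suffices to reach the level before with half as many chains:
this level is cut off. -/
theorem Tight.false_of_reach_pre (h : Tight r P k j L t) (hq : k < #(level r P (k + j - 1)))
    {a y : ℕ} (ha : a + 2 ≤ 2 * L ^ 2) (hR : Reach r P k j (j * L) a 1 (0 : ℕ) (k + j - 2) a y)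
    (ht : t ≤ 2 * j * a + 1) : False := by
  obtain ⟨f1, f2, f3, f4, f5, f6, f7, f8⟩ := h.sizes.facts
  obtain ⟨g1, g2, g3, g4, g5⟩ := h.sizes.bounds (θ := 2 * (1 + a)) (σ := a + 2) (by omega)
    (by omega)
  have hk := h.sizes.sq_le
  have hk' := h.sizes.pow_le
  have hj := h.sizes.two_le_j
  have htb := h.bounds.1
  have hanti : ∀ θ, IsAntichain r (forked r P k j θ : Set α) := fun θ =>
    rich_antichain.subset (by exact_mod_cast forked_subset)
  have hdeg : ∀ θ, 2 * θ ≤ k → ∀ x ∈ forked r P k j θ,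
      ∑ u ∈ range (2 * θ), (k + j - 1 - u).choose (k - u) ≤ #{C ∈ chains r P (k + 1) | x ∈ C} :=
    fun θ hθ x hx => le_card_through_pre (by omega) (mem_filter.1 hx).1 (mem_filter.1 hx).2 hθ
  have haj : 2 * (1 + a) * 1 ≤ 2 * (1 + a) * j := Nat.mul_le_mul_left _ (by omega)
  obtain ⟨-, -, h1, h2⟩ := hR
  rcases Nat.eq_zero_or_pos y with rfl | hy
  · have h3 : Spread r P k (k + j - 2) (1 + a) ((a * (j * L + j) : ℕ) : ℤ) := by simpa using h2
    have h4 := h.card_forked hq h3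
    refine h.false_of_one (θ := 2 * (1 + a)) (forked_subset.trans rich_subset) (hanti (1 + a))
      (hdeg _ (by omega)) (X := (a + 2) * (j * L + j)) ?_ (by omega) ?_
    · have : (a + 2) * (j * L + j) = a * (j * L + j) + 2 * (j * L + j) := by ring
      omega
    · have e1 : j * (2 * (1 + a)) * ((a + 2) * (j * L + j) + j * (2 * (1 + a))) =
          j * ((a + 2) * (j * L + j) * (2 * (1 + a)) + j * (2 * (1 + a)) ^ 2) := by ring
      have e2 : j * ((a + 2) * (j * L + j) * (2 * (1 + a)) + j * (2 * (1 + a)) ^ 2) ≤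
          j * (32 * (j * L ^ 5)) := Nat.mul_le_mul_left _ (by omega)
      have e3 : 4 * (j * (32 * (j * L ^ 5)) + t * j + j) ≤ j * k := by
        calc _ = j * (4 * (32 * (j * L ^ 5) + t + 1)) := by ring
          _ ≤ _ := Nat.mul_le_mul_left _ (by omega)
      have e4 : k * t ≤ k * (2 * j * a + 1) := Nat.mul_le_mul_left _ ht
      have e5 : 2 * k ≤ j * k := Nat.mul_le_mul_right _ hj
      have e6 : j * k * (2 * (1 + a)) = 2 * (j * k) + k * (2 * j * a) := by ring
      rw [e1, e6]
      have e7 : k * (2 * j * a + 1) = k * (2 * j * a) + k := by ring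
      have e8 : j * k + t * (k + j) + j = j * k + k * t + t * j + j := by ring
      rw [e8]
      omega
  · have h3 : Spread r P k (k + j - 2) (min (2 ^ y * (1 + a)) (t + 2))
        ((a * (j * L + j) + y * (j * L + j) : ℕ) : ℤ) := by
      refine h2.weaken (min_le_left _ _) ?_
      push_cast
      linarith
    have h4 := h.card_forked hq h3
    have h5 : y * (j * L + j) ≤ 2 * (j * L) * (j * L + j) := Nat.mul_le_mul_right _ h1.le
    have h6 := min_le_right (2 ^ y * (1 + a)) (t + 2)
    have h7 : a * (j * L + j) ≤ (a + 2) * (j * L + j) := Nat.mul_le_mul_right _ (by omega)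
    refine h.false_of_many (by omega) (forked_subset.trans rich_subset) (hanti _)
      (hdeg _ (by omega)) h4 (by omega) ?_
    rcases min_choice (2 ^ y * (1 + a)) (t + 2) with h8 | h8 <;> rw [h8]
    · have h9 : 2 ^ 1 ≤ 2 ^ y := Nat.pow_le_pow_right (by omega) hy
      calc 2 * t + 2 * j ≤ j * (2 * (2 ^ 1 * (1 + a))) := by linarith
        _ ≤ _ := by gcongr
    · have : t * 2 ≤ t * j := Nat.mul_le_mul_left _ hj
      have e : j * (2 * (t + 2)) = 2 * (t * j) + 4 * j := by ring
      omega

/-- If the first and the last level are big, then the surplus is at least `2 * j + 2` and no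
level is big strictly between the first one and the last two. Otherwise the big levels up to the
last but two supply enough chains for `Tight.false_of_reach_pre`. -/
theorem Tight.two_ends (h : Tight r P k j L t) (h0 : k < #(level r P 0))
    (hq : k < #(level r P (k + j - 1))) :
    2 * j + 2 ≤ t ∧ ∀ l, 1 ≤ l → l < k + j - 2 → #(level r P l) ≤ k := by
  obtain ⟨f1, f2, f3, f4, f5, f6, f7, f8⟩ := h.sizes.facts
  have hj := h.sizes.two_le_j
  have hL2 : 2 ^ 2 ≤ L ^ 2 := Nat.pow_le_pow_left h.sizes.two_le_L 2
  have htb := h.bounds.1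
  have h1t := h.one_le
  set G := #(bigLevels r P k 0 (k + j - 2)) with hG
  have h0G : 0 ∈ bigLevels r P k 0 (k + j - 2) :=
    mem_filter.2 ⟨mem_Ico.2 ⟨le_rfl, by omega⟩, h0⟩
  have hG1 : 1 ≤ G := card_pos.2 ⟨0, h0G⟩
  have htG : t ≤ j * (G + 2) := by
    have h1 := h.excess_top
    have h2 := h.toBounded.excess_le (Nat.zero_le (k + j - 2))
    rw [excess_zero, ← hG] at h2
    rw [excess_succ, show k + j - 1 = k + j - 2 + 1 by omega, excess_succ] at h1
    have h3 := h.toBounded.card_level_le (l := k + j - 2 + 1)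
    have h4 := h.toBounded.card_level_le (l := k + j - 2)
    have h5 : (t : ℤ) ≤ j * G + j + j := by omega
    have : t ≤ j * G + j + j := by exact_mod_cast h5
    linarith
  by_contra hcon
  have hor : t ≤ 2 * j + 1 ∨ 2 ≤ G := by
    by_contra! hno
    refine hcon ⟨by omega, fun l hl hl' => ?_⟩
    by_contra! hbig
    have : 1 < G := one_lt_card.2 ⟨0, h0G, l, mem_filter.2 ⟨mem_Ico.2 ⟨by omega, hl'⟩, hbig⟩,
      by omega⟩
    omega
  obtain ⟨a, ha1, ha2, ha3⟩ : ∃ a, t ≤ 2 * j * a + 1 ∧ a ≤ G ∧ a ≤ L ^ 2 + 1 := by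
    refine ⟨(t + 2 * j - 2) / (2 * j), ?_, ?_, ?_⟩
    · have := Nat.lt_div_mul_add (a := t + 2 * j - 2) (b := 2 * j) (by omega)
      rw [mul_comm (2 * j)]
      omega
    · rw [← Nat.lt_succ_iff, Nat.div_lt_iff_lt_mul (by omega)]
      have : G.succ * (2 * j) = 2 * (j * G) + 2 * j := by rw [Nat.succ_eq_add_one]; ring
      rcases hor with hor | hor
      · have : j * 1 ≤ j * G := Nat.mul_le_mul_left _ hG1
        omega
      · have : j * 2 ≤ j * G := Nat.mul_le_mul_left _ hor
        have : j * (G + 2) = j * G + 2 * j := by ring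
        omega
    · rw [← Nat.lt_succ_iff, Nat.div_lt_iff_lt_mul (by omega)]
      have : (L ^ 2 + 1).succ * (2 * j) = 2 * (j * L ^ 2) + 4 * j := by
        rw [Nat.succ_eq_add_one]; ring
      omega
  obtain ⟨σ, y, -, -, h2, hR⟩ := h.climb (s := a) (by omega) le_rfl (by omega)
    (h.reach_zero a) (Nat.zero_le (k + j - 2)) (by omega)
  obtain rfl : σ = a := by have := hR.1; omega
  exact h.false_of_reach_pre hq (by omega) hR ha1

/-- There is no set with the properties collected in `Tight`. If the top level of the order or
of its reverse is not big, then `Tight.profile` leaves one big level, which can be assumed not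
to be among the last two. If both top levels are big, `Tight.two_ends` applies to the order and
to its reverse. In the reverse, only the first and the last two levels can be big, and the last
two together have a surplus of at most `j`, as their elements lie in the first two levels of the
order. The whole surplus is then at most `2 * j`, a contradiction. -/
theorem Tight.false (h : Tight r P k j L t) : False := by
  obtain ⟨f1, f2, f3, f4, f5, f6, f7, f8⟩ := h.sizes.facts
  have hj := h.sizes.two_le_j
  have := isStrictOrder_flip (r := r)
  have h' := h.flip
  have a1 := h.toBounded.card_level_flip_le (by omega)
  have a2 := h'.toBounded.card_level_flip_le (by omega)
  have a3 := h.toBounded.card_two_levels_flip_le (by omega)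
  change #(level r P (k + j - 1)) ≤ _ at a2
  by_cases hd : #(level r P (k + j - 1)) ≤ k
  · obtain ⟨rfl, i, hi, hbig, ho⟩ := h.profile hd
    by_cases hi3 : i + 3 ≤ k + t
    · exact h.false_of_one_big hi3 hbig ho
    have b0 := ho 0 (by omega) (by omega)
    have b1 := ho 1 (by omega) (by omega)
    obtain ⟨-, i', hi', hbig', ho'⟩ := h'.profile (by omega)
    by_cases hi3' : i' + 3 ≤ k + t
    · exact h'.false_of_one_big hi3' hbig' ho'
    have b2 := ho' (k + t - 1) (by omega) (by omega)
    rw [show i' = k + t - 2 by omega] at hbig'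
    omega
  · by_cases hd' : #(level (_root_.flip r) P (k + j - 1)) ≤ k
    · obtain ⟨rfl, i', hi', hbig', ho'⟩ := h'.profile hd'
      have : i' = 0 := by
        by_contra hne
        have := ho' 0 (by omega) (by omega)
        omega
      subst this
      exact h'.false_of_one_big (by omega) hbig' ho'
    · obtain ⟨c1, c2⟩ := h.two_ends (by omega) (by omega)
      obtain ⟨-, c3⟩ := h'.two_ends (by omega) (by omega)
      have e1 := c2 1 le_rfl (by omega)
      have e2 := h.toBounded.card_level_le (l := 0)
      have e3 := h'.excess_top
      have e4 := h'.toBounded.excess_le (Nat.zero_le (k + j - 2))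
      have e5 : #(bigLevels (_root_.flip r) P k 0 (k + j - 2)) ≤ 1 := by
        refine (card_le_card (t := {0}) fun l hl => ?_).trans (card_singleton _).le
        obtain ⟨h1, h2⟩ := mem_filter.1 hl
        rw [mem_singleton]
        by_contra hne
        have := c3 l (by omega) (mem_Ico.1 h1).2
        omega
      rw [excess_succ, show k + j - 1 = k + j - 2 + 1 by omega, excess_succ] at e3
      rw [show k + j - 1 = k + j - 2 + 1 by omega] at a3
      rw [excess_zero, zero_add] at e4
      have e6 : (j : ℤ) * #(bigLevels (_root_.flip r) P k 0 (k + j - 2)) ≤ j * 1 :=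
        mul_le_mul_of_nonneg_left (by exact_mod_cast e5) (by positivity)
      omega

end

/-! ### Induction on the number of elements -/

section

variable {α : Type*} {r s : α → α → Prop} {P : Finset α} {k j t L J ℓ : ℕ}

/-- The extremal number is small enough for `Bounded` to hold with `Λ = j * L`. -/
theorem extremal_lt_two_pow (hj : 2 ≤ j) (hjk : j + 1 ≤ k) (ht : 1 ≤ t) (htk : t ≤ k)
    (hk : k < 2 ^ ℓ) (hL : 2 * ℓ + 1 ≤ L) : extremal k (k * (k + j) + t) < 2 ^ (j * L) := by
  rw [extremal_eq' htk ht rfl]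
  have h1 : (k + j + 1).choose (k + 1) ≤ (2 ^ (ℓ + 1)) ^ j := by
    have h2 : (k + j + 1).choose (k + 1) = (k + j + 1).choose j := by
      rw [← Nat.choose_symm (by omega : k + 1 ≤ k + j + 1)]
      congr 1
      omega
    rw [h2]
    refine (Nat.choose_le_pow _ _).trans (Nat.pow_le_pow_left ?_ _)
    rw [pow_succ]
    omega
  rw [Nat.choose_succ_succ'] at h1
  calc k * (k + j).choose (k + 1) + t * (k + j).choose k
      ≤ k * ((k + j).choose k + (k + j).choose (k + 1)) := by
        have := Nat.mul_le_mul_right ((k + j).choose k) htk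
        linarith
    _ ≤ k * (2 ^ (ℓ + 1)) ^ j := Nat.mul_le_mul_left _ h1
    _ < 2 ^ ℓ * (2 ^ (ℓ + 1)) ^ j := Nat.mul_lt_mul_of_pos_right hk (by positivity)
    _ = 2 ^ (ℓ + (ℓ + 1) * j) := by rw [← pow_mul, ← pow_add]
    _ ≤ 2 ^ (j * L) := by
      refine Nat.pow_le_pow_right (by omega) ?_
      have h3 : j * (2 * ℓ + 1) ≤ j * L := Nat.mul_le_mul_left _ hL
      have h4 : ℓ * 1 ≤ ℓ * j := Nat.mul_le_mul_left _ (by omega)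
      linarith

/-- The number of chains and antichains with `k + 1` elements is at least the extremal number,
and larger if both occur and `#P ≠ k² + k + 1`. -/
theorem extremal_le_mono [IsStrictOrder α r] [IsStrictOrder α s] (hc : Conj r s) (hk : 4 ≤ k)
    (hℓ : k < 2 ^ ℓ) (hL : 2 * ℓ + 1 ≤ L) (hS : ∀ j, 2 ≤ j → j ≤ J → Sizes k j L)
    (hP : #P ≤ k * (k + J) + k) :
    extremal k #P ≤ mono r P (k + 1) ∧ ((chains r P (k + 1)).Nonempty →
      (antis r P (k + 1)).Nonempty → #P ≠ k * k + k + 1 → extremal k #P < mono r P (k + 1)) := by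
  induction P using Finset.strongInduction with
  | H P ih =>
    have hW : ∀ Q ⊆ P, #Q < #P → extremal k #Q ≤ mono r Q (k + 1) := fun Q hQ hlt =>
      (ih Q (hQ.ssubset_of_ne (by rintro rfl; omega)) (by omega)).1
    by_cases hsmall : #P ≤ k * k + k
    · obtain ⟨h1, h2⟩ := extremal_le_mono_of_small (r := r) (P := P) (by omega) hsmall
      exact ⟨h1, fun h3 h4 _ => h2 h3 h4⟩
    -- with the remainder in `{1, …, k}`, the last element adds `C(k + j, k)` to the extremal
    -- number
    obtain ⟨j, t, hj1, ht1, htk, hcard⟩ : ∃ j t, 1 ≤ j ∧ 1 ≤ t ∧ t ≤ k ∧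
        #P = k * (k + j) + t := by
      have h1 := Nat.div_add_mod (#P - 1) k
      have h2 := Nat.mod_lt (#P - 1) (by omega : 0 < k)
      have h3 : k + 1 ≤ (#P - 1) / k := by
        rw [Nat.le_div_iff_mul_le (by omega)]
        have : (k + 1) * k = k * k + k := by ring
        omega
      refine ⟨(#P - 1) / k - k, (#P - 1) % k + 1, by omega, by omega, by omega, ?_⟩
      rw [show k + ((#P - 1) / k - k) = (#P - 1) / k by omega]
      omega
    have hjJ : j ≤ J := by
      by_contra! hlt
      have : k * (k + J + 1) ≤ k * (k + j) := Nat.mul_le_mul_left _ (by omega)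
      have : k * (k + J + 1) = k * (k + J) + k := by ring
      omega
    by_cases hlong : ∃ C ⊆ P, IsChain r (C : Set α) ∧ k + j + 1 ≤ #C
    · obtain ⟨C, h1, h2, h3⟩ := hlong
      have := extremal_le_mono_of_long_chain (r := r) (P := P) (j := j) (by omega) (by omega)
        (fun Q hQ h => hW Q hQ (by omega)) h1 h2 h3
      exact ⟨this.1, fun _ h _ => this.2 h⟩
    by_cases hlong' : ∃ C ⊆ P, IsAntichain r (C : Set α) ∧ k + j + 1 ≤ #C
    · obtain ⟨C, h1, h2, h3⟩ := hlong'
      have := extremal_le_mono_of_long_chain (r := s) (P := P) (j := j) (by omega) (by omega)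
        (fun Q hQ h => by rw [hc.mono_eq]; exact hW Q hQ (by omega)) h1 (hc.isChain_iff.2 h2) h3
      rw [hc.mono_eq, hc.antis_eq] at this
      exact ⟨this.1, fun h _ _ => this.2 h⟩
    have hch : ∀ C ⊆ P, IsChain r (C : Set α) → #C ≤ k + j := fun C h1 h2 => by
      by_contra! h3
      exact hlong ⟨C, h1, h2, h3⟩
    have han : ∀ C ⊆ P, IsAntichain r (C : Set α) → #C ≤ k + j := fun C h1 h2 => by
      by_contra! h3
      exact hlong' ⟨C, h1, h2, h3⟩
    rcases hj1.eq_or_lt with rfl | hj2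
    · obtain ⟨h1, h2⟩ := extremal_le_mono_of_height_width hc hk ht1 htk hcard hch han
      refine ⟨h1, fun _ _ hne => h2 ?_⟩
      by_contra hlt
      have : k * (k + 1) = k * k + k := by ring
      omega
    suffices h : extremal k #P < mono r P (k + 1) from ⟨h.le, fun _ _ _ => h⟩
    by_contra! hle
    have hsz := hS j hj2 hjJ
    obtain ⟨f1, f2, f3, f4, f5, f6, f7, f8⟩ := hsz.facts
    have hkk := hsz.sq_le
    have hlt : mono r P (k + 1) < 2 ^ (j * L) :=
      hle.trans_lt (hcard ▸ extremal_lt_two_pow hj2 (by omega) ht1 htk hℓ hL)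
    have hB : Bounded r P k j (j * L) :=
      ⟨hch, han, (Nat.le_add_right _ _).trans_lt hlt, (Nat.le_add_left _ _).trans_lt hlt,
        by omega, by omega⟩
    rcases hB.robust_or hc hj2 (by omega) (by omega) (by omega) (E := robustness j L) le_rfl
      with hR | hR
    · exact (Tight.mk hB hsz ht1 htk hcard hW hR hle).false
    · exact (Tight.mk (hB.conj hc) hsz ht1 htk hcard
        (fun Q hQ h => by rw [hc.mono_eq]; exact hW Q hQ h) hR (by rw [hc.mono_eq]; exact hle)).false

end

/-! ### Permutations -/

section

variable {n k : ℕ} {σ : Equiv.Perm (Fin n)}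

/-- The order on positions whose chains are the increasing subsequences of `σ`. -/
def incRel (σ : Equiv.Perm (Fin n)) (x y : Fin n) : Prop := x < y ∧ σ x < σ y

/-- The order on positions whose chains are the decreasing subsequences of `σ`. -/
def decRel (σ : Equiv.Perm (Fin n)) (x y : Fin n) : Prop := x < y ∧ σ y < σ x

instance : IsStrictOrder (Fin n) (incRel σ) where
  irrefl x h := lt_irrefl x h.1
  trans _ _ _ h1 h2 := ⟨h1.1.trans h2.1, h1.2.trans h2.2⟩

instance : IsStrictOrder (Fin n) (decRel σ) where
  irrefl x h := lt_irrefl x h.1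
  trans _ _ _ h1 h2 := ⟨h1.1.trans h2.1, h2.2.trans h1.2⟩

theorem conj_incRel_decRel : Conj (incRel σ) (decRel σ) := by
  intro x y hxy
  have hne : σ x ≠ σ y := fun h => hxy (σ.injective h)
  unfold incRel decRel
  rcases lt_or_gt_of_ne hxy with h1 | h1 <;> rcases lt_or_gt_of_ne hne with h2 | h2 <;>
    simp [h1, h2, h1.not_gt, h2.not_gt]

theorem incSubseqs_eq : incSubseqs k σ = chains (incRel σ) univ (k + 1) := by
  ext S
  rw [incSubseqs, mem_filter, mem_powersetCard, mem_chains, and_assoc]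
  refine and_congr_right fun _ => and_congr_right fun _ => ⟨fun h x hx y hy hxy => ?_,
    fun h x hx y hy hxy => ?_⟩
  · rcases lt_or_gt_of_ne hxy with h1 | h1
    · exact Or.inl ⟨h1, h hx hy h1⟩
    · exact Or.inr ⟨h1, h hy hx h1⟩
  · rcases h hx hy hxy.ne with h1 | h1
    · exact h1.2
    · exact (hxy.not_gt h1.1).elim

theorem decSubseqs_eq : decSubseqs k σ = antis (incRel σ) univ (k + 1) := by
  rw [← conj_incRel_decRel.chains_eq]
  ext S
  rw [decSubseqs, mem_filter, mem_powersetCard, mem_chains, and_assoc]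
  refine and_congr_right fun _ => and_congr_right fun _ => ⟨fun h x hx y hy hxy => ?_,
    fun h x hx y hy hxy => ?_⟩
  · rcases lt_or_gt_of_ne hxy with h1 | h1
    · exact Or.inl ⟨h1, h hx hy h1⟩
    · exact Or.inr ⟨h1, h hy hx h1⟩
  · rcases h hx hy hxy.ne with h1 | h1
    · exact h1.2
    · exact (hxy.not_gt h1.1).elim

theorem monoCount_eq (hk : 1 ≤ k) : monoCount k σ = mono (incRel σ) univ (k + 1) := by
  rw [monoCount, incSubseqs_eq, decSubseqs_eq,
    card_union_of_disjoint (disjoint_chains_antis (by omega)), mono]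

/-! ### The extremal permutation -/

/-- A sum of `m` binomial coefficients `C(d, k + 1)`, where the steps `d` of `f` are `q` or `q +
1`, depends only on the total `f m`. -/
theorem sum_choose_sub (f : ℕ → ℕ) {q : ℕ} (h0 : f 0 = 0)
    (h1 : ∀ b, f b + q ≤ f (b + 1)) (h2 : ∀ b, f (b + 1) ≤ f b + q + 1) (m : ℕ) :
    ∑ b ∈ range m, (f (b + 1) - f b).choose (k + 1) + m * q * q.choose k =
      m * q.choose (k + 1) + f m * q.choose k := by
  induction m with
  | zero => simp [h0]
  | succ m ih =>
    rw [sum_range_succ]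
    have h3 : f (m + 1) - f m = q ∧ f (m + 1) = f m + q ∨
        f (m + 1) - f m = q + 1 ∧ f (m + 1) = f m + q + 1 := by
      have := h1 m
      have := h2 m
      omega
    rcases h3 with ⟨h3, h4⟩ | ⟨h3, h4⟩
    · rw [h3, h4]
      linarith
    · rw [h3, h4, Nat.choose_succ_succ']
      linarith

/-- The row of `τ` that contains the position `p`. -/
def rowOf (k n p : ℕ) : ℕ := rowIndex k n (n - 1 - p)

theorem rowOf_lt (hk : 0 < k) {p : ℕ} (hp : p < n) : rowOf k n p < k :=
  rowIndex_lt hk (by omega)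

theorem rowOf_bounds (hk : 0 < k) {p : ℕ} (hp : p < n) :
    rowOf k n p * n / k ≤ n - 1 - p ∧ n - 1 - p < (rowOf k n p + 1) * n / k :=
  (rowIndex_eq_iff hk (by omega)).1 rfl

theorem tauVal_eq (p : ℕ) : tauVal k n p =
    rowOf k n p * n / k + (rowOf k n p + 1) * n / k - 1 - (n - 1 - p) := rfl

/-- An ascent of `τ` between two positions means that they lie in the same row. -/
theorem tauVal_lt_iff (hk : 0 < k) {p p' : ℕ} (hpp : p < p') (hp : p' < n) :
    tauVal k n p < tauVal k n p' ↔ rowOf k n p = rowOf k n p' := by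
  have h1 := rowOf_bounds (k := k) (n := n) (p := p) hk (by omega)
  have h2 := rowOf_bounds (k := k) (n := n) (p := p') hk hp
  constructor
  · intro hlt
    by_contra hne
    rcases lt_or_gt_of_ne hne with h | h
    · have h3 : (rowOf k n p + 1) * n / k ≤ rowOf k n p' * n / k :=
        Nat.div_le_div_right (Nat.mul_le_mul_right _ h)
      omega
    · have h3 : (rowOf k n p' + 1) * n / k ≤ rowOf k n p * n / k :=
        Nat.div_le_div_right (Nat.mul_le_mul_right _ h)
      rw [tauVal_eq, tauVal_eq] at hlt
      omega
  · intro h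
    rw [tauVal_eq, tauVal_eq, h]
    rw [h] at h1
    generalize rowOf k n p' * n / k = l at *
    generalize (rowOf k n p' + 1) * n / k = u at *
    omega

theorem incRel_tau_iff (hk : 0 < k) {x y : Fin n} (h : x < y) :
    incRel (tau k n) x y ↔ rowOf k n x = rowOf k n y := by
  rw [← tauVal_lt_iff hk h y.2, incRel, and_iff_right h, tau, dif_pos hk]
  rfl

theorem rowOf_eq_of_isChain (hk : 0 < k) {S : Finset (Fin n)}
    (hS : IsChain (incRel (tau k n)) (S : Set (Fin n))) {x y : Fin n} (hx : x ∈ S) (hy : y ∈ S) :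
    rowOf k n x = rowOf k n y := by
  by_cases hxy : x = y
  · rw [hxy]
  · rcases hS hx hy hxy with h | h
    · exact (incRel_tau_iff hk h.1).1 h
    · exact ((incRel_tau_iff hk h.1).1 h).symm

theorem antis_tau_eq_empty (hk : 0 < k) : antis (incRel (tau k n)) univ (k + 1) = ∅ := by
  rw [eq_empty_iff_forall_notMem]
  intro A hA
  obtain ⟨-, h1, h2⟩ := mem_antis.1 hA
  have h3 : #A ≤ #(range k) := by
    refine card_le_card_of_injOn (fun x : Fin n => rowOf k n x)
      (fun x _ => mem_coe.2 (mem_range.2 (rowOf_lt hk x.2))) fun x hx y hy he => ?_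
    by_contra hne
    rcases lt_or_gt_of_ne hne with h | h
    · exact h2 hx hy hne ((incRel_tau_iff hk h).2 he)
    · exact h2 hy hx (Ne.symm hne) ((incRel_tau_iff hk h).2 he.symm)
  rw [card_range] at h3
  omega

/-- The rows of `τ` have at most the sizes read off from their definition. -/
theorem card_row_le (hk : 0 < k) (b : ℕ) :
    #{x : Fin n | rowOf k n x = b} ≤ (b + 1) * n / k - b * n / k := by
  rw [← Nat.card_Ico]
  refine card_le_card_of_injOn (fun x : Fin n => n - 1 - (x : ℕ)) (fun x hx => ?_)
    fun x _ y _ he => ?_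
  · have h1 := rowOf_bounds (k := k) hk x.2
    rw [(mem_filter.1 (mem_coe.1 hx)).2] at h1
    exact mem_coe.2 (mem_Ico.2 h1)
  · have := x.2
    have := y.2
    have he' : n - 1 - (x : ℕ) = n - 1 - (y : ℕ) := he
    exact Fin.ext (by omega)

theorem card_chains_tau_le (hk : 0 < k) :
    #(chains (incRel (tau k n)) univ (k + 1)) ≤ extremal k n := by
  have h1 : chains (incRel (tau k n)) univ (k + 1) ⊆ (range k).biUnion fun b =>
      powersetCard (k + 1) {x : Fin n | rowOf k n x = b} := by
    intro C hC
    obtain ⟨-, h2, h3⟩ := mem_chains.1 hC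
    obtain ⟨x, hx⟩ : C.Nonempty := card_pos.1 (by omega)
    refine mem_biUnion.2 ⟨rowOf k n x, mem_range.2 (rowOf_lt hk x.2), mem_powersetCard.2
      ⟨fun y hy => mem_filter.2 ⟨mem_univ _, rowOf_eq_of_isChain hk h3 hy hx⟩, h2⟩⟩
  have h2 := sum_choose_sub (k := k) (fun b => b * n / k) (q := n / k) (by simp)
    (fun b => by
      have := Nat.div_add_div_le_add_div (x := b * n) (y := n) (z := k)
      rwa [show (b + 1) * n = b * n + n by ring])
    (fun b => by
      rw [show (b + 1) * n = b * n + n by ring, Nat.add_div hk]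
      split_ifs <;> omega) k
  have h3 := extremal_eq n (n / k) (n % k) (Nat.mod_lt n hk) (Nat.div_add_mod n k).symm
  have h4 : ∑ b ∈ range k, ((b + 1) * n / k - b * n / k).choose (k + 1) = extremal k n := by
    have h5 : k * n / k = n := Nat.mul_div_cancel_left n hk
    have h6 : n * (n / k).choose k = k * (n / k) * (n / k).choose k + n % k * (n / k).choose k := by
      rw [← add_mul, Nat.div_add_mod]
    simp only [h5] at h2
    omega
  rw [← h4]
  refine (card_le_card h1).trans (card_biUnion_le.trans (sum_le_sum fun b _ => ?_))
  rw [card_powersetCard]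
  exact Nat.choose_le_choose _ (card_row_le hk b)

theorem monoCount_tau_le (hk : 1 ≤ k) : monoCount k (tau k n) ≤ extremal k n := by
  rw [monoCount_eq hk, mono, antis_tau_eq_empty hk, card_empty, add_zero]
  exact card_chains_tau_le hk

theorem extremal_eq_floor_ceil (hk : 1 ≤ k) : extremal k n =
    (n % k) * Nat.choose ⌈(n : ℝ) / k⌉₊ (k + 1) +
      (k - n % k) * Nat.choose ⌊(n : ℝ) / k⌋₊ (k + 1) := by
  have h1 := Nat.div_add_mod n k
  have h2 := Nat.mod_lt n hk
  rw [extremal_eq n (n / k) (n % k) h2 h1.symm, Nat.floor_div_eq_div]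
  rcases Nat.eq_zero_or_pos (n % k) with h0 | h0
  · rw [h0]
    simp
  · have h3 : ⌈(n : ℝ) / k⌉₊ = n / k + 1 := by
      have hk0 : (0 : ℝ) < k := by exact_mod_cast hk
      rw [Nat.ceil_eq_iff (Nat.succ_ne_zero _)]
      constructor
      · rw [lt_div_iff₀ hk0, Nat.succ_sub_one]
        have : n / k * k < n := by rw [mul_comm]; omega
        exact_mod_cast this
      · rw [div_le_iff₀ hk0]
        have : n ≤ (n / k + 1) * k := by
          rw [add_mul, mul_comm (n / k)]
          omega
        exact_mod_cast this
    rw [h3, Nat.choose_succ_succ']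
    have h4 : k * (n / k).choose (k + 1) = n % k * (n / k).choose (k + 1) +
        (k - n % k) * (n / k).choose (k + 1) := by
      rw [← add_mul, Nat.add_sub_cancel' h2.le]
    rw [h4]
    ring

/-! ### The sizes -/

/-- The range of sizes in which the asymptotic argument works. -/
theorem exists_sizes : ∃ k₀ : ℕ, ∀ k : ℕ, k₀ ≤ k → ∀ j : ℕ, 2 ≤ j →
    (j : ℝ) ≤ 1 / 6000 * Real.sqrt k / Real.log k → Sizes k j (2 * (Nat.log 2 k + 1) + 1) := by
  have h1 := (Real.isLittleO_pow_log_id_atTop (n := 8)).bound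
    (by norm_num : (0 : ℝ) < 1 / 129600 ^ 2)
  have h2 := tendsto_natCast_atTop_atTop (R := ℝ) |>.eventually h1
  obtain ⟨k₁, hk₁⟩ := Filter.eventually_atTop.1 h2
  refine ⟨max k₁ 3, fun k hk j hj hle => ?_⟩
  have hk3 : 3 ≤ k := (le_max_right _ _).trans hk
  have h3 := hk₁ k ((le_max_left _ _).trans hk)
  have hk0 : (0 : ℝ) < k := by exact_mod_cast (by omega : 0 < k)
  have hlog : 1 ≤ Real.log k := by
    rw [Real.le_log_iff_exp_le hk0]
    have : (3 : ℝ) ≤ k := by exact_mod_cast hk3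
    linarith [Real.exp_one_lt_d9]
  set y := Real.log k with hy
  set s := Real.sqrt k with hs
  have hs0 : 0 ≤ s := Real.sqrt_nonneg _
  have hss : s ^ 2 = k := Real.sq_sqrt hk0.le
  -- the number of binary digits is at most a multiple of the logarithm
  have hL : ((2 * (Nat.log 2 k + 1) + 1 : ℕ) : ℝ) ≤ 6 * y := by
    have h4 : ((2 ^ Nat.log 2 k : ℕ) : ℝ) ≤ k := by
      exact_mod_cast Nat.pow_log_le_self 2 (by omega)
    have h5 := Real.log_le_log (by positivity) h4
    rw [Nat.cast_pow, Real.log_pow, ← hy] at h5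
    have h6 := Real.log_two_gt_d9
    have h7 : (0 : ℝ) ≤ Nat.log 2 k := Nat.cast_nonneg _
    push_cast at h5 ⊢
    nlinarith
  have hlog4 : 129600 * y ^ 4 ≤ s := by
    have h4 : (129600 * y ^ 4) ^ 2 ≤ s ^ 2 := by
      rw [Real.norm_of_nonneg (by positivity), id, Real.norm_of_nonneg hk0.le] at h3
      rw [hss]
      calc (129600 * y ^ 4) ^ 2 = 129600 ^ 2 * y ^ 8 := by ring
        _ ≤ 129600 ^ 2 * (1 / 129600 ^ 2 * (k : ℝ)) := by gcongr
        _ = (k : ℝ) := by ring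
    exact (pow_le_pow_iff_left₀ (by positivity) hs0 (by norm_num)).1 h4
  have hj0 : (0 : ℝ) ≤ j := Nat.cast_nonneg _
  have hjy : (j : ℝ) * y ≤ 1 / 6000 * s := (le_div_iff₀ (by linarith)).1 hle
  generalize hLL : 2 * (Nat.log 2 k + 1) + 1 = L at *
  have hL0 : (0 : ℝ) ≤ L := Nat.cast_nonneg _
  have hjL : (j : ℝ) * L ≤ 1 / 1000 * s := by
    calc (j : ℝ) * L ≤ j * (6 * y) := by gcongr
      _ = 6 * (j * y) := by ring
      _ ≤ 6 * (1 / 6000 * s) := by gcongr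
      _ = _ := by ring
  refine ⟨hj, by omega, ?_, ?_, ?_⟩
  · calc k < 2 ^ (Nat.log 2 k + 1) := Nat.lt_pow_succ_log_self (by norm_num) k
      _ ≤ 2 ^ L := Nat.pow_le_pow_right (by norm_num) (by omega)
  · have : (1000000 : ℝ) * (j * L) ^ 2 ≤ k := by
      calc (1000000 : ℝ) * (j * L) ^ 2 ≤ 1000000 * (1 / 1000 * s) ^ 2 := by gcongr
        _ = s ^ 2 := by ring
        _ = (k : ℝ) := hss
    exact_mod_cast this
  · have : (100000 : ℝ) * (j * L ^ 5) ≤ k := by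
      calc (100000 : ℝ) * (j * L ^ 5) ≤ 100000 * (j * (6 * y) ^ 5) := by gcongr
        _ = 777600000 * ((j * y) * y ^ 4) := by ring
        _ ≤ 777600000 * ((1 / 6000 * s) * y ^ 4) := by gcongr
        _ = s * (129600 * y ^ 4) := by ring
        _ ≤ s * s := by gcongr
        _ = (k : ℝ) := by rw [← sq, hss]
    exact_mod_cast this

end

end MonoCount

theorem mainTheorem2 :
    ∃ (k₀ : ℕ) (c : ℝ), 2 ≤ k₀ ∧ 0 < c ∧
      ∀ k n : ℕ, k₀ ≤ k → (n : ℝ) ≤ (k : ℝ) ^ 2 + c * (k : ℝ) ^ (3 / 2 : ℝ) / Real.log k →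
        minMonoCount k n = monoCount k (tau k n) ∧
        minMonoCount k n =
          (n % k) * Nat.choose ⌈(n : ℝ) / k⌉₊ (k + 1)
            + (k - n % k) * Nat.choose ⌊(n : ℝ) / k⌋₊ (k + 1) ∧
        (n ≠ k ^ 2 + k + 1 →
          ∀ σ : Equiv.Perm (Fin n), monoCount k σ = minMonoCount k n →
            decSubseqs k σ = ∅ ∨ incSubseqs k σ = ∅) := by
  obtain ⟨k₀, hk₀⟩ := MonoCount.exists_sizes
  refine ⟨max k₀ 4, 1 / 6000, by omega, by norm_num, fun k n hk hn => ?_⟩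
  have hk4 : 4 ≤ k := (le_max_right _ _).trans hk
  have hk0 : (0 : ℝ) < k := by exact_mod_cast (by omega : 0 < k)
  have hlog : 0 < Real.log k := Real.log_pos (by exact_mod_cast (by omega : 1 < k))
  -- the size condition reads `n ≤ k (k + B)`, so that the number `j` of extra rows is at most `⌊B⌋`
  set B := 1 / 6000 * Real.sqrt k / Real.log k with hB
  have hB0 : 0 ≤ B := by positivity
  have hpow : (k : ℝ) ^ (3 / 2 : ℝ) = k * Real.sqrt k := by
    rw [show (3 / 2 : ℝ) = 1 + 1 / 2 by norm_num, Real.rpow_add hk0, Real.rpow_one,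
      ← Real.sqrt_eq_rpow]
  have hnB : n ≤ k * (k + ⌊B⌋₊) + k := by
    have h1 : (n : ℝ) ≤ k * (k + ⌊B⌋₊) + k := by
      calc (n : ℝ) ≤ (k : ℝ) ^ 2 + k * B := by
            rw [hpow] at hn
            rw [hB]
            convert hn using 2
            ring
        _ ≤ (k : ℝ) ^ 2 + k * (⌊B⌋₊ + 1) := by
            gcongr
            exact (Nat.lt_floor_add_one B).le
        _ = _ := by ring
    exact_mod_cast h1
  have key : ∀ σ : Equiv.Perm (Fin n), MonoCount.extremal k n ≤ monoCount k σ ∧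
      ((incSubseqs k σ).Nonempty → (decSubseqs k σ).Nonempty → n ≠ k * k + k + 1 →
        MonoCount.extremal k n < monoCount k σ) := by
    intro σ
    have h1 := MonoCount.extremal_le_mono (r := MonoCount.incRel σ) (P := Finset.univ) (J := ⌊B⌋₊)
      (ℓ := Nat.log 2 k + 1) MonoCount.conj_incRel_decRel hk4 (Nat.lt_pow_succ_log_self (by norm_num) k)
      le_rfl (fun j hj hjB => hk₀ k ((le_max_left _ _).trans hk) j hj
        ((Nat.le_floor_iff hB0).1 hjB)) (by rw [Finset.card_univ, Fintype.card_fin]; exact hnB)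
    rw [Finset.card_univ, Fintype.card_fin] at h1
    rw [MonoCount.monoCount_eq (by omega), MonoCount.incSubseqs_eq, MonoCount.decSubseqs_eq]
    exact h1
  have htau : monoCount k (tau k n) = MonoCount.extremal k n :=
    le_antisymm (MonoCount.monoCount_tau_le (by omega)) (key _).1
  have hmin : minMonoCount k n = MonoCount.extremal k n := by
    refine le_antisymm (htau ▸ Nat.sInf_le ⟨tau k n, rfl⟩) ?_
    obtain ⟨σ, hσ⟩ := Nat.sInf_mem (Set.range_nonempty fun σ : Equiv.Perm (Fin n) => monoCount k σ)
    rw [minMonoCount, ← hσ]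
    exact (key σ).1
  refine ⟨hmin.trans htau.symm, hmin.trans (MonoCount.extremal_eq_floor_ceil (by omega)), fun hne σ hσ => ?_⟩
  by_contra! hcon
  have := (key σ).2 hcon.2 hcon.1 (by rwa [← sq])
  omega
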